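/- **Setup.** Fix integers $L>m\ge 0$ and put $n=L-m$. For each $J\ge1$ consider an experiment with $T=JL$ periods and fixed potential outcomes $Y_t(\mathbf w)\in\mathbb R$, $t\in\{1,\dots,T\}$, $\mathbf w\in\{0,1\}^T$ (the potential outcomes and the probabilities below may vary with $J$), such that $Y_t(\mathbf w)$ does not depend on $w_s$ for $s>t$ (non-anticipation) and, for $t\ge m+1$, does not depend on $w_s$ for $s<t-m$ ($m$-carryover). Session $j\in\{1,\dots,J\}$ is $\{(j-1)L+1,\dots,jL\}$. Session labels $Z_1,\dots,Z_J$ are independent with $Z_j\sim\mathrm{Bernoulli}(p_j)$, and the realized path $\mathbf W$ equals $Z_j$ throughout session $j$. For $\ell\in\{1,\dots,n\}$ let $t_{j,\ell}=(j-1)L+m+\ell$, $Y_{j,\ell}(z)=Y_{t_{j,\ell}}(z,\dots,z)$ for $z\in\{0,1\}$, $Y^{\mathrm{obs}}_{j,\ell}=Y_{t_{j,\ell}}(\mathbf W)$, $\mathbf Y_j(z)=(Y_{j,\ell}(z))_{\ell\le n}$, $\mathbf Y_j^{\mathrm{obs}}=(Y^{\mathrm{obs}}_{j,\ell})_{\ell\le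 n}$, and $\tau_\ell=\frac1J\sum_{j=1}^J\{Y_{j,\ell}(1)-Y_{j,\ell}(0)\}$. **Assumptions.** There are $\underline p\in(0,1/2)$ and $C<\infty$, not depending on $J$, with $\underline p\le p_j\le 1-\underline p$ for all $j$ and $J$, and: (a) $\frac1J\sum_{j=1}^J\max\{\|\mathbf Y_j(1)\|,\|\mathbf Y_j(0)\|\}^4\le C$ for all $J\ge1$; (b) the empirical measures $\frac1J\sum_{j=1}^J\delta_{(p_j,\mathbf Y_j(1),\mathbf Y_j(0))}$ converge weakly, as $J\to\infty$, to a probability measure $\nu$; (c) if $(P,\mathbf Y_1,\mathbf Y_0)\sim\nu$, the matrix $\mathbb E_\nu\big[\frac{\mathbf Y_1\mathbf Y_1^\top}{1-P}+\frac{\mathbf Y_0\mathbf Y_0^\top}{P}\big]$ is positive definite. **Statistics.** Let $$\hat{\boldsymbol\tau}=\frac1J\sum_{j=1}^J\Big(\frac{Z_j\mathbf Y_j^{\mathrm{obs}}}{p_j}-\frac{(1-Z_j)\mathbf Y_j^{\mathrm{obs}}}{1-p_j}\Big),\qquad \hat\Sigma_{\mathrm{up}}=\frac1{J^2}\sum_{j=1}^J\mathbf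 Y_j^{\mathrm{obs}}(\mathbf Y_j^{\mathrm{obs}})^\top\Big(\frac{Z_j}{p_j^2}+\frac{1-Z_j}{(1-p_j)^2}\Big),$$ $T_\ell=\hat\tau_\ell/\sqrt{(\hat\Sigma_{\mathrm{up}})_{\ell\ell}}$ and $T_F=\hat{\boldsymbol\tau}^\top\hat\Sigma_{\mathrm{up}}^{-1}\hat{\boldsymbol\tau}$, where any convention (such as a generalized inverse) may be used when $\hat\Sigma_{\mathrm{up}}$ is singular. For each of these statistics, the randomization test redraws the labels $Z^\ast$ independently from the law of $Z$, holds $\{\mathbf Y_j^{\mathrm{obs}}\}$ fixed, and recomputes the statistic. Its Monte Carlo $p$-value from $B$ independent redraws is $(1+N)/(B+1)$, where $N$ is the number of redraws whose statistic is at least the observed one; its exact $p$-value is the conditional probability, given the data, that the recomputed statistic is at least the observed one. Let $\hat p_\ell$ and $\hat p_F$ denote the $p$-values based on $T_\ell$ and $T_F$, in either version, where $B=B_J$ may be fixed or vary with $J$ in any way. **Theorem.** (i) For every $\ell\in\{1,\dots,n\}$, if $\tau_\ell=0$ for every $J$, then $\limsup_{J\to\infty}\mathbb P(\hat p_\ell\le\alpha)\le\alpha$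 for all $\alpha\in(0,1/2)$. (ii) If $\tau_1=\dots=\tau_n=0$ for every $J$, then $\limsup_{J\to\infty}\mathbb P(\hat p_F\le\alpha)\le\alpha$ for all $\alpha\in(0,1)$. (iii) More generally, for every subset $\mathcal L\subseteq\{1,\dots,n\}$, if $\tau_\ell=0$ for all $\ell\in\mathcal L$ and every $J$, then the conclusion of (ii) holds for the statistic formed in the same way from the subvector of $\hat{\boldsymbol\tau}$ and the principal submatrix of $\hat\Sigma_{\mathrm{up}}$ indexed by $\mathcal L$. -/

import Mathlib

open MeasureTheory Filter Topology
open scoped NNReal ENNReal Matrix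

namespace Switchback

/-- Assignment paths over `T` periods (`true` is treatment); period `t` of the text is `t - 1` here. -/
abbrev Path (T : ℕ) : Type := Fin T → Bool

/-- Potential outcomes: `Y t w` is the outcome at time `t` under the assignment path `w`. -/
abbrev Outcomes (T : ℕ) : Type := Fin T → Path T → ℝ

/-- Outcomes at time `t` do not depend on assignments after time `t`. -/
def NonAnticipating {T : ℕ} (Y : Outcomes T) : Prop :=
  ∀ (t : Fin T) (w w' : Path T), (∀ s : Fin T, s ≤ t → w s = w' s) → Y t w = Y t w'

/-- For each time with at least `m` predecessors, outcomes do not depend on assignments more than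
`m` periods in the past. -/
def Carryover {T : ℕ} (m : ℕ) (Y : Outcomes T) : Prop :=
  ∀ (t : Fin T) (w w' : Path T), m ≤ (t : ℕ) →
    (∀ s : Fin T, (t : ℕ) ≤ (s : ℕ) + m → w s = w' s) → Y t w = Y t w'

variable {J L m : ℕ}

/-- The session that contains a time (session `j` is `{jL, …, jL + L - 1}`). -/
def sessionOf (t : Fin (J * L)) : Fin J := (finProdFinEquiv.symm t).1

/-- The `ℓ`-th focal time `jL + m + ℓ` of session `j`; there are `L - m` of them. -/
def focalTime (j : Fin J) (ℓ : Fin (L - m)) : Fin (J * L) :=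
  finProdFinEquiv (j, ⟨m + ℓ, by have := ℓ.2; omega⟩)

/-- The assignment path that is constant on sessions, with session labels `z`. -/
def sessionPath (L : ℕ) (z : Fin J → Bool) : Path (J * L) := fun t => z (sessionOf t)

/-- `Y_{j,ℓ}(b)`: the outcome at the `ℓ`-th focal time of session `j` under the path that is
constantly equal to `b`. -/
def focalOutcome (m : ℕ) (Y : Outcomes (J * L)) (b : Bool) (j : Fin J) (ℓ : Fin (L - m)) : ℝ :=
  Y (focalTime j ℓ) (fun _ => b)

/-- `Y_{j,ℓ}^obs`: the outcome at the `ℓ`-th focal time of session `j` under the realized path. -/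
def observed (m : ℕ) (Y : Outcomes (J * L)) (z : Fin J → Bool) (j : Fin J) (ℓ : Fin (L - m)) : ℝ :=
  Y (focalTime j ℓ) (sessionPath L z)

/-- `τ_ℓ`: the average effect at focal position `ℓ`. -/
noncomputable def tau (m : ℕ) (Y : Outcomes (J * L)) (ℓ : Fin (L - m)) : ℝ :=
  (1 / (J : ℝ)) * ∑ j : Fin J, (focalOutcome m Y true j ℓ - focalOutcome m Y false j ℓ)

/-- The focal outcome vector of session `j`, with its Euclidean norm. -/
noncomputable def focalVec (m : ℕ) (Y : Outcomes (J * L)) (b : Bool) (j : Fin J) :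
    EuclideanSpace ℝ (Fin (L - m)) :=
  WithLp.toLp 2 (focalOutcome m Y b j)

/-- The law of the session labels: independent, the `j`-th one Bernoulli with parameter `p j`. -/
noncomputable def design (p : Fin J → unitInterval) : Measure (Fin J → Bool) :=
  Measure.pi fun j => ProbabilityTheory.bernoulliMeasure true false (p j)

/-- The numerical value of a label. -/
def ind (b : Bool) : ℝ := if b then 1 else 0

/-- The Horvitz–Thompson estimator at each position, for labels `z` and recorded outcomes `y`. -/
noncomputable def htEst {κ : Type*} (p : Fin J → unitInterval) (z : Fin J → Bool)
    (y : Fin J → κ → ℝ) (ℓ : κ) : ℝ :=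
  (1 / (J : ℝ)) * ∑ j : Fin J,
    (ind (z j) * y j ℓ / (p j : ℝ) - (1 - ind (z j)) * y j ℓ / (1 - (p j : ℝ)))

/-- The upper-bound covariance estimator. -/
noncomputable def sigmaUp {κ : Type*} (p : Fin J → unitInterval) (z : Fin J → Bool)
    (y : Fin J → κ → ℝ) : Matrix κ κ ℝ :=
  Matrix.of fun a b => (1 / (J : ℝ) ^ 2) * ∑ j : Fin J, y j a * y j b *
    (ind (z j) / (p j : ℝ) ^ 2 + (1 - ind (z j)) / (1 - (p j : ℝ)) ^ 2)

/-- The upper-bound variance estimator at position `ℓ`. -/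
noncomputable def varUp {κ : Type*} (p : Fin J → unitInterval) (z : Fin J → Bool)
    (y : Fin J → κ → ℝ) (ℓ : κ) : ℝ :=
  (1 / (J : ℝ) ^ 2) * ∑ j : Fin J, (y j ℓ) ^ 2 *
    (ind (z j) / (p j : ℝ) ^ 2 + (1 - ind (z j)) / (1 - (p j : ℝ)) ^ 2)

/-- The position-wise studentized statistic `T_ℓ`. -/
noncomputable def studentized {κ : Type*} (ℓ : κ) (p : Fin J → unitInterval) (z : Fin J → Bool)
    (y : Fin J → κ → ℝ) : ℝ :=
  htEst p z y ℓ / Real.sqrt (varUp p z y ℓ)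

/-- `ginv` is a convention for inverting matrices: it is the inverse on invertible matrices, and
arbitrary (for instance any generalized inverse) on singular ones. -/
def IsInversion {κ : Type*} [Fintype κ] [DecidableEq κ]
    (ginv : Matrix κ κ ℝ → Matrix κ κ ℝ) : Prop :=
  ∀ A : Matrix κ κ ℝ, IsUnit A.det → ginv A = A⁻¹

/-- The quadratic-form statistic `T_F` formed from the full vector of positions. -/
noncomputable def quadStat {κ : Type*} [Fintype κ] (ginv : Matrix κ κ ℝ → Matrix κ κ ℝ)
    (p : Fin J → unitInterval) (z : Fin J → Bool) (y : Fin J → κ → ℝ) : ℝ :=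
  htEst p z y ⬝ᵥ (ginv (sigmaUp p z y) *ᵥ htEst p z y)

/-- The quadratic-form statistic formed from the subvector and the principal submatrix that
belong to a subset `S` of positions. -/
noncomputable def quadStatOn {κ : Type*} (S : Finset κ) (ginv : Matrix S S ℝ → Matrix S S ℝ)
    (p : Fin J → unitInterval) (z : Fin J → Bool) (y : Fin J → κ → ℝ) : ℝ :=
  (fun a : S => htEst p z y a) ⬝ᵥ
    (ginv ((sigmaUp p z y).submatrix (fun a : S => (a : κ)) (fun a : S => (a : κ))) *ᵥ
      (fun a : S => htEst p z y a))

/-- The exact one-sided randomization `p`-value: labels are redrawn from the design while the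
recorded outcomes `y` are held fixed. -/
noncomputable def exactPValue {κ : Type*} (p : Fin J → unitInterval)
    (stat : (Fin J → Bool) → (Fin J → κ → ℝ) → ℝ) (z : Fin J → Bool) (y : Fin J → κ → ℝ) : ℝ :=
  (design p).real {z' | stat z' y ≥ stat z y}

/-- The one-sided Monte Carlo `p`-value `(count + 1) / (B + 1)` from redrawn labels `zs 1, …, zs B`,
with the recorded outcomes `y` held fixed. -/
noncomputable def mcPValue {κ : Type*} {B : ℕ}
    (stat : (Fin J → Bool) → (Fin J → κ → ℝ) → ℝ) (z : Fin J → Bool) (zs : Fin B → Fin J → Bool)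
    (y : Fin J → κ → ℝ) : ℝ :=
  (((Finset.univ.filter fun b : Fin B => stat (zs b) y ≥ stat z y).card : ℝ) + 1) / ((B : ℝ) + 1)

/-- Joint law of the realized labels and of `B` independent redraws from the design. -/
noncomputable def mcLaw (p : Fin J → unitInterval) (B : ℕ) :
    Measure ((Fin J → Bool) × (Fin B → Fin J → Bool)) :=
  (design p).prod (Measure.pi fun _ : Fin B => design p)

/-- Asymptotic validity at level `α` of the randomization test based on `stat`, as the number `J`
of sessions tends to infinity: for the Monte Carlo `p`-value, whatever the numbers `B J` of
redraws (fixed or varying with `J`), and for the exact randomization `p`-value. -/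
def AsymptoticallyValid (m : ℕ) (Y : (J : ℕ) → Outcomes (J * L))
    (p : (J : ℕ) → Fin J → unitInterval)
    (stat : (J : ℕ) → (Fin J → Bool) → (Fin J → Fin (L - m) → ℝ) → ℝ) (α : ℝ) : Prop :=
  (∀ B : ℕ → ℕ,
    limsup (fun J => mcLaw (p J) (B J)
      {ω | mcPValue (stat J) ω.1 ω.2 (observed m (Y J) ω.1) ≤ α}) atTop ≤ ENNReal.ofReal α) ∧
  limsup (fun J => design (p J)
    {z | exactPValue (p J) (stat J) z (observed m (Y J) z) ≤ α}) atTop ≤ ENNReal.ofReal α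

/-- The empirical measure `(1 / J) ∑ δ_{x j}`. -/
noncomputable def empiricalMeasure {X : Type*} [MeasurableSpace X] (x : Fin J → X) :
    FiniteMeasure X :=
  ((J : ℝ≥0)⁻¹) • ∑ j : Fin J, (diracProba (x j)).toFiniteMeasure

/-- Values `(P, Y_1, Y_0)` of a treatment probability and of the two focal outcome vectors. -/
abbrev SessionData (n : ℕ) : Type :=
  ℝ × EuclideanSpace ℝ (Fin n) × EuclideanSpace ℝ (Fin n)

/-- `Σ_R = E[Y_1 Y_1ᵀ / (1 - P) + Y_0 Y_0ᵀ / P]` for `(P, Y_1, Y_0)` with law `ν`. -/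
noncomputable def sigmaR {n : ℕ} (ν : Measure (SessionData n)) : Matrix (Fin n) (Fin n) ℝ :=
  Matrix.of fun a b =>
    ∫ x, (x.2.1 a * x.2.1 b / (1 - x.1) + x.2.2 a * x.2.2 b / x.1) ∂ν

/-- The vector weak-null asymptotic conditions for a triangular array of experiments, the `J`-th
one with `J` sessions of length `L`. -/
structure VectorAsymptotics (m : ℕ) (Y : (J : ℕ) → Outcomes (J * L))
    (p : (J : ℕ) → Fin J → unitInterval) (pmin C : ℝ)
    (ν : ProbabilityMeasure (SessionData (L - m))) : Prop where
  pmin_pos : 0 < pmin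
  pmin_lt : pmin < 1 / 2
  overlap : ∀ (J : ℕ) (j : Fin J), pmin ≤ (p J j : ℝ) ∧ (p J j : ℝ) ≤ 1 - pmin
  fourth_moment : ∀ J : ℕ, 1 ≤ J →
    (1 / (J : ℝ)) * ∑ j : Fin J,
      (max ‖focalVec m (Y J) true j‖ ‖focalVec m (Y J) false j‖) ^ 4 ≤ C
  stabilization : Tendsto
    (fun J => empiricalMeasure fun j : Fin J =>
      (((p J j : ℝ), focalVec m (Y J) true j, focalVec m (Y J) false j) : SessionData (L - m)))
    atTop (𝓝 ν.toFiniteMeasure)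
  nondegenerate : (sigmaR (ν : Measure (SessionData (L - m)))).PosDef

end Switchback

/-!
Under a vanishing average effect the Horvitz–Thompson estimator is exactly a weighted sum of the
centred labels, so `√J` times it is asymptotically `N(0, S)` with `S = lim htCov`
(`limsup_normalizedSum_le`), while `J` times the covariance estimator tends to `U = lim upCov`
(`ArrayLimit.sigmaUp_tendsto`), and `S ≤ U` (`ArrayLimit.cov_le_up`). The redrawn experiment is of
the same kind, with both potential outcomes of a session equal to the recorded one. In that case
the bound is sharp (`htCov_self`), and the common limit `Q` of the two matrices is the
nondegenerate matrix `sigmaR ν` (restricted to the positions in use) for all but improbable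
labels. Hence the statistic and its redrawn version converge to the same functional of `N(0, S)`
normalized by `U`, and of `N(0, Q)` normalized by `Q`, respectively (`HasGaussianLimit`).
Convergence of the redrawn law is needed uniformly over typical labels; it follows by
contradiction, applying the Gaussian limit along a sequence of recorded outcomes that violate it
(`HasGaussianLimit.exists_redraw_bound`). The outcome is an asymptotic upper bound on the
distribution function of the exact `p`-value, `pValueBound`, in terms of the two limit laws
(`HasGaussianLimit.exactPValue_bound`).

For the quadratic statistic the redrawn limit law is that of `‖ξ‖²` with `ξ` standard Gaussian,
and `S ≤ U` makes the observed limit law stochastically smaller (`quadratic_sqrt_le`); so the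
bound is at most the identity on `(0, 1)`. For the studentized statistic the redrawn limit law is
standard normal and the observed one is the law of `s ξ` with `0 ≤ s ≤ 1`; the bound `H` satisfies
`H a ≤ a` for `a < 1 / 2` only, but also `H a + H (1 - a) ≤ 1` by symmetry.

Given the data, the number of redraws that reach the observed statistic is binomial with the exact
`p`-value as success probability. Thus with `k = ⌊α (B + 1)⌋` the rejection probability of the
Monte Carlo test is the integral of the distribution function of the exact `p`-value against the
density of the `k`-th of `B` uniform order statistics, whose mean is `k / (B + 1) ≤ α`
(`integral_binomialBelow_eq`, `integral_id_mul_betaDensity`). This settles every fixed `B` when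
`H` is below the identity, and also in the one-sided case with `α < 1 / 2`, since then the beta
density gives more weight to `a` than to `1 - a` for `a < 1 / 2`
(`integral_mul_betaDensity_le_of_reflect`). For large `B` the Monte Carlo and the exact `p`-values
are uniformly close by Chebyshev's inequality (`binomialBelow_le`), so the number of redraws may
vary with `J` in any way (`asymptoticallyValid_of_bound`).
-/

namespace Switchback

/-! ### Moments of functions of the labels -/

section Design

variable {J : ℕ}

instance isProbabilityMeasure_design (p : Fin J → unitInterval) :
    IsProbabilityMeasure (design p) := by
  unfold design; infer_instance

theorem integral_bernoulli_label {E : Type*} [NormedAddCommGroup E] [NormedSpace ℝ E]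
    [CompleteSpace E] (p : unitInterval) (g : Bool → E) :
    ∫ b, g b ∂(ProbabilityTheory.bernoulliMeasure true false p) =
      (p : ℝ) • g true + (1 - (p : ℝ)) • g false := by
  have := ProbabilityTheory.integral_bernoulliMeasure true false p g
  simpa using this

theorem integral_design_prod (p : Fin J → unitInterval) (g : Fin J → Bool → ℂ) :
    ∫ z, ∏ j, g j (z j) ∂(design p) =
      ∏ j, ((p j : ℂ) * g j true + (1 - (p j : ℂ)) * g j false) := by
  rw [design, integral_fintype_prod_eq_prod (f := g)]
  simp [integral_bernoulli_label]

theorem variance_bernoulliMeasure (p : unitInterval) (g : Bool → ℝ) :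
    ProbabilityTheory.variance g (ProbabilityTheory.bernoulliMeasure true false p) =
      (p : ℝ) * (1 - p) * (g true - g false) ^ 2 := by
  rw [ProbabilityTheory.variance_eq_integral (by fun_prop), integral_bernoulli_label]
  simp only [integral_bernoulli_label, smul_eq_mul]
  ring

theorem integral_design_sum (p : Fin J → unitInterval) (g : Fin J → Bool → ℝ) :
    ∫ z, ∑ j, g j (z j) ∂(design p) =
      ∑ j, ((p j : ℝ) * g j true + (1 - (p j : ℝ)) * g j false) := by
  rw [integral_finsetSum _ fun j _ => Integrable.of_finite]
  refine Finset.sum_congr rfl fun j _ => ?_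
  have := MeasureTheory.integral_comp_eval (μ := fun j =>
      ProbabilityTheory.bernoulliMeasure true false (p j)) (i := j) (f := g j) (by fun_prop)
  rw [design, this, integral_bernoulli_label]
  simp only [smul_eq_mul]

theorem variance_design_sum (p : Fin J → unitInterval) (g : Fin J → Bool → ℝ) :
    ProbabilityTheory.variance (fun z => ∑ j, g j (z j)) (design p) =
      ∑ j, (p j : ℝ) * (1 - p j) * (g j true - g j false) ^ 2 := by
  have := ProbabilityTheory.variance_sum_pi (μ := fun j =>
      ProbabilityTheory.bernoulliMeasure true false (p j)) (X := g) (fun i => MemLp.of_discrete)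
  simp only [variance_bernoulliMeasure] at this
  rw [← this, design]
  congr 1
  ext z; simp

/-- Chebyshev's inequality for averages of functions of the independent labels. -/
theorem design_average_deviation (p : Fin J → unitInterval) (g : Fin J → Bool → ℝ) {ε : ℝ}
    (hε : 0 < ε) :
    (design p).real {z | ε ≤ |(1 / (J : ℝ)) * ∑ j, g j (z j) -
        (1 / (J : ℝ)) * ∑ j, ((p j : ℝ) * g j true + (1 - (p j : ℝ)) * g j false)|} ≤
      (1 / (J : ℝ)) * ((1 / (J : ℝ)) * ∑ j, (g j true - g j false) ^ 2) / ε ^ 2 := by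
  have h := ProbabilityTheory.meas_ge_le_variance_div_sq (μ := design p)
    (X := fun z => ∑ j, (1 / (J : ℝ)) * g j (z j)) MemLp.of_discrete hε
  have hv := variance_design_sum p (fun j b => (1 / (J : ℝ)) * g j b)
  have hm := integral_design_sum p (fun j b => (1 / (J : ℝ)) * g j b)
  rw [hv, hm] at h
  have h2 := ENNReal.toReal_mono ENNReal.ofReal_ne_top h
  rw [ENNReal.toReal_ofReal (by
    refine div_nonneg (Finset.sum_nonneg fun j _ => ?_) (by positivity)
    have h0 := (p j).2.1; have h1 := (p j).2.2
    exact mul_nonneg (mul_nonneg h0 (by linarith)) (sq_nonneg _))] at h2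
  have e1 : ∀ z : Fin J → Bool, (∑ j, (1 / (J : ℝ)) * g j (z j)) = (1 / (J : ℝ)) * ∑ j, g j (z j) :=
    fun z => by rw [Finset.mul_sum]
  have e2 : (∑ j, ((p j : ℝ) * ((1 / (J : ℝ)) * g j true) + (1 - (p j : ℝ)) * ((1 /
      (J : ℝ)) * g j false)))
      = (1 / (J : ℝ)) * ∑ j, ((p j : ℝ) * g j true + (1 - (p j : ℝ)) * g j false) := by
    rw [Finset.mul_sum]; exact Finset.sum_congr rfl fun j _ => by ring
  simp only [e1, e2] at h2
  refine le_trans h2 ?_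
  gcongr
  rw [Finset.mul_sum, Finset.mul_sum]
  refine Finset.sum_le_sum fun j _ => ?_
  have h0 := (p j).2.1; have h1 := (p j).2.2
  have : (p j : ℝ) * (1 - p j) ≤ 1 := by nlinarith
  calc _ = ((p j : ℝ) * (1 - p j)) * ((1 / (J : ℝ)) * ((1 /
      (J : ℝ)) * (g j true - g j false) ^ 2)) := by ring
    _ ≤ _ := mul_le_of_le_one_left (by positivity) this

end Design

/-! ### Central limit theorem for weighted sums of labels -/

theorem norm_prod_sub_prod_le {ι : Type*} (s : Finset ι) (a b : ι → ℂ)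
    (ha : ∀ j ∈ s, ‖a j‖ ≤ 1) (hb : ∀ j ∈ s, ‖b j‖ ≤ 1) :
    ‖∏ j ∈ s, a j - ∏ j ∈ s, b j‖ ≤ ∑ j ∈ s, ‖a j - b j‖ := by
  classical
  induction s using Finset.induction_on with
  | empty => simp
  | insert i s hi ih =>
    rw [Finset.prod_insert hi, Finset.prod_insert hi, Finset.sum_insert hi]
    have ih' := ih (fun j hj => ha j (Finset.mem_insert_of_mem hj))
      (fun j hj => hb j (Finset.mem_insert_of_mem hj))
    have hp : ‖∏ j ∈ s, a j‖ ≤ 1 := by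
      rw [norm_prod]
      exact Finset.prod_le_one (fun _ _ => norm_nonneg _)
        fun j hj => ha j (Finset.mem_insert_of_mem hj)
    have e : a i * ∏ j ∈ s, a j - b i * ∏ j ∈ s, b j
        = (a i - b i) * ∏ j ∈ s, a j + b i * (∏ j ∈ s, a j - ∏ j ∈ s, b j) := by ring
    rw [e]
    refine (norm_add_le _ _).trans (add_le_add ?_ ?_)
    · rw [norm_mul]; exact mul_le_of_le_one_right (norm_nonneg _) hp
    · rw [norm_mul]
      exact (mul_le_of_le_one_left (norm_nonneg _) (hb i (Finset.mem_insert_self _ _))).trans ih'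

theorem norm_exp_mul_I_sub_taylor_le (x : ℝ) :
    ‖Complex.exp (x * Complex.I) - (1 + x * Complex.I - (x : ℂ) ^ 2 / 2)‖ ≤ 4 * |x| ^ 3 := by
  rcases le_or_gt |x| 1 with hx | hx
  · have h := Complex.exp_bound (x := x * Complex.I) (by simpa using hx) (n := 3) (by norm_num)
    simp only [Finset.sum_range_succ, Finset.sum_range_zero] at h
    have e : (0 + (x * Complex.I) ^ 0 / (Nat.factorial 0 : ℂ) +
        (x * Complex.I) ^ 1 / (Nat.factorial 1 : ℂ)
      + (x * Complex.I) ^ 2 / (Nat.factorial 2 : ℂ)) = 1 + x * Complex.I - (x : ℂ) ^ 2 / 2 := by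
      simp [Nat.factorial, mul_pow]; ring
    rw [e] at h
    refine h.trans ?_
    simp [Nat.factorial]
    nlinarith [pow_nonneg (abs_nonneg x) 3]
  · have h1 : ‖Complex.exp (x * Complex.I)‖ = 1 := Complex.norm_exp_ofReal_mul_I x
    have h2 : ‖(1 + x * Complex.I - (x : ℂ) ^ 2 / 2)‖ ≤ 1 + |x| + |x| ^ 2 / 2 := by
      refine (norm_sub_le _ _).trans (add_le_add ((norm_add_le _ _).trans ?_) ?_) <;> simp
    have h3 : 1 ≤ |x| ^ 3 := one_le_pow₀ hx.le
    have h4 : |x| ≤ |x| ^ 3 := le_self_pow₀ hx.le (by norm_num)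
    have h5 : |x| ^ 2 ≤ |x| ^ 3 := pow_le_pow_right₀ hx.le (by norm_num)
    refine (norm_sub_le _ _).trans ?_
    rw [h1]; linarith

theorem abs_exp_neg_sub_le {x : ℝ} (hx : 0 ≤ x) : |Real.exp (-x) - (1 - x)| ≤ x ^ 2 := by
  have h1 := Real.add_one_le_exp (-x)
  have h2 := Real.add_one_le_exp x
  have h3 : Real.exp (-x) * Real.exp x = 1 := by rw [← Real.exp_add]; simp
  have h4 := Real.exp_pos (-x)
  rw [abs_of_nonneg (by linarith)]
  have h5 : Real.exp (-x) * (x + 1) ≤ 1 := by nlinarith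
  by_contra hc
  push Not at hc
  nlinarith [mul_pos (by linarith : (0:ℝ) < x + 1) (sub_pos.2 hc), mul_nonneg hx (sq_nonneg x)]

/-- The characteristic function of a centred Bernoulli label is close to that of the normal law
with the same variance. -/
theorem norm_bernoulli_charFun_sub_le {p : ℝ} (h0 : 0 ≤ p) (h1 : p ≤ 1) (s : ℝ) :
    ‖((p : ℂ) * Complex.exp (((1 - p) * s : ℝ) * Complex.I) +
        (1 - (p : ℂ)) * Complex.exp (((-p) * s : ℝ) * Complex.I)) -
      Complex.exp (-(p * (1 - p) * s ^ 2 / 2 : ℝ))‖ ≤ 4 * |s| ^ 3 + s ^ 4 := by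
  set x := (1 - p) * s
  set y := (-p) * s
  set v := p * (1 - p) * s ^ 2 / 2 with hv
  have hx := norm_exp_mul_I_sub_taylor_le x
  have hy := norm_exp_mul_I_sub_taylor_le y
  have hv0 : 0 ≤ v := by have := mul_nonneg h0 (sub_nonneg.2 h1); positivity
  have hb := abs_exp_neg_sub_le hv0
  have hxs : |x| ^ 3 ≤ |s| ^ 3 := by
    refine pow_le_pow_left₀ (abs_nonneg _) ?_ 3
    rw [abs_mul]; refine mul_le_of_le_one_left (abs_nonneg _) ?_
    rw [abs_le]; constructor <;> linarith
  have hys : |y| ^ 3 ≤ |s| ^ 3 := by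
    refine pow_le_pow_left₀ (abs_nonneg _) ?_ 3
    rw [abs_mul]; refine mul_le_of_le_one_left (abs_nonneg _) ?_
    rw [abs_le]; constructor <;> linarith
  have hvs : v ^ 2 ≤ s ^ 4 := by
    have : v ≤ s ^ 2 := by
      have : p * (1 - p) ≤ 1 := by nlinarith
      nlinarith [sq_nonneg s]
    calc v ^ 2 ≤ (s ^ 2) ^ 2 := pow_le_pow_left₀ hv0 this 2
      _ = s ^ 4 := by ring
  have hb' : ‖(1 - (v : ℂ)) - Complex.exp (-(v : ℝ))‖ ≤ v ^ 2 := by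
    rw [norm_sub_rev]
    have : Complex.exp (-(v : ℂ)) - (1 - (v : ℂ)) = ((Real.exp (-v) - (1 - v) : ℝ) : ℂ) := by
      push_cast; rfl
    rw [this, Complex.norm_real]; exact hb
  have e : ((p : ℂ) * Complex.exp (x * Complex.I) + (1 - (p : ℂ)) * Complex.exp (y * Complex.I)) -
      Complex.exp (-(v : ℝ)) =
      (p : ℂ) * (Complex.exp (x * Complex.I) - (1 + x * Complex.I - (x : ℂ) ^ 2 / 2)) +
      (1 - (p : ℂ)) * (Complex.exp (y * Complex.I) - (1 + y * Complex.I - (y : ℂ) ^ 2 / 2)) +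
      ((1 - (v : ℂ)) - Complex.exp (-(v : ℝ))) := by
    simp only [x, y, v]; push_cast; ring
  rw [e]
  have n1 : ‖(p : ℂ)‖ = p := by rw [Complex.norm_real, Real.norm_of_nonneg h0]
  have n2 : ‖1 - (p : ℂ)‖ = 1 - p := by
    rw [← Complex.ofReal_one, ← Complex.ofReal_sub, Complex.norm_real,
        Real.norm_of_nonneg (by linarith)]
  refine (norm_add₃_le).trans ?_
  rw [norm_mul, norm_mul, n1, n2]
  have q1 := mul_le_mul_of_nonneg_left (hx.trans (mul_le_mul_of_nonneg_left hxs (by norm_num))) h0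
  have q2 := mul_le_mul_of_nonneg_left (hy.trans (mul_le_mul_of_nonneg_left hys (by norm_num)))
      (sub_nonneg.2 h1)
  linarith

/-- The sum `J^{-1/2} ∑ (Z_j - p_j) V_j`. -/
noncomputable def normalizedSum {J : ℕ} {E : Type*} [AddCommGroup E] [Module ℝ E]
    (p : Fin J → unitInterval) (V : Fin J → E) (z : Fin J → Bool) : E :=
  (√(J : ℝ))⁻¹ • ∑ j, (ind (z j) - (p j : ℝ)) • V j

variable {κ : Type*} [Fintype κ]

theorem charFun_normalizedSum {J : ℕ} (p : Fin J → unitInterval)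
    (V : Fin J → EuclideanSpace ℝ κ) (t : EuclideanSpace ℝ κ) :
    charFun ((design p).map (normalizedSum p V)) t =
      ∏ j, (((p j : ℝ) : ℂ) * Complex.exp (((1 -
          (p j : ℝ)) * ((√(J : ℝ))⁻¹ * inner ℝ (V j) t) : ℝ) * Complex.I) +
        (1 - ((p j : ℝ) : ℂ)) * Complex.exp
          (((-(p j : ℝ)) * ((√(J : ℝ))⁻¹ * inner ℝ (V j) t) : ℝ) * Complex.I)) := by
  rw [charFun_apply, integral_map (Measurable.of_discrete).aemeasurable
    (by fun_prop)]
  have := integral_design_prod p (fun j b => Complex.exp (((ind b -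
      (p j : ℝ)) * ((√(J : ℝ))⁻¹ * inner ℝ (V j) t) : ℝ) * Complex.I))
  simp only [ind, if_true, Bool.false_eq_true, if_false, zero_sub] at this
  rw [← this]
  refine integral_congr_ae (Eventually.of_forall fun z => ?_)
  simp only
  rw [← Complex.exp_sum, ← Finset.sum_mul, ← Complex.ofReal_sum]
  congr 3
  simp only [normalizedSum, inner_smul_left, sum_inner, ind, Finset.mul_sum]
  refine Finset.sum_congr rfl fun j _ => ?_
  simp; ring

/-- Quantitative form of the central limit theorem for labels: the characteristic function of the
normalized sum differs from the Gaussian one by `O(J^{-1/2})`. -/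
theorem norm_charFun_normalizedSum_sub_le {J : ℕ} (p : Fin J → unitInterval)
    (V : Fin J → EuclideanSpace ℝ κ) (t : EuclideanSpace ℝ κ) {C : ℝ}
    (hC : (1 / (J : ℝ)) * ∑ j, ‖V j‖ ^ 4 ≤ C) :
    ‖charFun ((design p).map (normalizedSum p V)) t -
      Complex.exp (-((1 / (J : ℝ)) * ∑ j, (p j : ℝ) * (1 -
          (p j : ℝ)) * (inner ℝ (V j) t) ^ 2) / 2 : ℝ)‖ ≤
      4 * ‖t‖ ^ 3 * (1 + C) * (√(J : ℝ))⁻¹ + ‖t‖ ^ 4 * C * (1 / (J : ℝ)) := by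
  set s : Fin J → ℝ := fun j => (√(J : ℝ))⁻¹ * inner ℝ (V j) t with hs
  have hJ2 : (√(J : ℝ))⁻¹ ^ 2 = 1 /
      (J : ℝ) := by rw [inv_pow, Real.sq_sqrt (Nat.cast_nonneg _), one_div]
  have e : Complex.exp (-((1 / (J : ℝ)) * ∑ j, (p j : ℝ) * (1 -
      (p j : ℝ)) * (inner ℝ (V j) t) ^ 2) / 2 : ℝ)
      = ∏ j, Complex.exp (-((p j : ℝ) * (1 - (p j : ℝ)) * (s j) ^ 2 / 2 : ℝ)) := by
    rw [← Complex.exp_sum]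
    congr 1
    rw [← hJ2]
    simp only [hs]
    push_cast
    rw [Finset.mul_sum, ← Finset.sum_neg_distrib, Finset.sum_div]
    exact Finset.sum_congr rfl fun j _ => by ring
  rw [e, charFun_normalizedSum]
  refine (norm_prod_sub_prod_le _ _ _ ?_ ?_).trans ?_
  · intro j _
    have h0 := (p j).2.1; have h1 := (p j).2.2
    refine (norm_add_le _ _).trans ?_
    rw [norm_mul, norm_mul, Complex.norm_exp_ofReal_mul_I, Complex.norm_exp_ofReal_mul_I,
      ← Complex.ofReal_one, ← Complex.ofReal_sub, Complex.norm_real, Complex.norm_real,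
      Real.norm_of_nonneg h0, Real.norm_of_nonneg (by linarith)]
    linarith
  · intro j _
    have h0 := (p j).2.1; have h1 := (p j).2.2
    rw [← Complex.ofReal_neg, ← Complex.ofReal_exp, Complex.norm_real,
        Real.norm_of_nonneg (Real.exp_pos _).le,
      Real.exp_le_one_iff]
    have := mul_nonneg h0 (sub_nonneg.2 h1)
    have := mul_nonneg this (sq_nonneg (s j))
    linarith
  · have hV : ∀ j, |s j| ≤ (√(J : ℝ))⁻¹ * (‖V j‖ * ‖t‖) := fun j => by
      simp only [hs]; rw [abs_mul, abs_of_nonneg (by positivity : (0:ℝ) ≤ (√(J : ℝ))⁻¹)]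
      exact mul_le_mul_of_nonneg_left (abs_real_inner_le_norm _ _) (by positivity)
    have hb : ∀ j, 4 * |s j| ^ 3 + s j ^ 4 ≤
        4 * ‖t‖ ^ 3 * (√(J : ℝ))⁻¹ * (1 / (J : ℝ) * (1 + ‖V j‖ ^ 4)) + ‖t‖ ^ 4 * (1 /
            (J : ℝ)) * (1 / (J : ℝ) * ‖V j‖ ^ 4) := fun j => by
      have a1 : |s j| ^ 3 ≤ ((√(J : ℝ))⁻¹ * (‖V j‖ * ‖t‖)) ^ 3 := pow_le_pow_left₀ (abs_nonneg _)
          (hV j) 3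
      have a2 : s j ^ 4 ≤ ((√(J : ℝ))⁻¹ * (‖V j‖ * ‖t‖)) ^ 4 := by
        rw [← (by decide : Even 4).pow_abs (s j)]; exact pow_le_pow_left₀ (abs_nonneg _) (hV j) 4
      have a3 : ‖V j‖ ^ 3 ≤ 1 + ‖V j‖ ^ 4 := by
        rcases le_total ‖V j‖ 1 with h | h
        · have := pow_le_one₀ (n := 3) (norm_nonneg (V j)) h; have : 0 ≤ ‖V j‖ ^ 4 := by positivity
          linarith
        · have := pow_le_pow_right₀ h (by norm_num : 3 ≤ 4); linarith
      have e1 : ((√(J : ℝ))⁻¹ * (‖V j‖ * ‖t‖)) ^ 3 =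
          ‖t‖ ^ 3 * (√(J : ℝ))⁻¹ * ((√(J : ℝ))⁻¹ ^ 2 * ‖V j‖ ^ 3) := by ring
      have e2 : ((√(J : ℝ))⁻¹ * (‖V j‖ * ‖t‖)) ^ 4 =
          ‖t‖ ^ 4 * (√(J : ℝ))⁻¹ ^ 2 * ((√(J : ℝ))⁻¹ ^ 2 * ‖V j‖ ^ 4) := by ring
      rw [e1, hJ2] at a1
      rw [e2, hJ2] at a2
      have : ‖t‖ ^ 3 * (√(J : ℝ))⁻¹ * (1 / (J : ℝ) * ‖V j‖ ^ 3) ≤ ‖t‖ ^ 3 * (√(J : ℝ))⁻¹ * (1 /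
          (J : ℝ) * (1 + ‖V j‖ ^ 4)) := by gcongr
      nlinarith
    refine (Finset.sum_le_sum fun j _ =>
        (norm_bernoulli_charFun_sub_le (p j).2.1 (p j).2.2 (s j)).trans (hb j)).trans ?_
    rw [Finset.sum_add_distrib, ← Finset.mul_sum, ← Finset.mul_sum, ← Finset.mul_sum,
        ← Finset.mul_sum, Finset.sum_add_distrib]
    have h1 : (1 / (J : ℝ)) * ((∑ _j : Fin J, (1 : ℝ)) + ∑ j, ‖V j‖ ^ 4) ≤ 1 + C := by
      rw [mul_add]
      refine add_le_add ?_ hC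
      simp only [Finset.sum_const, Finset.card_univ, Fintype.card_fin, nsmul_eq_mul, mul_one]
      rw [one_div_mul_eq_div]; exact div_self_le_one _
    have q1 : 4 * ‖t‖ ^ 3 * (√(J : ℝ))⁻¹ * ((1 / (J : ℝ)) * ((∑ _j : Fin J, (1 : ℝ)) + ∑ j,
        ‖V j‖ ^ 4)) ≤ 4 * ‖t‖ ^ 3 * (√(J : ℝ))⁻¹ * (1 + C) := by gcongr
    have q2 : ‖t‖ ^ 4 * (1 / (J : ℝ)) * ((1 / (J : ℝ)) * ∑ j, ‖V j‖ ^ 4) ≤ ‖t‖ ^ 4 * (1 /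
        (J : ℝ)) * C := by gcongr
    linarith

/-- **Multivariate central limit theorem** for weighted sums of independent labels, under a bound
on the average fourth power of the weights. -/
theorem limsup_normalizedSum_le [DecidableEq κ] {J : ℕ → ℕ} (hJ : Tendsto J atTop atTop)
    (p : ∀ i, Fin (J i) → unitInterval) (V : ∀ i, Fin (J i) → EuclideanSpace ℝ κ) {C : ℝ}
    (hC : ∀ i, (1 / (J i : ℝ)) * ∑ j, ‖V i j‖ ^ 4 ≤ C) {S : Matrix κ κ ℝ} (hS : S.PosSemidef)
    (hlim : ∀ t : EuclideanSpace ℝ κ, Tendsto (fun i => (1 / (J i : ℝ)) *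
      ∑ j, (p i j : ℝ) * (1 - (p i j : ℝ)) * (inner ℝ (V i j) t) ^ 2) atTop
        (𝓝 (t ⬝ᵥ (S *ᵥ t)))) {F : Set (EuclideanSpace ℝ κ)} (hF : IsClosed F) :
    limsup (fun i => design (p i) {z | normalizedSum (p i) (V i) z ∈ F}) atTop ≤
      ProbabilityTheory.multivariateGaussian 0 S F := by
  let μ : ℕ → ProbabilityMeasure (EuclideanSpace ℝ κ) := fun i =>
    ⟨(design (p i)).map (normalizedSum (p i) (V i)),
      Measure.isProbabilityMeasure_map (Measurable.of_discrete).aemeasurable⟩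
  let μ₀ : ProbabilityMeasure (EuclideanSpace ℝ κ) :=
    ⟨ProbabilityTheory.multivariateGaussian 0 S, inferInstance⟩
  have hconv : Tendsto μ atTop (𝓝 μ₀) := by
    refine ProbabilityMeasure.tendsto_of_tendsto_charFun fun t => ?_
    change Tendsto (fun i => charFun ((design (p i)).map (normalizedSum (p i) (V i))) t) atTop
      (𝓝 (charFun (ProbabilityTheory.multivariateGaussian 0 S) t))
    rw [ProbabilityTheory.charFun_multivariateGaussian hS]
    have h1 : Tendsto (fun i => Complex.exp (-((1 / (J i : ℝ)) * ∑ j, (p i j : ℝ) * (1 -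
        (p i j : ℝ)) *
        (inner ℝ (V i j) t) ^ 2) / 2 : ℝ)) atTop 
        (𝓝 (Complex.exp ((-(t ⬝ᵥ (S *ᵥ t)) / 2 : ℝ) : ℂ))) :=
      ((Complex.continuous_exp.comp Complex.continuous_ofReal).tendsto _).comp
        (((hlim t).neg).div_const 2)
    have h2 : Tendsto (fun i => 4 * ‖t‖ ^ 3 * (1 + C) * (√(J i : ℝ))⁻¹ + ‖t‖ ^ 4 * C * (1 /
        (J i : ℝ)))
        atTop (𝓝 0) := by
      have hJ' : Tendsto (fun i => (J i : ℝ)) atTop atTop := tendsto_natCast_atTop_atTop.comp hJ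
      have a := (tendsto_inv_atTop_zero.comp (Real.tendsto_sqrt_atTop.comp hJ')).const_mul
        (4 * ‖t‖ ^ 3 * (1 + C))
      have b := (tendsto_inv_atTop_zero.comp hJ').const_mul (‖t‖ ^ 4 * C)
      simpa [Function.comp_def] using a.add b
    have h3 := squeeze_zero_norm (fun i => norm_charFun_normalizedSum_sub_le (p i)
        (V i) t (hC i)) h2
    have h4 := h3.add h1
    simp only [sub_add_cancel, zero_add] at h4
    convert h4 using 2
    congr 1
    simp
    ring
  have := ProbabilityMeasure.limsup_measure_closed_le_of_tendsto hconv hF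
  refine le_trans (le_of_eq ?_) this
  congr 1
  ext i
  exact (Measure.map_apply Measurable.of_discrete hF.measurableSet).symm

/-! ### Slutsky's theorem and the law of large numbers -/

theorem measureReal_lt_add_of_subset_union {Ω : Type*} [MeasurableSpace Ω] {P : Measure Ω}
    [IsFiniteMeasure P] {s t u : Set Ω} (h : s ⊆ t ∪ u) {a b : ℝ} (ht : P.real t < a)
    (hu : P.real u < b) : P.real s < a + b :=
  ((measureReal_mono h (measure_ne_top _ _)).trans (measureReal_union_le _ _)).trans_lt
    (add_lt_add ht hu)

/-- Slutsky's theorem on varying probability spaces, for closed sets. -/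
theorem slutsky_closed {E F : Type*} [TopologicalSpace E] [MeasurableSpace E]
    [OpensMeasurableSpace E] [PseudoMetricSpace F] [ProperSpace F] {Ω : ℕ → Type*}
    [∀ i, MeasurableSpace (Ω i)] (P : ∀ i, Measure (Ω i)) [∀ i, IsProbabilityMeasure (P i)]
    (X : ∀ i, Ω i → E) (A : ∀ i, Ω i → F) (μ : Measure E) [IsProbabilityMeasure μ] (u : F)
    (hX : ∀ K : Set E, IsClosed K → limsup (fun i => P i {ω | X i ω ∈ K}) atTop ≤ μ K)
    (hA : ∀ ε > 0, Tendsto (fun i => (P i).real {ω | ε ≤ dist (A i ω) u}) atTop (𝓝 0))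
    {C : Set (E × F)} (hC : IsClosed C) {b : ℝ} (hb : μ.real {x | (x, u) ∈ C} < b) :
    ∀ᶠ i in atTop, (P i).real {ω | (X i ω, A i ω) ∈ C} < b := by
  -- The projection to `E` of the part of `C` over a small compact ball around `u` is closed, and it
  -- decreases to the slice of `C` at `u`.
  let K : ℕ → Set E := fun n => {x | ∃ y ∈ Metric.closedBall u (1 / ((n : ℝ) + 1)), (x, y) ∈ C}
  have hKc : ∀ n, IsClosed (K n) := fun n => by
    rw [← isOpen_compl_iff, isOpen_iff_eventually]
    intro x hx
    have hx' : ∀ y ∈ Metric.closedBall u (1 / ((n : ℝ) + 1)), (x, y) ∉ C := fun y hy h => hx ⟨y,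
        hy, h⟩
    have := (isCompact_closedBall u (1 / ((n : ℝ) + 1))).eventually_forall_of_forall_eventually
      (x₀ := x) (P := fun x y => (x, y) ∉ C) (fun y hy => hC.isOpen_compl.eventually_mem (hx' y hy))
    filter_upwards [this] with x' h' ⟨y, hy, h⟩ using h' y hy h
  have hanti : Antitone K := fun n m hnm x ⟨y, hy, h⟩ =>
    ⟨y, Metric.closedBall_subset_closedBall (by gcongr) hy, h⟩
  have hinter : ⋂ n, K n = {x | (x, u) ∈ C} := by
    ext x
    simp only [Set.mem_iInter, Set.mem_ofPred_eq]
    refine ⟨fun h => ?_, fun h n => ⟨u, Metric.mem_closedBall_self (by positivity), h⟩⟩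
    choose y hy hyC using h
    have hyu : Tendsto y atTop (𝓝 u) :=
      tendsto_iff_dist_tendsto_zero.2 (squeeze_zero (fun _ => dist_nonneg) (fun n => hy n)
        tendsto_one_div_add_atTop_nhds_zero_nat)
    exact hC.mem_of_tendsto (tendsto_const_nhds.prodMk_nhds hyu) (Eventually.of_forall hyC)
  have hlim : Tendsto (fun n => μ.real (K n)) atTop (𝓝 (μ.real {x | (x, u) ∈ C})) := by
    rw [← hinter]
    exact (ENNReal.tendsto_toReal (measure_ne_top _ _)).comp
      (tendsto_measure_iInter_atTop (fun n => (hKc n).measurableSet.nullMeasurableSet) hanti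
        ⟨0, measure_ne_top _ _⟩)
  obtain ⟨n, hn⟩ := (hlim.eventually_lt_const hb).exists
  obtain ⟨b', hb1, hb2⟩ := exists_between hn
  have h1 : ∀ᶠ i in atTop, (P i).real {ω | X i ω ∈ K n} < b' := by
    have hb0 : 0 ≤ b' := measureReal_nonneg.trans hb1.le
    have : limsup (fun i => P i {ω | X i ω ∈ K n}) atTop < ENNReal.ofReal b' :=
      (hX _ (hKc n)).trans_lt ((ENNReal.lt_ofReal_iff_toReal_lt (measure_ne_top _ _)).2 hb1)
    filter_upwards [eventually_lt_of_limsup_lt this] with i hi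
    exact (ENNReal.lt_ofReal_iff_toReal_lt (measure_ne_top _ _)).1 hi
  have h2 := (hA (1 / ((n : ℝ) + 1)) (by positivity)).eventually_lt_const (sub_pos.2 hb2)
  filter_upwards [h1, h2] with i hi1 hi2
  have hsub : {ω | (X i ω, A i ω) ∈ C} ⊆ {ω | X i ω ∈ K n} ∪ {ω | 1 / ((n : ℝ) + 1) ≤
      dist (A i ω) u} := by
    intro ω hω
    rcases le_total (1 / ((n : ℝ) + 1)) (dist (A i ω) u) with h | h
    · exact Or.inr h
    · exact Or.inl ⟨A i ω, h, hω⟩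
  simpa using measureReal_lt_add_of_subset_union hsub hi1 hi2

/-- The law of large numbers for averages of independent labels, along a sequence of designs. -/
theorem average_tendsto_in_probability {J : ℕ → ℕ} (hJ : Tendsto J atTop atTop)
    (p : ∀ i, Fin (J i) → unitInterval) (g : ∀ i, Fin (J i) → Bool → ℝ) {K m : ℝ}
    (hK : ∀ i, (1 / (J i : ℝ)) * ∑ j, (g i j true - g i j false) ^ 2 ≤ K)
    (hm : Tendsto (fun i => (1 / (J i : ℝ)) *
      ∑ j, ((p i j : ℝ) * g i j true + (1 - (p i j : ℝ)) * g i j false)) atTop (𝓝 m))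
    {ε : ℝ} (hε : 0 < ε) :
    Tendsto (fun i => (design (p i)).real {z | ε ≤ |(1 / (J i : ℝ)) * ∑ j, g i j (z j) - m|})
      atTop (𝓝 0) := by
  have hJ' : Tendsto (fun i => 1 / (J i : ℝ)) atTop (𝓝 0) :=
    tendsto_one_div_atTop_nhds_zero_nat.comp hJ
  have hb : Tendsto (fun i => (1 / (J i : ℝ)) * K / (ε / 2) ^ 2) atTop (𝓝 0) := by
    simpa using (hJ'.mul_const K).div_const ((ε / 2) ^ 2)
  refine squeeze_zero' (Eventually.of_forall fun _ => measureReal_nonneg) ?_ hb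
  filter_upwards [Metric.tendsto_nhds.1 hm (ε / 2) (by positivity)] with i hi
  rw [Real.dist_eq] at hi
  refine (measureReal_mono ?_ (measure_ne_top _ _)).trans ((design_average_deviation (p i) (g i)
      (half_pos hε)).trans ?_)
  · intro z hz
    simp only [Set.mem_ofPred_eq] at hz ⊢
    have := abs_sub_le ((1 / (J i : ℝ)) * ∑ j, g i j (z j)) ((1 / (J i : ℝ)) *
      ∑ j, ((p i j : ℝ) * g i j true + (1 - (p i j : ℝ)) * g i j false)) m
    linarith
  · gcongr
    exact hK i

/-! ### Sequences of experiments and their joint limits -/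

/-- The outcomes recorded under the labels `z` when session `j` has outcome vectors `u1 j` under
treatment and `u0 j` under control. -/
def pick {J : ℕ} {κ : Type*} (u1 u0 : Fin J → κ → ℝ) (z : Fin J → Bool) (j : Fin J) (a : κ) : ℝ :=
  if z j then u1 j a else u0 j a

/-- The coefficient of the centred label of session `j` in the Horvitz–Thompson estimator. -/
noncomputable def htCoef {J : ℕ} {κ : Type*} (p : Fin J → unitInterval) (u1 u0 : Fin J → κ → ℝ)
    (j : Fin J) (a : κ) : ℝ :=
  u1 j a / (p j : ℝ) + u0 j a / (1 - (p j : ℝ))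

/-- `J` times the covariance matrix of the Horvitz–Thompson estimator. -/
noncomputable def htCov {J : ℕ} {κ : Type*} (p : Fin J → unitInterval) (u1 u0 : Fin J → κ → ℝ) :
    Matrix κ κ ℝ :=
  Matrix.of fun a b => (1 / (J : ℝ)) *
    ∑ j, (p j : ℝ) * (1 - (p j : ℝ)) * (htCoef p u1 u0 j a * htCoef p u1 u0 j b)

/-- `J` times the expectation of the upper-bound covariance estimator. -/
noncomputable def upCov {J : ℕ} {κ : Type*} (p : Fin J → unitInterval) (u1 u0 : Fin J → κ → ℝ) :
    Matrix κ κ ℝ :=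
  Matrix.of fun a b => (1 / (J : ℝ)) *
    ∑ j, (u1 j a * u1 j b / (p j : ℝ) + u0 j a * u0 j b / (1 - (p j : ℝ)))

/-- A sequence of experiments with sizes tending to infinity, overlap, bounded fourth moments, a
vanishing average effect, and convergent covariance matrices. -/
structure ArrayLimit {κ : Type*} {J : ℕ → ℕ} (p : ∀ i, Fin (J i) → unitInterval)
    (u1 u0 : ∀ i, Fin (J i) → κ → ℝ) (pmin C : ℝ) (S U : Matrix κ κ ℝ) : Prop where
  pmin_pos : 0 < pmin
  size : Tendsto J atTop atTop
  overlap : ∀ i j, pmin ≤ (p i j : ℝ) ∧ (p i j : ℝ) ≤ 1 - pmin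
  moment_one : ∀ i a, (1 / (J i : ℝ)) * ∑ j, u1 i j a ^ 4 ≤ C
  moment_zero : ∀ i a, (1 / (J i : ℝ)) * ∑ j, u0 i j a ^ 4 ≤ C
  null : ∀ i a, ∑ j, (u1 i j a - u0 i j a) = 0
  cov : ∀ a b, Tendsto (fun i => htCov (p i) (u1 i) (u0 i) a b) atTop (𝓝 (S a b))
  up : ∀ a b, Tendsto (fun i => upCov (p i) (u1 i) (u0 i) a b) atTop (𝓝 (U a b))

/-- When the average effect vanishes, the Horvitz–Thompson estimator is a linear combination of
centred labels. -/
theorem htEst_pick {J : ℕ} {κ : Type*} (p : Fin J → unitInterval) (u1 u0 : Fin J → κ → ℝ)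
    (hp : ∀ j, 0 < (p j : ℝ) ∧ (p j : ℝ) < 1) (a : κ) (hnull : ∑ j, (u1 j a - u0 j a) = 0)
    (z : Fin J → Bool) :
    htEst p z (pick u1 u0 z) a =
      (√(J : ℝ))⁻¹ * normalizedSum p (fun j => WithLp.toLp 2 (htCoef p u1 u0 j)) z a := by
  have h : ∀ j, ind (z j) * pick u1 u0 z j a / (p j : ℝ) -
      (1 - ind (z j)) * pick u1 u0 z j a / (1 - (p j : ℝ)) =
      (ind (z j) - (p j : ℝ)) * htCoef p u1 u0 j a + (u1 j a - u0 j a) := fun j => by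
    have h0 := (hp j).1.ne'
    have h1 : (1 - (p j : ℝ)) ≠ 0 := by linarith [(hp j).2]
    cases hz : z j <;> simp [ind, pick, hz, htCoef] <;> field_simp <;> ring
  simp only [htEst, h, Finset.sum_add_distrib, hnull, add_zero, normalizedSum]
  simp only [PiLp.smul_apply, WithLp.ofLp_sum, Finset.sum_apply, smul_eq_mul]
  rw [← mul_assoc, ← mul_inv, Real.mul_self_sqrt (Nat.cast_nonneg _), one_div]

/-- Rescaled by `J`, the upper-bound covariance estimator is an average of functions of single
labels. -/
theorem mul_sigmaUp_pick {J : ℕ} {κ : Type*} (p : Fin J → unitInterval) (u1 u0 : Fin J → κ → ℝ)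
    (z : Fin J → Bool) (a b : κ) :
    (J : ℝ) * sigmaUp p z (pick u1 u0 z) a b = (1 / (J : ℝ)) * ∑ j,
      (if z j then u1 j a * u1 j b / (p j : ℝ) ^ 2 else u0 j a * u0 j b / (1 - (p j : ℝ)) ^ 2) := by
  have h : ∀ j, pick u1 u0 z j a * pick u1 u0 z j b *
      (ind (z j) / (p j : ℝ) ^ 2 + (1 - ind (z j)) / (1 - (p j : ℝ)) ^ 2) =
      (if z j then u1 j a * u1 j b / (p j : ℝ) ^ 2 else u0 j a * u0 j b / (1 -
          (p j : ℝ)) ^ 2) := fun j => by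
    cases hz : z j <;> simp [ind, pick, hz] <;> ring
  simp only [sigmaUp, Matrix.of_apply, h]
  rcases eq_or_ne (J : ℝ) 0 with hJ | hJ
  · simp [hJ]
  · field_simp

section Array

variable {κ : Type*} {J : ℕ → ℕ} {p : ∀ i, Fin (J i) → unitInterval}
  {u1 u0 : ∀ i, Fin (J i) → κ → ℝ} {pmin C : ℝ} {S U : Matrix κ κ ℝ}

theorem sq_mul_le_fourth (x y : ℝ) : (x * y) ^ 2 ≤ (x ^ 4 + y ^ 4) / 2 := by
  nlinarith [sq_nonneg (x ^ 2 - y ^ 2)]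

theorem ArrayLimit.p_mem (h : ArrayLimit p u1 u0 pmin C S U) (i : ℕ) (j : Fin (J i)) :
    0 < (p i j : ℝ) ∧ (p i j : ℝ) < 1 := by
  have := h.overlap i j; have := h.pmin_pos; constructor <;> linarith

variable [Fintype κ]

/-- The rescaled upper-bound covariance estimator is consistent for `U`. -/
theorem ArrayLimit.sigmaUp_tendsto (h : ArrayLimit p u1 u0 pmin C S U) {ε : ℝ} (hε : 0 < ε) :
    Tendsto (fun i => (design (p i)).real {z | ε ≤ dist
      (fun a b => (J i : ℝ) * sigmaUp (p i) z (pick (u1 i) (u0 i) z) a b) (fun a b => U a b)})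
      atTop (𝓝 0) := by
  have hab : ∀ a b, Tendsto (fun i => (design (p i)).real {z | ε ≤
      |(J i : ℝ) * sigmaUp (p i) z (pick (u1 i) (u0 i) z) a b - U a b|}) atTop (𝓝 0) := by
    intro a b
    simp only [mul_sigmaUp_pick]
    refine average_tendsto_in_probability h.size p (fun i j t => if t then u1 i j a * u1 i j b /
        (p i j : ℝ) ^ 2
      else u0 i j a * u0 i j b / (1 - (p i j : ℝ)) ^ 2) (K := 4 * C / pmin ^ 4) ?_ ?_ hε
    · intro i
      have hb : ∀ j, (u1 i j a * u1 i j b / (p i j : ℝ) ^ 2 - u0 i j a * u0 i j b / (1 -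
          (p i j : ℝ)) ^ 2) ^ 2
          ≤ (u1 i j a ^ 4 + u1 i j b ^ 4 + u0 i j a ^ 4 + u0 i j b ^ 4) / pmin ^ 4 := fun j => by
        have h0 := h.pmin_pos
        obtain ⟨h1, h2⟩ := h.overlap i j
        have e1 : (u1 i j a * u1 i j b / (p i j : ℝ) ^ 2) ^ 2 ≤ (u1 i j a ^ 4 +
            u1 i j b ^ 4) / 2 / pmin ^ 4 := by
          rw [div_pow, ← pow_mul]
          exact div_le_div₀ (by positivity) (sq_mul_le_fourth _ _) (by positivity)
              (pow_le_pow_left₀ h0.le h1 4)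
        have e2 : (u0 i j a * u0 i j b / (1 - (p i j : ℝ)) ^ 2) ^ 2 ≤ (u0 i j a ^ 4 +
            u0 i j b ^ 4) / 2 / pmin ^ 4 := by
          rw [div_pow, ← pow_mul]
          exact div_le_div₀ (by positivity) (sq_mul_le_fourth _ _) (by positivity)
              (pow_le_pow_left₀ h0.le (by linarith) 4)
        have e3 := sq_nonneg (u1 i j a * u1 i j b / (p i j : ℝ) ^ 2 + u0 i j a * u0 i j b / (1 -
            (p i j : ℝ)) ^ 2)
        have : (u1 i j a ^ 4 + u1 i j b ^ 4 + u0 i j a ^ 4 + u0 i j b ^ 4) / pmin ^ 4 =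
          2 * ((u1 i j a ^ 4 + u1 i j b ^ 4) / 2 / pmin ^ 4) + 2 * ((u0 i j a ^ 4 +
              u0 i j b ^ 4) / 2 / pmin ^ 4) := by ring
        nlinarith
      simp only [if_true, Bool.false_eq_true, if_false]
      refine (mul_le_mul_of_nonneg_left (Finset.sum_le_sum fun j _ => hb j)
          (by positivity)).trans ?_
      rw [← Finset.sum_div]
      simp only [Finset.sum_add_distrib]
      have := h.moment_one i a; have := h.moment_one i b
      have := h.moment_zero i a; have := h.moment_zero i b
      rw [← mul_div_assoc]
      have h0 := h.pmin_pos
      refine div_le_div_of_nonneg_right ?_ (by positivity)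
      linarith
    · refine (h.up a b).congr fun i => ?_
      simp only [upCov, Matrix.of_apply, if_true, Bool.false_eq_true, if_false]
      congr 1
      refine Finset.sum_congr rfl fun j _ => ?_
      have h0 := (h.p_mem i j).1.ne'
      have h1 : (1 - (p i j : ℝ)) ≠ 0 := by linarith [(h.p_mem i j).2]
      field_simp
  have hsum : Tendsto (fun i => ∑ a, ∑ b, (design (p i)).real {z | ε ≤
      |(J i : ℝ) * sigmaUp (p i) z (pick (u1 i) (u0 i) z) a b - U a b|}) atTop (𝓝 0) := by
    simpa using tendsto_finsetSum Finset.univ fun a _ => tendsto_finsetSum Finset.univ fun b _ =>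
        hab a b
  refine squeeze_zero (fun _ => measureReal_nonneg) (fun i => ?_) hsum
  refine (measureReal_mono (s₂ := ⋃ a, ⋃ b, {z | ε ≤
      |(J i : ℝ) * sigmaUp (p i) z (pick (u1 i)
          (u0 i) z) a b - U a b|}) ?_ (measure_ne_top _ _)).trans
    ((measureReal_iUnion_fintype_le _).trans (Finset.sum_le_sum fun a _ =>
        measureReal_iUnion_fintype_le _))
  intro z hz
  simp only [Set.mem_iUnion, Set.mem_ofPred_eq] at hz ⊢
  by_contra hc
  push Not at hc
  refine absurd hz (not_le.2 ?_)
  rw [dist_pi_lt_iff hε]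
  intro a
  rw [dist_pi_lt_iff hε]
  intro b
  exact hc a b

/-- The quadratic form of a weighted sum of rank-one matrices. -/
theorem dotProduct_weightedGram {n : ℕ} (c : ℝ) (w : Fin n → ℝ) (v : Fin n → κ → ℝ) (t : κ → ℝ) :
    t ⬝ᵥ ((Matrix.of fun a b => c * ∑ j, w j * (v j a * v j b)) *ᵥ t) =
      c * ∑ j, w j * (v j ⬝ᵥ t) ^ 2 := by
  have hR : c * ∑ j, w j * (v j ⬝ᵥ t) ^ 2 =
      ∑ j, ∑ a, ∑ b, c * (w j * ((v j a * t a) * (v j b * t b))) := by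
    simp only [sq, dotProduct, Finset.sum_mul_sum]
    simp only [Finset.mul_sum]
  rw [hR, Finset.sum_comm]
  simp only [dotProduct, Matrix.mulVec, Matrix.of_apply]
  refine Finset.sum_congr rfl fun a _ => ?_
  rw [Finset.sum_comm, Finset.mul_sum]
  refine Finset.sum_congr rfl fun b _ => ?_
  rw [Finset.mul_sum, Finset.sum_mul, Finset.mul_sum]
  exact Finset.sum_congr rfl fun j _ => by ring

theorem dotProduct_htCov {J : ℕ} (p : Fin J → unitInterval) (u1 u0 : Fin J → κ → ℝ) (t : κ → ℝ) :
    t ⬝ᵥ (htCov p u1 u0 *ᵥ t) = (1 / (J : ℝ)) *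
      ∑ j, (p j : ℝ) * (1 - (p j : ℝ)) * (htCoef p u1 u0 j ⬝ᵥ t) ^ 2 :=
  dotProduct_weightedGram _ _ _ t

theorem tendsto_dotProduct_mulVec {B : ℕ → Matrix κ κ ℝ} {A : Matrix κ κ ℝ}
    (h : ∀ a b, Tendsto (fun i => B i a b) atTop (𝓝 (A a b))) (t : κ → ℝ) :
    Tendsto (fun i => t ⬝ᵥ (B i *ᵥ t)) atTop (𝓝 (t ⬝ᵥ (A *ᵥ t))) := by
  simp only [dotProduct, Matrix.mulVec]
  exact tendsto_finsetSum _ fun a _ => (tendsto_finsetSum _ fun b _ =>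
      (h a b).mul_const _).const_mul _

theorem ArrayLimit.posSemidef (h : ArrayLimit p u1 u0 pmin C S U) : S.PosSemidef := by
  refine Matrix.PosSemidef.of_dotProduct_mulVec_nonneg ?_ fun t => ?_
  · ext a b
    simp only [Matrix.conjTranspose_apply, star_trivial]
    refine tendsto_nhds_unique (h.cov b a) ((h.cov a b).congr fun i => ?_)
    simp only [htCov, Matrix.of_apply, mul_comm]
  · simp only [star_trivial]
    refine ge_of_tendsto' (tendsto_dotProduct_mulVec h.cov t) fun i => ?_
    rw [dotProduct_htCov]
    refine mul_nonneg (by positivity) (Finset.sum_nonneg fun j _ => ?_)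
    have := h.p_mem i j
    exact mul_nonneg (mul_nonneg this.1.le (by linarith)) (sq_nonneg _)

theorem ArrayLimit.coef_moment (h : ArrayLimit p u1 u0 pmin C S U) (i : ℕ) :
    (1 / (J i : ℝ)) * ∑ j, ‖(WithLp.toLp 2 (htCoef (p i) (u1 i)
        (u0 i) j) : EuclideanSpace ℝ κ)‖ ^ 4 ≤
      Fintype.card κ * ∑ _a : κ, 16 * C / pmin ^ 4 := by
  have h0 := h.pmin_pos
  have hb : ∀ j a, htCoef (p i) (u1 i) (u0 i) j a ^ 4 ≤ 8 / pmin ^ 4 * (u1 i j a ^ 4 +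
      u0 i j a ^ 4) := fun j a => by
    obtain ⟨h1, h2⟩ := h.overlap i j
    have e1 : (u1 i j a / (p i j : ℝ)) ^ 4 ≤ u1 i j a ^ 4 / pmin ^ 4 := by
      rw [div_pow]; exact div_le_div_of_nonneg_left (by positivity) (by positivity)
          (pow_le_pow_left₀ h0.le h1 4)
    have e2 : (u0 i j a / (1 - (p i j : ℝ))) ^ 4 ≤ u0 i j a ^ 4 / pmin ^ 4 := by
      rw [div_pow]; exact div_le_div_of_nonneg_left (by positivity) (by positivity)
          (pow_le_pow_left₀ h0.le (by linarith) 4)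
    have e3 : ∀ x y : ℝ, (x + y) ^ 4 ≤ 8 * (x ^ 4 + y ^ 4) := fun x y => by
      nlinarith [sq_nonneg (x - y), sq_nonneg (x + y), sq_nonneg (x ^ 2 - y ^ 2), sq_nonneg (x*y),
          mul_nonneg (sq_nonneg (x - y)) (sq_nonneg (x + y)), mul_nonneg (sq_nonneg (x - y))
              (sq_nonneg x), mul_nonneg (sq_nonneg (x - y)) (sq_nonneg y), sq_nonneg ((x-y)^2)]
    have := e3 (u1 i j a / (p i j : ℝ)) (u0 i j a / (1 - (p i j : ℝ)))
    have e4 : 8 / pmin ^ 4 * (u1 i j a ^ 4 + u0 i j a ^ 4) = 8 * (u1 i j a ^ 4 / pmin ^ 4 +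
        u0 i j a ^ 4 / pmin ^ 4) := by ring
    rw [e4, htCoef]
    linarith
  have hn : ∀ j, ‖(WithLp.toLp 2 (htCoef (p i) (u1 i) (u0 i) j) : EuclideanSpace ℝ κ)‖ ^ 4 ≤
      Fintype.card κ * ∑ a, 8 / pmin ^ 4 * (u1 i j a ^ 4 + u0 i j a ^ 4) := fun j => by
    have e : ‖(WithLp.toLp 2 (htCoef (p i) (u1 i) (u0 i) j) : EuclideanSpace ℝ κ)‖ ^ 4 =
        (∑ a, htCoef (p i) (u1 i) (u0 i) j a ^ 2) ^ 2 := by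
      rw [show (4 : ℕ) = 2 * 2 from rfl, pow_mul, EuclideanSpace.real_norm_sq_eq]
    rw [e]
    refine (sq_sum_le_card_mul_sum_sq).trans ?_
    rw [Finset.card_univ]
    gcongr with a
    calc _ = htCoef (p i) (u1 i) (u0 i) j a ^ 4 := by ring
      _ ≤ _ := hb j a
  refine (mul_le_mul_of_nonneg_left (Finset.sum_le_sum fun j _ => hn j) (by positivity)).trans ?_
  rw [← Finset.mul_sum, Finset.sum_comm, mul_left_comm, Finset.mul_sum]
  gcongr with a
  rw [← Finset.mul_sum, Finset.sum_add_distrib, mul_left_comm]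
  have := h.moment_one i a; have := h.moment_zero i a
  calc _ ≤ 8 / pmin ^ 4 * (2 * C) := mul_le_mul_of_nonneg_left (by linarith) (by positivity)
    _ = _ := by ring

/-- Joint limit of the normalized estimator and of the normalized covariance estimator. -/
theorem ArrayLimit.eventually_lt [DecidableEq κ] (h : ArrayLimit p u1 u0 pmin C S U)
    {K : Set (EuclideanSpace ℝ κ × (κ → κ → ℝ))} (hK : IsClosed K) {b : ℝ}
    (hb : (ProbabilityTheory.multivariateGaussian 0 S).real {x | (x, fun a b => U a b) ∈ K} < b) :
    ∀ᶠ i in atTop, (design (p i)).real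
      {z | (normalizedSum (p i) (fun j => WithLp.toLp 2 (htCoef (p i) (u1 i) (u0 i) j)) z,
        fun a b => (J i : ℝ) * sigmaUp (p i) z (pick (u1 i) (u0 i) z) a b) ∈ K} < b := by
  refine slutsky_closed (fun i => design (p i)) _ _ (ProbabilityTheory.multivariateGaussian 0 S)
    (fun a b => U a b) (fun K hK => ?_) (fun ε hε => h.sigmaUp_tendsto hε) hK hb
  refine limsup_normalizedSum_le h.size p _ h.coef_moment h.posSemidef (fun t => ?_) hK
  refine (tendsto_dotProduct_mulVec h.cov t).congr fun i => ?_
  rw [dotProduct_htCov]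
  simp [PiLp.inner_apply, dotProduct, mul_comm]

/-- Limits of statistics that are continuous functions of the normalized estimator and of the
normalized covariance estimator, as long as the latter stays in a closed region. -/
theorem ArrayLimit.eventually_stat_lt [DecidableEq κ] (h : ArrayLimit p u1 u0 pmin C S U)
    {f : (κ → κ → ℝ) → ℝ} (hf : Continuous f) {δ : ℝ} (hδ : δ < f (fun a b => U a b))
    {φ : EuclideanSpace ℝ κ × (κ → κ → ℝ) → ℝ} (hφ : ContinuousOn φ {x | δ ≤ f x.2})
    (T : ∀ i, (Fin (J i) → Bool) → ℝ)
    (hT : ∀ i z, 0 < J i → δ ≤ f (fun a b => (J i : ℝ) * sigmaUp (p i) z (pick (u1 i)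
        (u0 i) z) a b) →
      T i z = φ (normalizedSum (p i) (fun j => WithLp.toLp 2 (htCoef (p i) (u1 i) (u0 i) j)) z,
        fun a b => (J i : ℝ) * sigmaUp (p i) z (pick (u1 i) (u0 i) z) a b))
    {R : Set ℝ} (hR : IsClosed R) {b : ℝ}
    (hb : (ProbabilityTheory.multivariateGaussian 0 S).real {x | φ (x, fun a b => U a b) ∈ R} < b) :
    ∀ᶠ i in atTop, (design (p i)).real {z | T i z ∈ R} < b := by
  have hD : IsClosed {x : EuclideanSpace ℝ κ × (κ → κ → ℝ) | δ ≤ f x.2} :=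
    isClosed_le continuous_const (hf.comp continuous_snd)
  have hK : IsClosed ({x : EuclideanSpace ℝ κ × (κ → κ → ℝ) | δ ≤ f x.2} ∩ φ ⁻¹' R) :=
    hφ.preimage_isClosed_of_isClosed hD hR
  have hK2 : IsClosed {x : EuclideanSpace ℝ κ × (κ → κ → ℝ) | f x.2 ≤ δ} :=
    isClosed_le (hf.comp continuous_snd) continuous_const
  obtain ⟨b', hb1, hb2⟩ := exists_between hb
  have e1 := h.eventually_lt hK (b := b') (by
    refine lt_of_le_of_lt (measureReal_mono ?_ (measure_ne_top _ _)) hb1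
    intro x hx; exact hx.2)
  have e2 := h.eventually_lt hK2 (b := b - b') (by
    have : {x : EuclideanSpace ℝ κ | (x, fun a b => U a b) ∈
        {x : EuclideanSpace ℝ κ × (κ → κ → ℝ) | f x.2 ≤ δ}} = ∅ := by
      ext x; simpa using hδ
    rw [this]; simpa using hb2)
  filter_upwards [e1, e2, h.size.eventually_gt_atTop 0] with i h1 h2 h3
  rw [← add_sub_cancel b' b]
  refine measureReal_lt_add_of_subset_union (fun z hz => ?_) h1 h2
  rcases le_total δ (f (fun a b => (J i : ℝ) * sigmaUp (p i) z (pick (u1 i)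
      (u0 i) z) a b)) with hd | hd
  · left
    refine ⟨hd, ?_⟩
    rw [Set.mem_preimage, ← hT i z h3 hd]; exact hz
  · right; exact hd

end Array

/-! ### Limits of the statistics and of the exact `p`-value -/

/-- `J` times the covariance matrix of the redrawn estimator,
    averaged over the labels that determine
the recorded outcomes: treatment outcomes are recorded with probability `p j`, and the redrawn
estimator weights them by `1 / (p j * (1 - p j))`, which leaves the weight `1 / (1 - p j)`. -/
noncomputable def crossCov {J : ℕ} {κ : Type*} (p : Fin J → unitInterval) (u1 u0 : Fin J → κ → ℝ) :
    Matrix κ κ ℝ :=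
  Matrix.of fun a b => (1 / (J : ℝ)) *
    ∑ j, (u1 j a * u1 j b / (1 - (p j : ℝ)) + u0 j a * u0 j b / (p j : ℝ))

theorem upCov_self_apply {J : ℕ} {κ : Type*} (p : Fin J → unitInterval) (u : Fin J → κ → ℝ)
    (hp : ∀ j, 0 < (p j : ℝ) ∧ (p j : ℝ) < 1) (a b : κ) :
    upCov p u u a b = (1 / (J : ℝ)) * ∑ j, u j a * u j b / ((p j : ℝ) * (1 - (p j : ℝ))) := by
  simp only [upCov, Matrix.of_apply]
  congr 1
  refine Finset.sum_congr rfl fun j _ => ?_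
  have h0 := (hp j).1.ne'
  have h1 : (1 - (p j : ℝ)) ≠ 0 := by linarith [(hp j).2]
  field_simp
  ring

/-- When the two potential outcomes of every session coincide, the upper bound on the covariance is
sharp. This is the situation of the redrawn experiment, whose outcomes are held fixed. -/
theorem htCov_self {J : ℕ} {κ : Type*} (p : Fin J → unitInterval) (u : Fin J → κ → ℝ)
    (hp : ∀ j, 0 < (p j : ℝ) ∧ (p j : ℝ) < 1) : htCov p u u = upCov p u u := by
  ext a b
  rw [upCov_self_apply p u hp]
  simp only [htCov, htCoef, Matrix.of_apply]
  congr 1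
  refine Finset.sum_congr rfl fun j _ => ?_
  have h0 := (hp j).1.ne'
  have h1 : (1 - (p j : ℝ)) ≠ 0 := by linarith [(hp j).2]
  field_simp
  ring

theorem pick_self {J : ℕ} {κ : Type*} (u : Fin J → κ → ℝ) (z : Fin J → Bool) : pick u u z = u := by
  ext j a; simp [pick]

/-- The covariance matrix of the redrawn estimator, a function of the observed labels, is consistent
for the limit of its average. -/
theorem ArrayLimit.upCov_pick_tendsto {κ : Type*} [Fintype κ] {p : ∀ J, Fin J → unitInterval}
    {u1 u0 : ∀ J, Fin J → κ → ℝ} {pmin C : ℝ} {S U Q : Matrix κ κ ℝ}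
    (h : ArrayLimit (J := id) p u1 u0 pmin C S U)
    (hcross : ∀ k l, Tendsto (fun J => crossCov (p J) (u1 J) (u0 J) k l) atTop (𝓝 (Q k l)))
    {δ : ℝ} (hδ : 0 < δ) :
    Tendsto (fun J => (design (p J)).real {z | ¬ ∀ k l,
      |upCov (p J) (pick (u1 J) (u0 J) z) (pick (u1 J)
          (u0 J) z) k l - Q k l| < δ}) atTop (𝓝 0) := by
  have hp := fun J => h.p_mem J
  have hkl : ∀ k l, Tendsto (fun J => (design (p J)).real {z | δ ≤
      |upCov (p J) (pick (u1 J) (u0 J) z) (pick (u1 J) (u0 J) z) k l - Q k l|}) atTop (𝓝 0) := by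
    intro k l
    have e : ∀ J (z : Fin J → Bool), upCov (p J) (pick (u1 J) (u0 J) z) (pick (u1 J) (u0 J) z) k l =
        (1 / (J : ℝ)) * ∑ j, (if z j then u1 J j k * u1 J j l / ((p J j : ℝ) * (1 - (p J j : ℝ)))
          else u0 J j k * u0 J j l / ((p J j : ℝ) * (1 - (p J j : ℝ)))) := fun J z => by
      rw [upCov_self_apply _ _ (hp J)]
      congr 1
      refine Finset.sum_congr rfl fun j _ => ?_
      unfold pick
      split_ifs <;> rfl
    simp only [e]
    refine average_tendsto_in_probability (J := id) h.size p
      (fun J j t => if t then u1 J j k * u1 J j l / ((p J j : ℝ) * (1 - (p J j : ℝ)))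
          else u0 J j k * u0 J j l / ((p J j : ℝ) * (1 - (p J j : ℝ)))) (K :=
              4 * C / (pmin ^ 2) ^ 2) ?_ ?_ hδ
    · intro J
      simp only [if_true, Bool.false_eq_true, if_false, id]
      have h0 := h.pmin_pos
      have hb : ∀ j, (u1 J j k * u1 J j l / ((p J j : ℝ) * (1 - (p J j : ℝ))) -
          u0 J j k * u0 J j l / ((p J j : ℝ) * (1 - (p J j : ℝ)))) ^ 2 ≤
          (u1 J j k ^ 4 + u1 J j l ^ 4 + u0 J j k ^ 4 +
              u0 J j l ^ 4) / (pmin ^ 2) ^ 2 := fun j => by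
        obtain ⟨h1, h2⟩ := h.overlap J j
        have h3 : pmin ^ 2 ≤ (p J j : ℝ) * (1 - (p J j : ℝ)) := by
          rw [sq]; exact mul_le_mul h1 (by linarith) h0.le (by linarith)
        rw [← sub_div, div_pow]
        refine div_le_div₀ (by positivity) ?_ (by positivity)
            (pow_le_pow_left₀ (by positivity) h3 2)
        have e1 := sq_mul_le_fourth (u1 J j k) (u1 J j l)
        have e2 := sq_mul_le_fourth (u0 J j k) (u0 J j l)
        nlinarith [sq_nonneg (u1 J j k * u1 J j l + u0 J j k * u0 J j l)]
      refine (mul_le_mul_of_nonneg_left (Finset.sum_le_sum fun j _ => hb j)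
          (by positivity)).trans ?_
      rw [← Finset.sum_div, ← mul_div_assoc]
      simp only [Finset.sum_add_distrib]
      have m1 := h.moment_one J k; have m2 := h.moment_one J l
      have m3 := h.moment_zero J k; have m4 := h.moment_zero J l
      simp only [id] at m1 m2 m3 m4
      refine div_le_div_of_nonneg_right ?_ (by positivity)
      linarith
    · refine (hcross k l).congr fun J => ?_
      simp only [crossCov, Matrix.of_apply, if_true, Bool.false_eq_true, if_false, id]
      congr 1
      refine Finset.sum_congr rfl fun j _ => ?_
      have h0 := (hp J j).1.ne'
      have h1 : (1 - (p J j : ℝ)) ≠ 0 := by linarith [(hp J j).2]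
      field_simp
  have hsum : Tendsto (fun J => ∑ k, ∑ l, (design (p J)).real {z | δ ≤
      |upCov (p J) (pick (u1 J) (u0 J) z) (pick (u1 J) (u0 J) z) k l - Q k l|}) atTop (𝓝 0) := by
    simpa using tendsto_finsetSum Finset.univ fun k _ => tendsto_finsetSum Finset.univ fun l _ =>
        hkl k l
  refine squeeze_zero (fun _ => measureReal_nonneg) (fun J => ?_) hsum
  refine (measureReal_mono (s₂ := ⋃ k, ⋃ l, {z | δ ≤
      |upCov (p J) (pick (u1 J) (u0 J) z) (pick (u1 J)
          (u0 J) z) k l - Q k l|}) ?_ (measure_ne_top _ _)).trans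
    ((measureReal_iUnion_fintype_le _).trans (Finset.sum_le_sum fun a _ =>
        measureReal_iUnion_fintype_le _))
  intro z hz
  simp only [Set.mem_iUnion, Set.mem_ofPred_eq] at hz ⊢
  push Not at hz
  exact hz

section Limit

variable {κ : Type*} [Fintype κ] [DecidableEq κ]

/-- A statistic computed from probabilities, labels and recorded outcomes has the Gaussian limit
`lim` if, for every convergent sequence of experiments with vanishing average effect and
nonsingular limit `U`, it behaves asymptotically like `lim U` of a centred Gaussian vector
(portmanteau inequality for closed sets). -/
def HasGaussianLimit
    (stat : ∀ {J : ℕ}, (Fin J → unitInterval) → (Fin J → Bool) → (Fin J → κ → ℝ) → ℝ)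
    (lim : Matrix κ κ ℝ → EuclideanSpace ℝ κ → ℝ) : Prop :=
  ∀ (J : ℕ → ℕ) (p : ∀ i, Fin (J i) → unitInterval) (u1 u0 : ∀ i, Fin (J i) → κ → ℝ)
    (pmin C : ℝ) (S U : Matrix κ κ ℝ), ArrayLimit p u1 u0 pmin C S U → U.PosDef →
    ∀ (R : Set ℝ), IsClosed R → ∀ b : ℝ,
      (ProbabilityTheory.multivariateGaussian 0 S).real {x | lim U x ∈ R} < b →
      ∀ᶠ i in atTop, (design (p i)).real {z | stat (p i) z (pick (u1 i) (u0 i) z) ∈ R} < b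

/-- The convention for singular matrices is immaterial, because the limit `U` is nonsingular. -/
theorem hasGaussianLimit_quadStat {ginv : Matrix κ κ ℝ → Matrix κ κ ℝ} (hg : IsInversion ginv) :
    HasGaussianLimit (fun {_} => quadStat ginv) (fun U x => x ⬝ᵥ (U⁻¹ *ᵥ x)) := by
  intro J p u1 u0 pmin C S U h hU R hR b hb
  have hdet : 0 < |U.det| := abs_pos.2 hU.det_pos.ne'
  refine h.eventually_stat_lt (f := fun B => |(Matrix.of B).det|) (δ := |U.det| / 2)
    (φ := fun x => x.1 ⬝ᵥ ((Matrix.of x.2)⁻¹ *ᵥ x.1)) ?_ (half_lt_self hdet) ?_ _ ?_ hR hb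
  · exact (Continuous.matrix_det (A := fun B : κ → κ → ℝ => Matrix.of B) continuous_id).abs
  · have hc : Continuous (fun x : EuclideanSpace ℝ κ × (κ → κ → ℝ) => Matrix.of x.2) :=
        continuous_snd
    have e : (fun x : EuclideanSpace ℝ κ × (κ → κ → ℝ) => x.1 ⬝ᵥ ((Matrix.of x.2)⁻¹ *ᵥ x.1)) =
        fun x => (Matrix.of x.2).det⁻¹ * (x.1 ⬝ᵥ ((Matrix.of x.2).adjugate *ᵥ x.1)) := by
      ext x
      rw [Matrix.inv_def, Ring.inverse_eq_inv', Matrix.smul_mulVec, dotProduct_smul, smul_eq_mul]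
    rw [e]
    refine ContinuousOn.mul (ContinuousOn.inv₀ hc.matrix_det.continuousOn fun x hx h0 => ?_) ?_
    · simp only [Set.mem_ofPred_eq, h0, abs_zero] at hx
      linarith
    · refine Continuous.continuousOn ?_
      have hx : Continuous (fun x : EuclideanSpace ℝ κ × (κ → κ → ℝ) =>
          (x.1 : κ → ℝ)) := by fun_prop
      exact hx.dotProduct (hc.matrix_adjugate.matrix_mulVec hx)
  · intro i z hJ hδ
    set A := sigmaUp (p i) z (pick (u1 i) (u0 i) z) with hA
    have hJ' : (J i : ℝ) ≠ 0 := by positivity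
    have e : Matrix.of (fun a b => (J i : ℝ) * A a b) = (J i : ℝ) • A := by
      ext a b; simp
    have hd : A.det ≠ 0 := by
      intro h0
      rw [e, Matrix.det_smul, h0, mul_zero, abs_zero] at hδ
      linarith
    have hu : IsUnit A.det := isUnit_iff_ne_zero.2 hd
    set N : EuclideanSpace ℝ κ := normalizedSum (p i)
      (fun j => WithLp.toLp 2 (htCoef (p i) (u1 i) (u0 i) j)) z with hN
    have hx : htEst (p i) z (pick (u1 i) (u0 i) z) = (√(J i : ℝ))⁻¹ • WithLp.ofLp N := by
      ext a
      exact htEst_pick (p i) (u1 i) (u0 i) (h.p_mem i) a (h.null i a) z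
    have hinv : ((J i : ℝ) • A)⁻¹ = (J i : ℝ)⁻¹ • A⁻¹ :=
      Matrix.inv_smul' A (Units.mk0 _ hJ') hu
    simp only
    rw [e, quadStat, ← hA, hg A hu, hx, Matrix.mulVec_smul, dotProduct_smul, smul_dotProduct,
        smul_smul,
      ← mul_inv, Real.mul_self_sqrt (Nat.cast_nonneg _),
      hinv, Matrix.smul_mulVec, dotProduct_smul]

theorem hasGaussianLimit_studentized (ℓ : κ) :
    HasGaussianLimit (fun {_} => studentized ℓ) (fun U x => x ℓ / √(U ℓ ℓ)) := by
  intro J p u1 u0 pmin C S U h hU R hR b hb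
  have hpos : 0 < U ℓ ℓ := hU.diag_pos
  refine h.eventually_stat_lt (f := fun B => B ℓ ℓ) (δ := U ℓ ℓ / 2)
    (φ := fun x => x.1 ℓ / √(x.2 ℓ ℓ)) (by fun_prop) (half_lt_self hpos) ?_ _ ?_ hR hb
  · refine ContinuousOn.div (Continuous.continuousOn (by fun_prop))
        (Continuous.continuousOn (by fun_prop)) ?_
    intro x hx
    simp only [Set.mem_ofPred_eq] at hx
    exact (Real.sqrt_pos.2 (by linarith)).ne'
  · intro i z hJ hδ
    have e : varUp (p i) z (pick (u1 i) (u0 i) z) ℓ = sigmaUp (p i) z (pick (u1 i)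
        (u0 i) z) ℓ ℓ := by
      simp [varUp, sigmaUp, sq]
    simp only [studentized]
    rw [htEst_pick (p i) (u1 i) (u0 i) (h.p_mem i) ℓ (h.null i ℓ) z, e,
      Real.sqrt_mul (Nat.cast_nonneg _)]
    rw [inv_mul_eq_div, div_div]

variable {stat : ∀ {J : ℕ}, (Fin J → unitInterval) → (Fin J → Bool) → (Fin J → κ → ℝ) → ℝ}
  {lim : Matrix κ κ ℝ → EuclideanSpace ℝ κ → ℝ}
  {p : ∀ J, Fin J → unitInterval} {u1 u0 : ∀ J, Fin J → κ → ℝ} {pmin C : ℝ} {S U Q : Matrix κ κ ℝ}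

/-- If the covariance of the redrawn estimator is close to its limit, then the redrawn statistic
has approximately its limiting tail probabilities. -/
theorem HasGaussianLimit.exists_redraw_bound (hs : HasGaussianLimit stat lim)
    (hlim : ∀ U, Measurable (lim U)) (h : ArrayLimit (J := id) p u1 u0 pmin C S U) (hQ : Q.PosDef)
    {a c : ℝ} (hac : a < (ProbabilityTheory.multivariateGaussian 0 Q).real {x | c < lim Q x}) :
    ∃ δ > 0, ∃ J₀, ∀ J ≥ J₀, ∀ z : Fin J → Bool,
      (∀ k l, |upCov (p J) (pick (u1 J) (u0 J) z) (pick (u1 J) (u0 J) z) k l - Q k l| < δ) →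
      a < (design (p J)).real {z' | c ≤ stat (p J) z' (pick (u1 J) (u0 J) z)} := by
  -- Otherwise there are labels, in experiments of growing size, whose recorded outcomes have a
  -- covariance tending to `Q` but too small a tail. Recorded outcomes form experiments in which
  -- treatment and control outcomes coincide, so the Gaussian limit applies to them.
  by_contra hcon
  push Not at hcon
  choose J hJ z hz hfail using fun n : ℕ => hcon (1 / ((n : ℝ) + 1)) (by positivity) n
  have hsize : Tendsto J atTop atTop := tendsto_atTop_mono hJ tendsto_id
  have hup : ∀ k l, Tendsto (fun i => upCov (p (J i)) (pick (u1 (J i)) (u0 (J i)) (z i))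
      (pick (u1 (J i)) (u0 (J i)) (z i)) k l) atTop (𝓝 (Q k l)) := fun k l =>
    tendsto_iff_dist_tendsto_zero.2 (squeeze_zero (fun _ => dist_nonneg)
      (fun i => (hz i k l).le) tendsto_one_div_add_atTop_nhds_zero_nat)
  have hm : ∀ i k, (1 / (J i : ℝ)) * ∑ j, pick (u1 (J i)) (u0 (J i)) (z i) j k ^ 4 ≤ 2 * C := by
    intro i k
    have hb : ∀ j, pick (u1 (J i)) (u0 (J i)) (z i) j k ^ 4 ≤ u1 (J i) j k ^ 4 +
        u0 (J i) j k ^ 4 := fun j => by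
      have e1 : 0 ≤ u1 (J i) j k ^ 4 := by positivity
      have e0 : 0 ≤ u0 (J i) j k ^ 4 := by positivity
      unfold pick
      split_ifs <;> linarith
    refine (mul_le_mul_of_nonneg_left (Finset.sum_le_sum fun j _ => hb j) (by positivity)).trans ?_
    rw [Finset.sum_add_distrib]
    have h1 := h.moment_one (J i) k
    have h0 := h.moment_zero (J i) k
    simp only [id] at h1 h0
    linarith
  have hA : ArrayLimit (J := J) (fun i => p (J i)) (fun i => pick (u1 (J i)) (u0 (J i)) (z i))
      (fun i => pick (u1 (J i)) (u0 (J i)) (z i)) pmin (2 * C) Q Q :=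
    { pmin_pos := h.pmin_pos
      size := hsize
      overlap := fun i j => h.overlap (J i) j
      moment_one := hm
      moment_zero := hm
      null := fun i k => by simp
      cov := fun k l => by simpa only [htCov_self _ _ (h.p_mem (J _))] using hup k l
      up := hup }
  have hcompl : (ProbabilityTheory.multivariateGaussian 0 Q).real
      {x | lim Q x ∈ Set.Iic c} < 1 - a := by
    have hc := probReal_compl_eq_one_sub (μ := ProbabilityTheory.multivariateGaussian 0 Q)
      (measurableSet_lt measurable_const (hlim Q) : MeasurableSet {x | c < lim Q x})
    have e : {x | lim Q x ∈ Set.Iic c} = {x | c < lim Q x}ᶜ := by ext x; simp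
    rw [e, hc]; linarith
  obtain ⟨i, hi⟩ := (hs _ _ _ _ _ _ _ _ hA hQ _ isClosed_Iic _ hcompl).exists
  simp only [pick_self] at hi
  have h1 := hfail i
  have h2 : (1 : ℝ) ≤ (design (p (J i))).real {z' | stat (p (J i)) z' (pick (u1 (J i)) (u0 (J i))
      (z i)) ∈ Set.Iic c} +
      (design (p (J i))).real {z' | c ≤ stat (p (J i)) z' (pick (u1 (J i)) (u0 (J i)) (z i))} := by
    rw [← probReal_univ (μ := design (p (J i)))]
    refine (measureReal_mono (fun z' _ => ?_) (measure_ne_top _ _)).trans (measureReal_union_le _ _)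
    exact le_total (stat (p (J i)) z' (pick (u1 (J i)) (u0 (J i)) (z i))) c
  linarith

/-- Asymptotic distribution function of the exact randomization `p`-value: a `p`-value at most `a`
forces the observed statistic above every threshold `c` that the limit law of the redrawn statistic
exceeds with probability more than `a`. -/
theorem HasGaussianLimit.exactPValue_bound (hs : HasGaussianLimit stat lim)
    (hlim : ∀ U, Measurable (lim U)) (h : ArrayLimit (J := id) p u1 u0 pmin C S U) (hU : U.PosDef)
    (hQ : Q.PosDef)
    (hcross : ∀ k l, Tendsto (fun J => crossCov (p J) (u1 J) (u0 J) k l) atTop (𝓝 (Q k l)))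
    {a c b : ℝ} (hac : a < (ProbabilityTheory.multivariateGaussian 0 Q).real {x | c < lim Q x})
    (hb : (ProbabilityTheory.multivariateGaussian 0 S).real {x | c ≤ lim U x} < b) :
    ∀ᶠ J in atTop, (design (p J)).real
      {z | exactPValue (p J) (stat (p J)) z (pick (u1 J) (u0 J) z) ≤ a} < b := by
  obtain ⟨δ, hδ, J₀, hJ₀⟩ := hs.exists_redraw_bound hlim h hQ hac
  obtain ⟨b', hb1, hb2⟩ := exists_between hb
  have e1 := hs _ _ _ _ _ _ _ _ h hU (Set.Ici c) isClosed_Ici b' hb1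
  have e2 := (h.upCov_pick_tendsto hcross hδ).eventually_lt_const (sub_pos.2 hb2)
  filter_upwards [e1, e2, eventually_ge_atTop J₀] with J h1 h2 h3
  rw [← add_sub_cancel b' b]
  refine measureReal_lt_add_of_subset_union (fun z hz => ?_) h1 h2
  by_cases hg : ∀ k l, |upCov (p J) (pick (u1 J) (u0 J) z) (pick (u1 J) (u0 J) z) k l - Q k l| < δ
  · left
    by_contra hlt
    have hlt' : stat (p J) z (pick (u1 J) (u0 J) z) < c := not_le.1 hlt
    have := hJ₀ J h3 z hg
    have hle : (design (p J)).real {z' | c ≤ stat (p J) z' (pick (u1 J) (u0 J) z)} ≤ a :=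
      (measureReal_mono (fun z' (hz' : c ≤ _) => hlt'.le.trans hz') (measure_ne_top _ _)).trans hz
    linarith
  · right; exact hg

end Limit

/-! ### Averages along weakly convergent empirical measures -/

section Moments

variable {X : Type*} [MeasurableSpace X]

theorem integral_empiricalMeasure [TopologicalSpace X] [BorelSpace X] {J : ℕ} (x : Fin J → X)
    {g : X → ℝ} (hg : Continuous g) :
    ∫ y, g y ∂(empiricalMeasure x : Measure X) = (1 / (J : ℝ)) * ∑ j, g (x j) := by
  have e : (empiricalMeasure x : Measure X) = ((J : ℝ≥0)⁻¹) • ∑ j : Fin J, Measure.dirac (x j) := by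
    simp [empiricalMeasure, diracProba]
    rfl
  rw [e, integral_smul_nnreal_measure, integral_finsetSum_measure (fun j _ => ?_)]
  · simp only [integral_dirac' _ _ hg.stronglyMeasurable, NNReal.smul_def]
    simp
  · exact (integrable_dirac' hg.stronglyMeasurable (by simp))

theorem clip_abs_le {M x : ℝ} (hM : 0 ≤ M) : |max (-M) (min M x)| ≤ M := by
  rw [abs_le]
  exact ⟨le_max_left _ _, max_le (by linarith) (min_le_left _ _)⟩

/-- The error of truncation at `M` is at most `x ^ 2 / M`, uniformly in `x`. -/
theorem abs_sub_clip_le {M x : ℝ} (hM : 0 < M) : |x - max (-M) (min M x)| ≤ x ^ 2 / M := by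
  rw [le_div_iff₀ hM]
  rcases le_total x M with h1 | h1
  · rcases le_total (-M) x with h2 | h2
    · rw [min_eq_right h1, max_eq_right h2]; simp; positivity
    · rw [min_eq_right h1, max_eq_left h2, abs_of_nonpos (by linarith)]; nlinarith
  · rw [min_eq_left h1, max_eq_right (by linarith), abs_of_nonneg (by linarith)]; nlinarith

variable [TopologicalSpace X] [BorelSpace X] {x : ∀ J : ℕ, Fin J → X} {ν : ProbabilityMeasure X}

theorem average_tendsto_of_bounded
    (hν : Tendsto (fun J => empiricalMeasure (x J)) atTop (𝓝 ν.toFiniteMeasure)) {g : X → ℝ}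
    (hg : Continuous g) {M : ℝ} (hM : ∀ y, |g y| ≤ M) :
    Tendsto (fun J : ℕ => (1 / (J : ℝ)) * ∑ j, g (x J j)) atTop (𝓝 (∫ y,
        g y ∂(ν : Measure X))) := by
  have h := FiniteMeasure.tendsto_iff_forall_integral_tendsto.1 hν
    (BoundedContinuousFunction.ofNormedAddCommGroup g hg M hM)
  refine Tendsto.congr (fun J => ?_) h
  exact integral_empiricalMeasure (x J) hg

/-- Averages of a continuous function converge along weakly convergent empirical measures as soon
as the averages of its square stay bounded. -/
theorem average_tendsto_of_sq_bounded
    (hν : Tendsto (fun J => empiricalMeasure (x J)) atTop (𝓝 ν.toFiniteMeasure)) {f : X → ℝ}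
    (hf : Continuous f) {K : ℝ} (hK : ∀ J : ℕ, 1 ≤ J → (1 / (J : ℝ)) * ∑ j, f (x J j) ^ 2 ≤ K) :
    Tendsto (fun J : ℕ => (1 / (J : ℝ)) * ∑ j, f (x J j)) atTop (𝓝 (∫ y,
        f y ∂(ν : Measure X))) := by
  have hK0 : 0 ≤ K := le_trans (by positivity) (hK 1 le_rfl)
  have hmin : ∀ n : ℕ, ∫ y, min (f y ^ 2) n ∂(ν : Measure X) ≤ K := fun n => by
    have hb : ∀ y, |min (f y ^ 2) (n : ℝ)| ≤ n := fun y => by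
      rw [abs_of_nonneg (le_min (sq_nonneg _) (Nat.cast_nonneg _))]; exact min_le_right _ _
    refine le_of_tendsto (average_tendsto_of_bounded hν (by fun_prop) hb) ?_
    filter_upwards [eventually_ge_atTop 1] with J hJ
    refine le_trans ?_ (hK J hJ)
    gcongr
    exact min_le_left _ _
  have hlint : ∫⁻ y, ENNReal.ofReal (f y ^ 2) ∂(ν : Measure X) ≤ ENNReal.ofReal K := by
    have hlim : ∀ y, Tendsto (fun n : ℕ => ENNReal.ofReal (min (f y ^ 2) n)) atTop
        (𝓝 (ENNReal.ofReal (f y ^ 2))) := fun y => by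
      refine tendsto_const_nhds.congr' ?_
      filter_upwards [tendsto_natCast_atTop_atTop.eventually_ge_atTop (f y ^ 2)] with n hn
      rw [min_eq_left hn]
    calc ∫⁻ y, ENNReal.ofReal (f y ^ 2) ∂(ν : Measure X)
        = ∫⁻ y, liminf (fun n : ℕ => ENNReal.ofReal (min (f y ^ 2) n)) atTop ∂(ν : Measure X) := by
          simp only [(hlim _).liminf_eq]
      _ ≤ liminf (fun n : ℕ => ∫⁻ y, ENNReal.ofReal (min (f y ^ 2) n) ∂(ν : Measure X)) atTop :=
          lintegral_liminf_le fun n => (ENNReal.continuous_ofReal.comp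
            (by fun_prop : Continuous fun y => min (f y ^ 2) (n : ℝ))).measurable
      _ ≤ ENNReal.ofReal K := by
          refine liminf_le_of_le (by isBoundedDefault) fun b hb => ?_
          obtain ⟨n, hn⟩ := hb.exists
          refine hn.trans ?_
          rw [← ofReal_integral_eq_lintegral_ofReal]
          · exact ENNReal.ofReal_le_ofReal (hmin n)
          · refine Integrable.of_bound (C := n) (by fun_prop : Continuous fun y => min (f y ^ 2)
                (n : ℝ)).aestronglyMeasurable
              (Eventually.of_forall fun y => ?_)
            rw [Real.norm_of_nonneg (le_min (sq_nonneg _)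
                (Nat.cast_nonneg _))]; exact min_le_right _ _
          · exact Eventually.of_forall fun y => le_min (sq_nonneg _) (Nat.cast_nonneg _)
  have hint2 : Integrable (fun y => f y ^ 2) (ν : Measure X) :=
    ⟨(hf.pow 2).aestronglyMeasurable, (hasFiniteIntegral_iff_ofReal (Eventually.of_forall fun y =>
        sq_nonneg _)).2
      (hlint.trans_lt ENNReal.ofReal_lt_top)⟩
  have hI2 : ∫ y, f y ^ 2 ∂(ν : Measure X) ≤ K := by
    rw [integral_eq_lintegral_of_nonneg_ae (Eventually.of_forall fun y => sq_nonneg _)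
        (hf.pow 2).aestronglyMeasurable]
    exact ENNReal.toReal_le_of_le_ofReal hK0 hlint
  have hint : Integrable f (ν : Measure X) :=
    ((memLp_two_iff_integrable_sq hf.aestronglyMeasurable).2 hint2).integrable (by norm_num)
  rw [Metric.tendsto_atTop]
  intro ε hε
  obtain ⟨M, hM0, hMK⟩ : ∃ M : ℝ, 0 < M ∧ K / M < ε / 3 := by
    refine ⟨3 * (K + 1) / ε, by positivity, ?_⟩
    rw [div_div_eq_mul_div, div_lt_div_iff₀ (by positivity) (by norm_num)]
    nlinarith
  have hcc : Continuous fun y => max (-M) (min M (f y)) := by fun_prop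
  obtain ⟨N, hN⟩ := Metric.tendsto_atTop.1 (average_tendsto_of_bounded hν hcc (M := M)
    (fun y => clip_abs_le hM0.le)) (ε / 3) (by positivity)
  refine ⟨max N 1, fun J hJ => ?_⟩
  have h1 := hN J (le_of_max_le_left hJ)
  have h2 : |(1 / (J : ℝ)) * ∑ j, f (x J j) - (1 / (J : ℝ)) * ∑ j, max (-M) (min M (f (x J j)))| ≤
      K / M := by
    rw [← mul_sub, ← Finset.sum_sub_distrib, abs_mul, abs_of_nonneg (by positivity : (0 : ℝ) ≤
        1 / J)]
    calc _ ≤ (1 / (J : ℝ)) * ∑ j, f (x J j) ^ 2 / M := by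
          gcongr
          exact (Finset.abs_sum_le_sum_abs _ _).trans (Finset.sum_le_sum fun j _ =>
              abs_sub_clip_le hM0)
      _ = ((1 / (J : ℝ)) * ∑ j, f (x J j) ^ 2) / M := by rw [← Finset.sum_div, mul_div_assoc]
      _ ≤ K / M := by
          have := hK J (le_of_max_le_right hJ)
          gcongr
  have hintc : Integrable (fun y => max (-M) (min M (f y))) (ν : Measure X) :=
    Integrable.of_bound (C := M) hcc.aestronglyMeasurable
      (Eventually.of_forall fun y => clip_abs_le hM0.le)
  have h3 : |∫ y, max (-M) (min M (f y)) ∂(ν : Measure X) - ∫ y, f y ∂(ν : Measure X)| ≤ K / M := by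
    rw [abs_sub_comm, ← integral_sub hint hintc]
    calc _ ≤ ∫ y, |f y - max (-M) (min M (f y))| ∂(ν : Measure X) := abs_integral_le_integral_abs
      _ ≤ ∫ y, f y ^ 2 / M ∂(ν : Measure X) :=
          integral_mono (hint.sub hintc).abs (hint2.div_const M) fun y => abs_sub_clip_le hM0
      _ = (∫ y, f y ^ 2 ∂(ν : Measure X)) / M := integral_div _ _
      _ ≤ K / M := by gcongr
  rw [Real.dist_eq] at h1 ⊢
  have := abs_sub_le ((1 / (J : ℝ)) * ∑ j, f (x J j)) ((1 / (J : ℝ)) * ∑ j, max (-M)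
      (min M (f (x J j)))) (∫ y, f y ∂(ν : Measure X))
  have := abs_sub_le ((1 / (J : ℝ)) * ∑ j, max (-M) (min M (f (x J j)))) (∫ y, max (-M)
      (min M (f y)) ∂(ν : Measure X)) (∫ y, f y ∂(ν : Measure X))
  linarith

end Moments

/-! ### Recorded outcomes -/

section Outcomes

variable {J L m : ℕ}

/-- The recorded focal outcomes of a session are its potential outcomes under the path that is
constantly equal to the session's label. -/
theorem observed_eq_pick {Y : Outcomes (J * L)} (hna : NonAnticipating Y) (hco : Carryover m Y)
    (z : Fin J → Bool) :
    observed m Y z = pick (focalOutcome m Y true) (focalOutcome m Y false) z := by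
  ext j ℓ
  have hpick : pick (focalOutcome m Y true) (focalOutcome m Y false) z j ℓ =
      focalOutcome m Y (z j) j ℓ := by
    unfold pick; cases z j <;> simp
  rw [hpick, observed, focalOutcome]
  set t := focalTime j ℓ with ht
  have htval : (t : ℕ) = (m + ℓ) + L * j := by simp [ht, focalTime, finProdFinEquiv]
  have hℓ := ℓ.2
  -- the outcome ignores labels after `t`, so only the part of the session up to `t` matters
  let w : Path (J * L) := fun s => if s ≤ t then sessionPath L z s else z j
  rw [hna t (sessionPath L z) w fun s hs => by simp [w, hs]]
  refine hco t w _ (by omega) fun s hs => ?_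
  by_cases hst : s ≤ t
  · simp only [w, hst, if_true, sessionPath]
    congr 1
    have hst' : (s : ℕ) ≤ t := hst
    apply Fin.ext
    have : ((sessionOf s : Fin J) : ℕ) = (s : ℕ) / L := by
      simp [sessionOf, finProdFinEquiv, Fin.divNat]
    rw [this]
    refine Nat.div_eq_of_lt_le ?_ ?_
    · rw [mul_comm]; omega
    · have hc := mul_comm (j : ℕ) L
      rw [Nat.succ_mul, hc]; omega
  · simp [w, hst]

end Outcomes

/-! ### Limits of the covariance matrices -/

/-- Truncation of a probability to the overlap region `[pmin, 1 - pmin]`. -/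
noncomputable def clip (pmin q : ℝ) : ℝ := max pmin (min q (1 - pmin))

theorem continuous_clip (pmin : ℝ) : Continuous (clip pmin) := by
  unfold clip; fun_prop

theorem clip_mem {pmin : ℝ} (h : pmin < 1 / 2) (q : ℝ) :
    pmin ≤ clip pmin q ∧ clip pmin q ≤ 1 - pmin :=
  ⟨le_max_left _ _, max_le (by linarith) (min_le_right _ _)⟩

theorem clip_eq_self {pmin q : ℝ} (h : pmin ≤ q ∧ q ≤ 1 - pmin) : clip pmin q = q := by
  rw [clip, min_eq_left h.2, max_eq_right h.1]

theorem abs_apply_le_norm {ι : Type*} [Fintype ι] (x : EuclideanSpace ℝ ι) (a : ι) : |x a| ≤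
    ‖x‖ := by
  simpa using PiLp.norm_apply_le x a

section FocalMoments

variable {L m : ℕ} {Y : (J : ℕ) → Outcomes (J * L)} {p : (J : ℕ) → Fin J → unitInterval}
  {pmin C : ℝ} {ν : ProbabilityMeasure (SessionData (L - m))}

/-- Functions of at most quadratic growth in the outcomes have convergent averages. -/
theorem VectorAsymptotics.tendsto_average (h : VectorAsymptotics m Y p pmin C ν)
    {f : SessionData (L - m) → ℝ} (hf : Continuous f) {K : ℝ}
    (hK : ∀ x, |f x| ≤ K * max ‖x.2.1‖ ‖x.2.2‖ ^ 2) :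
    Tendsto (fun J : ℕ => (1 / (J : ℝ)) * ∑ j, f ((p J j : ℝ), focalVec m (Y J) true j,
        focalVec m (Y J) false j))
      atTop (𝓝 (∫ x, f x ∂(ν : Measure (SessionData (L - m))))) := by
  refine average_tendsto_of_sq_bounded h.stabilization hf (K := K ^ 2 * C) fun J hJ => ?_
  calc _ ≤ (1 / (J : ℝ)) * ∑ j, K ^ 2 *
          max ‖focalVec m (Y J) true j‖ ‖focalVec m (Y J) false j‖ ^ 4 := by
        gcongr with j
        rw [← sq_abs]
        refine (pow_le_pow_left₀ (abs_nonneg _) (hK _) 2).trans (le_of_eq ?_)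
        ring
    _ = K ^ 2 * ((1 / (J : ℝ)) * ∑ j,
          max ‖focalVec m (Y J) true j‖ ‖focalVec m (Y J) false j‖ ^ 4) := by
        rw [← Finset.mul_sum]; ring
    _ ≤ K ^ 2 * C := mul_le_mul_of_nonneg_left (h.fourth_moment J hJ) (sq_nonneg _)

/-- The limit law is carried by the overlap region. -/
theorem VectorAsymptotics.ae_clip_eq (h : VectorAsymptotics m Y p pmin C ν) :
    ∀ᵐ x ∂(ν : Measure (SessionData (L - m))), clip pmin x.1 = x.1 := by
  have hc : Continuous fun x : SessionData (L - m) => min |clip pmin x.1 - x.1| 1 :=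
    (((continuous_clip pmin).comp continuous_fst).sub continuous_fst).abs.min continuous_const
  have hb : ∀ x : SessionData (L - m), |min |clip pmin x.1 - x.1| 1| ≤ 1 := fun x => by
    rw [abs_of_nonneg (le_min (abs_nonneg _) zero_le_one)]; exact min_le_right _ _
  have hlim := average_tendsto_of_bounded h.stabilization hc hb
  simp only [clip_eq_self (h.overlap _ _), sub_self, abs_zero, zero_le_one, min_eq_left,
    Finset.sum_const_zero, mul_zero] at hlim
  have h0 := tendsto_nhds_unique hlim tendsto_const_nhds
  have hint : Integrable (fun x : SessionData (L - m) => min |clip pmin x.1 - x.1| 1)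
      (ν : Measure (SessionData (L - m))) :=
    Integrable.of_bound (C := 1) hc.aestronglyMeasurable (Eventually.of_forall hb)
  rw [integral_eq_zero_iff_of_nonneg (fun x => le_min (abs_nonneg _) zero_le_one) hint] at h0
  filter_upwards [h0] with x hx
  by_contra hne
  have : 0 < |clip pmin x.1 - x.1| := abs_pos.2 (sub_ne_zero.2 hne)
  exact (lt_min this one_pos).ne' hx

theorem abs_mul_div_add_le {n : ℕ} {pmin c d : ℝ} (h0 : 0 < pmin) (hc : pmin ≤ c) (hd : pmin ≤ d)
    (x y : EuclideanSpace ℝ (Fin n)) (a b : Fin n) :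
    |x a * x b / c + y a * y b / d| ≤ 2 / pmin * max ‖x‖ ‖y‖ ^ 2 := by
  set r := max ‖x‖ ‖y‖ with hr
  have hxr : ∀ a, |x a| ≤ r := fun a => (abs_apply_le_norm x a).trans (le_max_left _ _)
  have hyr : ∀ a, |y a| ≤ r := fun a => (abs_apply_le_norm y a).trans (le_max_right _ _)
  have hr0 : 0 ≤ r := (norm_nonneg x).trans (le_max_left _ _)
  have e1 : |x a * x b / c| ≤ r ^ 2 / pmin := by
    rw [abs_div, abs_mul, abs_of_pos (h0.trans_le hc), sq]
    exact div_le_div₀ (by positivity) (mul_le_mul (hxr a) (hxr b) (abs_nonneg _) hr0) h0 hc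
  have e2 : |y a * y b / d| ≤ r ^ 2 / pmin := by
    rw [abs_div, abs_mul, abs_of_pos (h0.trans_le hd), sq]
    exact div_le_div₀ (by positivity) (mul_le_mul (hyr a) (hyr b) (abs_nonneg _) hr0) h0 hd
  refine (abs_add_le _ _).trans ((add_le_add e1 e2).trans (le_of_eq ?_))
  ring

theorem abs_div_add_div_le {n : ℕ} {pmin c d : ℝ} (h0 : 0 < pmin) (hc : pmin ≤ c) (hd : pmin ≤ d)
    (x y : EuclideanSpace ℝ (Fin n)) (a : Fin n) :
    |x a / c + y a / d| ≤ 2 / pmin * max ‖x‖ ‖y‖ := by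
  have e1 : |x a / c| ≤ max ‖x‖ ‖y‖ / pmin := by
    rw [abs_div, abs_of_pos (h0.trans_le hc)]
    exact div_le_div₀ (by positivity) ((abs_apply_le_norm x a).trans (le_max_left _ _)) h0 hc
  have e2 : |y a / d| ≤ max ‖x‖ ‖y‖ / pmin := by
    rw [abs_div, abs_of_pos (h0.trans_le hd)]
    exact div_le_div₀ (by positivity) ((abs_apply_le_norm y a).trans (le_max_right _ _)) h0 hd
  refine (abs_add_le _ _).trans ((add_le_add e1 e2).trans (le_of_eq ?_))
  ring

theorem VectorAsymptotics.tendsto_upCov (h : VectorAsymptotics m Y p pmin C ν) :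
    ∃ U : Matrix (Fin (L - m)) (Fin (L - m)) ℝ, ∀ a b, Tendsto (fun J =>
      upCov (p J) (focalOutcome m (Y J) true)
          (focalOutcome m (Y J) false) a b) atTop (𝓝 (U a b)) := by
  have hm := fun q => clip_mem h.pmin_lt q
  have h0 := h.pmin_pos
  refine ⟨Matrix.of fun a b => _, fun a b => Tendsto.congr (fun J => ?_) (h.tendsto_average
    (f := fun x => x.2.1 a * x.2.1 b / clip pmin x.1 + x.2.2 a * x.2.2 b / (1 - clip pmin x.1)) ?_
    (K := 2 / pmin) ?_)⟩
  · simp only [clip_eq_self (h.overlap _ _), upCov, Matrix.of_apply]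
    rfl
  · have hc : Continuous fun x : SessionData (L - m) => clip pmin x.1 :=
      (continuous_clip pmin).comp continuous_fst
    exact (Continuous.div (by fun_prop) hc fun x => by linarith [(hm x.1).1]).add
      (Continuous.div (by fun_prop) (by fun_prop) fun x => by linarith [(hm x.1).2])
  · intro x
    exact abs_mul_div_add_le h0 (hm x.1).1 (by linarith [(hm x.1).2]) _ _ _ _

theorem VectorAsymptotics.tendsto_htCov (h : VectorAsymptotics m Y p pmin C ν) :
    ∃ S : Matrix (Fin (L - m)) (Fin (L - m)) ℝ, ∀ a b, Tendsto (fun J =>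
      htCov (p J) (focalOutcome m (Y J) true)
          (focalOutcome m (Y J) false) a b) atTop (𝓝 (S a b)) := by
  have hm := fun q => clip_mem h.pmin_lt q
  have h0 := h.pmin_pos
  refine ⟨Matrix.of fun a b => _, fun a b => Tendsto.congr (fun J => ?_) (h.tendsto_average
    (f := fun x => clip pmin x.1 * (1 - clip pmin x.1) *
      ((x.2.1 a / clip pmin x.1 + x.2.2 a / (1 - clip pmin x.1)) *
        (x.2.1 b / clip pmin x.1 + x.2.2 b / (1 - clip pmin x.1)))) ?_
    (K := (2 / pmin) ^ 2) ?_)⟩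
  · simp only [clip_eq_self (h.overlap _ _), htCov, htCoef, Matrix.of_apply]
    rfl
  · have hc : Continuous fun x : SessionData (L - m) => clip pmin x.1 :=
      (continuous_clip pmin).comp continuous_fst
    have hV : ∀ a, Continuous fun x : SessionData (L - m) =>
        x.2.1 a / clip pmin x.1 + x.2.2 a / (1 - clip pmin x.1) := fun a =>
      (Continuous.div (by fun_prop) hc fun x => by linarith [(hm x.1).1]).add
        (Continuous.div (by fun_prop) (by fun_prop) fun x => by linarith [(hm x.1).2])
    exact (hc.mul (continuous_const.sub hc)).mul ((hV a).mul (hV b))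
  · intro x
    have hc0 := (hm x.1).1
    have hc1 := (hm x.1).2
    have ha := abs_div_add_div_le h0 hc0 (by linarith : pmin ≤ 1 - clip pmin x.1) x.2.1 x.2.2 a
    have hb := abs_div_add_div_le h0 hc0 (by linarith : pmin ≤ 1 - clip pmin x.1) x.2.1 x.2.2 b
    rw [abs_mul]
    have e : |clip pmin x.1 * (1 - clip pmin x.1)| ≤ 1 := by
      rw [abs_of_nonneg (mul_nonneg (by linarith) (by linarith))]; nlinarith
    calc _ ≤ 1 * ((2 / pmin * max ‖x.2.1‖ ‖x.2.2‖) * (2 / pmin * max ‖x.2.1‖ ‖x.2.2‖)) := by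
          exact mul_le_mul e ((abs_mul _ _).le.trans
            (mul_le_mul ha hb (abs_nonneg _) ((abs_nonneg _).trans ha))) (abs_nonneg _) zero_le_one
      _ = _ := by ring

theorem VectorAsymptotics.tendsto_crossCov (h : VectorAsymptotics m Y p pmin C ν)
    (a b : Fin (L - m)) : Tendsto (fun J =>
      crossCov (p J) (focalOutcome m (Y J) true) (focalOutcome m (Y J) false) a b) atTop
        (𝓝 (sigmaR (ν : Measure (SessionData (L - m))) a b)) := by
  have hm := fun q => clip_mem h.pmin_lt q
  have h0 := h.pmin_pos
  have e : sigmaR (ν : Measure (SessionData (L - m))) a b = ∫ x,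
      (x.2.1 a * x.2.1 b / (1 - clip pmin x.1) +
      x.2.2 a * x.2.2 b / clip pmin x.1) ∂(ν : Measure (SessionData (L - m))) := by
    simp only [sigmaR, Matrix.of_apply]
    refine integral_congr_ae ?_
    filter_upwards [h.ae_clip_eq] with x hx
    rw [hx]
  rw [e]
  refine Tendsto.congr (fun J => ?_) (h.tendsto_average (K := 2 / pmin) ?_ ?_)
  · simp only [clip_eq_self (h.overlap _ _), crossCov, Matrix.of_apply]
    rfl
  · have hc : Continuous fun x : SessionData (L - m) => clip pmin x.1 :=
      (continuous_clip pmin).comp continuous_fst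
    exact (Continuous.div (by fun_prop) (by fun_prop) fun x => by linarith [(hm x.1).2]).add
      (Continuous.div (by fun_prop) hc fun x => by linarith [(hm x.1).1])
  · intro x
    exact abs_mul_div_add_le h0 (by linarith [(hm x.1).2]) (hm x.1).1 _ _ _ _

theorem VectorAsymptotics.moment_le (h : VectorAsymptotics m Y p pmin C ν) (t : Bool) (J : ℕ)
    (a : Fin (L - m)) : (1 / (J : ℝ)) * ∑ j, focalOutcome m (Y J) t j a ^ 4 ≤ C := by
  rcases Nat.eq_zero_or_pos J with rfl | hJ
  · have : 0 ≤ C := le_trans (by positivity) (h.fourth_moment 1 le_rfl)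
    simpa
  · refine le_trans ?_ (h.fourth_moment J hJ)
    refine mul_le_mul_of_nonneg_left (Finset.sum_le_sum fun j _ => ?_) (by positivity)
    rw [← (by decide : Even 4).pow_abs]
    refine pow_le_pow_left₀ (abs_nonneg _) ?_ 4
    have := abs_apply_le_norm (focalVec m (Y J) t j) a
    cases t
    · exact this.trans (le_max_right _ _)
    · exact this.trans (le_max_left _ _)

/-- A selection of focal positions at which the average effect vanishes gives a convergent sequence
of experiments. -/
theorem VectorAsymptotics.exists_arrayLimit (h : VectorAsymptotics m Y p pmin C ν) {κ : Type*}
    (e : κ → Fin (L - m)) (hτ : ∀ J k, tau m (Y J) (e k) = 0) :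
    ∃ S U : Matrix κ κ ℝ, ArrayLimit (J := id) p
      (fun J j k => focalOutcome m (Y J) true j (e k))
      (fun J j k => focalOutcome m (Y J) false j (e k)) pmin C S U := by
  obtain ⟨S, hS⟩ := h.tendsto_htCov
  obtain ⟨U, hU⟩ := h.tendsto_upCov
  refine ⟨S.submatrix e e, U.submatrix e e, ⟨h.pmin_pos, tendsto_id, h.overlap,
    fun J k => h.moment_le true J (e k), fun J k => h.moment_le false J (e k), fun J k => ?_,
    fun k l => hS (e k) (e l), fun k l => hU (e k) (e l)⟩⟩
  rcases Nat.eq_zero_or_pos J with rfl | hJ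
  · exact Finset.sum_eq_zero fun j => Fin.elim0 j
  · have := hτ J k
    rw [tau, mul_eq_zero] at this
    exact this.resolve_left (by positivity)

end FocalMoments

/-! ### Comparison of the covariance matrices -/

section Comparison

variable {κ : Type*} [Fintype κ] {p : ∀ J, Fin J → unitInterval}
    {u1 u0 : ∀ J, Fin J → κ → ℝ} {pmin C : ℝ} {S U Q : Matrix κ κ ℝ}

theorem dotProduct_upCov {J : ℕ} (p : Fin J → unitInterval) (u1 u0 : Fin J → κ → ℝ) (t : κ → ℝ) :
    t ⬝ᵥ (upCov p u1 u0 *ᵥ t) = (1 / (J : ℝ)) *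
      ∑ j, ((u1 j ⬝ᵥ t) ^ 2 / (p j : ℝ) + (u0 j ⬝ᵥ t) ^ 2 / (1 - (p j : ℝ))) := by
  have e : upCov p u1 u0 = (Matrix.of fun a b => (1 / (J : ℝ)) * ∑ j,
      (p j : ℝ)⁻¹ * (u1 j a * u1 j b)) +
      Matrix.of fun a b => (1 / (J : ℝ)) * ∑ j, (1 - (p j : ℝ))⁻¹ * (u0 j a * u0 j b) := by
    ext a b
    simp only [upCov, Matrix.of_apply, Matrix.add_apply, Finset.sum_add_distrib, mul_add,
        div_eq_inv_mul]
  rw [e, Matrix.add_mulVec, dotProduct_add, dotProduct_weightedGram, dotProduct_weightedGram,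
    ← mul_add, ← Finset.sum_add_distrib]
  simp only [div_eq_inv_mul]

theorem dotProduct_crossCov {J : ℕ} (p : Fin J → unitInterval) (u1 u0 : Fin J → κ → ℝ) (t : κ → ℝ) :
    t ⬝ᵥ (crossCov p u1 u0 *ᵥ t) = (1 / (J : ℝ)) *
      ∑ j, ((u1 j ⬝ᵥ t) ^ 2 / (1 - (p j : ℝ)) + (u0 j ⬝ᵥ t) ^ 2 / (p j : ℝ)) := by
  have e : crossCov p u1 u0 = (Matrix.of fun a b => (1 / (J : ℝ)) * ∑ j, (1 -
      (p j : ℝ))⁻¹ * (u1 j a * u1 j b)) +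
      Matrix.of fun a b => (1 / (J : ℝ)) * ∑ j, (p j : ℝ)⁻¹ * (u0 j a * u0 j b) := by
    ext a b
    simp only [crossCov, Matrix.of_apply, Matrix.add_apply, Finset.sum_add_distrib, mul_add,
        div_eq_inv_mul]
  rw [e, Matrix.add_mulVec, dotProduct_add, dotProduct_weightedGram, dotProduct_weightedGram,
    ← mul_add, ← Finset.sum_add_distrib]
  simp only [div_eq_inv_mul]

/-- The upper-bound covariance dominates the covariance of the estimator: the difference is the
second-moment matrix of the individual effects. -/
theorem ArrayLimit.cov_le_up (h : ArrayLimit (J := id) p u1 u0 pmin C S U) (t : κ → ℝ) :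
    t ⬝ᵥ (S *ᵥ t) ≤ t ⬝ᵥ (U *ᵥ t) := by
  refine le_of_tendsto_of_tendsto' (tendsto_dotProduct_mulVec h.cov t)
      (tendsto_dotProduct_mulVec h.up t)
    fun J => ?_
  rw [dotProduct_htCov, dotProduct_upCov]
  gcongr with j
  have h0 := (h.p_mem J j).1
  have h1 : 0 < (1 - (p J j : ℝ)) := by linarith [(h.p_mem J j).2]
  have e : htCoef (p J) (u1 J) (u0 J) j ⬝ᵥ t = (u1 J j ⬝ᵥ t) / (p J j : ℝ) + (u0 J j ⬝ᵥ t) / (1 -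
      (p J j : ℝ)) := by
    simp only [htCoef, dotProduct, Finset.sum_div, ← Finset.sum_add_distrib]
    exact Finset.sum_congr rfl fun k _ => by ring
  rw [e]
  set x := u1 J j ⬝ᵥ t
  set y := u0 J j ⬝ᵥ t
  have : x ^ 2 / (p J j : ℝ) + y ^ 2 / (1 - (p J j : ℝ)) -
    (p J j : ℝ) * (1 - (p J j : ℝ)) * (x / (p J j : ℝ) + y / (1 - (p J j : ℝ))) ^ 2 =
        (x - y) ^ 2 := by
    field_simp
    ring
  nlinarith [sq_nonneg (x - y)]

/-- Overlap makes the upper-bound covariance at least `pmin` times the average covariance of the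
redrawn estimator, so it inherits nondegeneracy. -/
theorem ArrayLimit.up_posDef (h : ArrayLimit (J := id) p u1 u0 pmin C S U)
    (hcross : ∀ k l, Tendsto (fun J => crossCov (p J) (u1 J) (u0 J) k l) atTop (𝓝 (Q k l)))
    (hQ : Q.PosDef) : U.PosDef := by
  have h0 := h.pmin_pos
  refine Matrix.PosDef.of_dotProduct_mulVec_pos ?_ fun t ht => ?_
  · ext a b
    simp only [Matrix.conjTranspose_apply, star_trivial]
    refine tendsto_nhds_unique (h.up b a) ((h.up a b).congr fun i => ?_)
    simp only [upCov, Matrix.of_apply, mul_comm]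
  · simp only [star_trivial]
    have hpos := hQ.dotProduct_mulVec_pos ht
    simp only [star_trivial] at hpos
    refine (mul_pos h0 hpos).trans_le ?_
    refine le_of_tendsto_of_tendsto' ((tendsto_dotProduct_mulVec hcross t).const_mul pmin)
      (tendsto_dotProduct_mulVec h.up t) fun J => ?_
    rw [dotProduct_crossCov, dotProduct_upCov, mul_left_comm, Finset.mul_sum]
    refine mul_le_mul_of_nonneg_left (Finset.sum_le_sum fun j _ => ?_) (by positivity)
    have hp0 := (h.p_mem J j).1
    have hp1 : 0 < (1 - (p J j : ℝ)) := by linarith [(h.p_mem J j).2]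
    obtain ⟨h1, h2⟩ := h.overlap J j
    rw [mul_add, ← mul_div_assoc, ← mul_div_assoc]
    refine add_le_add ?_ ?_
    · rw [div_le_div_iff₀ hp1 hp0]
      have : pmin * (p J j : ℝ) ≤ 1 - (p J j : ℝ) := by nlinarith
      nlinarith [mul_le_mul_of_nonneg_left this (sq_nonneg (u1 J j ⬝ᵥ t))]
    · rw [div_le_div_iff₀ hp0 hp1]
      have : pmin * (1 - (p J j : ℝ)) ≤ (p J j : ℝ) := by nlinarith
      nlinarith [mul_le_mul_of_nonneg_left this (sq_nonneg (u0 J j ⬝ᵥ t))]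

end Comparison

/-! ### Binomial tails and beta densities -/

section Binomial

/-- The probability that a binomial variable with `B` trials and success probability `q` is
smaller than `k`. -/
noncomputable def binomialBelow (B k : ℕ) (q : ℝ) : ℝ :=
  ∑ i ∈ Finset.range k, (bernsteinPolynomial ℝ B i).eval q

/-- The density of the `k`-th smallest of `B` independent uniform variables. -/
noncomputable def betaDensity (B k : ℕ) (a : ℝ) : ℝ :=
  B * (bernsteinPolynomial ℝ (B - 1) (k - 1)).eval a

theorem bernstein_eval (B i : ℕ) (q : ℝ) :
    (bernsteinPolynomial ℝ B i).eval q = (B.choose i : ℝ) * q ^ i * (1 - q) ^ (B - i) := by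
  simp [bernsteinPolynomial]

/-- The number of independent draws that fall in a set is binomial. -/
theorem measureReal_count_lt {Ω : Type*} [MeasurableSpace Ω] (μ : Measure Ω)
    [IsProbabilityMeasure μ] {A : Set Ω} [DecidablePred (· ∈ A)] (hA : MeasurableSet A) {B k : ℕ}
        (hk : k ≤ B + 1) :
    (Measure.pi fun _ : Fin B => μ).real
      {ω | (Finset.univ.filter fun b => ω b ∈ A).card < k} = binomialBelow B k (μ.real A) := by
  classical
  let c : Finset (Fin B) → Set (Fin B → Ω) := fun s => Set.pi Set.univ fun b =>
      if b ∈ s then A else Aᶜ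
  have hc : ∀ s ω, ω ∈ c s ↔ (Finset.univ.filter fun b => ω b ∈ A) = s := by
    intro s ω
    simp only [c, Set.mem_pi, Set.mem_univ, true_imp_iff, Finset.ext_iff, Finset.mem_filter,
      Finset.mem_univ, true_and]
    refine forall_congr' fun b => ?_
    by_cases hb : b ∈ s <;> simp [hb]
  have hset : {ω : Fin B → Ω | (Finset.univ.filter fun b => ω b ∈ A).card < k} =
      ⋃ s ∈ (Finset.univ : Finset (Finset (Fin B))).filter (fun s => s.card < k), c s := by
    ext ω
    simp only [Set.mem_ofPred_eq, Set.mem_iUnion, hc, Finset.mem_filter, Finset.mem_univ, true_and,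
      exists_prop, exists_eq_right']
  have hcm : ∀ s, (Measure.pi fun _ : Fin B => μ).real (c s) =
      μ.real A ^ s.card * (1 - μ.real A) ^ (B - s.card) := by
    intro s
    rw [measureReal_def, Measure.pi_pi, ENNReal.toReal_prod]
    have : ∀ b, (μ (if b ∈ s then A else Aᶜ)).toReal =
        if b ∈ s then μ.real A else 1 - μ.real A := by
      intro b
      split_ifs
      · rfl
      · exact probReal_compl_eq_one_sub hA
    simp only [this]
    rw [Finset.prod_ite]
    simp only [Finset.prod_const]
    have e : (Finset.univ.filter fun b => b ∉ s) = sᶜ := by ext; simp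
    rw [e, Finset.card_compl, Fintype.card_fin]
    simp
  rw [hset, measureReal_biUnion_finset]
  · simp only [hcm]
    rw [Finset.sum_filter]
    have := Finset.sum_powerset_apply_card (x := (Finset.univ : Finset (Fin B)))
      (fun i => if i < k then μ.real A ^ i * (1 - μ.real A) ^ (B - i) else 0)
    rw [Finset.powerset_univ] at this
    rw [this]
    simp only [Finset.card_univ, Fintype.card_fin, nsmul_eq_mul, mul_ite, mul_zero]
    rw [← Finset.sum_filter]
    have e : (Finset.range (B + 1)).filter (· < k) = Finset.range k := by
      ext i; simp; omega
    rw [e, binomialBelow]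
    refine Finset.sum_congr rfl fun i _ => ?_
    rw [bernstein_eval, mul_assoc]
  · intro s _ t _ hst
    rw [Function.onFun, Set.disjoint_left]
    intro ω h1 h2
    exact hst (((hc s ω).1 h1).symm.trans ((hc t ω).1 h2))
  · intro s _
    refine MeasurableSet.univ_pi fun b => ?_
    split_ifs
    exacts [hA, hA.compl]

/-- The sum telescopes under differentiation in the success probability. -/
theorem hasDerivAt_binomialBelow (B k : ℕ) (q : ℝ) :
    HasDerivAt (binomialBelow B (k + 1)) (-betaDensity B (k + 1) q) q := by
  induction k with
  | zero =>
    have h := (bernsteinPolynomial ℝ B 0).hasDerivAt q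
    rw [bernsteinPolynomial.derivative_zero] at h
    have e : binomialBelow B (0 + 1) = fun q => (bernsteinPolynomial ℝ B 0).eval q := by
      ext q; simp [binomialBelow]
    have e2 : -betaDensity B (0 + 1) q =
        Polynomial.eval q (-(B : Polynomial ℝ) * bernsteinPolynomial ℝ (B - 1) 0) := by
      simp [betaDensity]
    rw [e, e2]
    exact h
  | succ k ih =>
    have h := (bernsteinPolynomial ℝ B (k + 1)).hasDerivAt q
    rw [bernsteinPolynomial.derivative_succ] at h
    have e : binomialBelow B (k + 1 + 1) = fun q => binomialBelow B (k + 1) q +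
        (bernsteinPolynomial ℝ B (k + 1)).eval q := by
      ext q; rw [binomialBelow, Finset.sum_range_succ]; rfl
    have e2 : -betaDensity B (k + 1 + 1) q = -betaDensity B (k + 1) q +
        Polynomial.eval q ((B : Polynomial ℝ) *
          (bernsteinPolynomial ℝ (B - 1) k - bernsteinPolynomial ℝ (B - 1) (k + 1))) := by
      simp [betaDensity]
      ring
    rw [e, e2]
    exact ih.add h

theorem continuous_betaDensity (B k : ℕ) : Continuous (betaDensity B k) := by
  unfold betaDensity
  exact continuous_const.mul (bernsteinPolynomial ℝ (B - 1) (k - 1)).continuous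

theorem betaDensity_nonneg {B k : ℕ} {a : ℝ} (h0 : 0 ≤ a) (h1 : a ≤ 1) : 0 ≤ betaDensity B k a := by
  rw [betaDensity, bernstein_eval]
  have : 0 ≤ 1 - a := by linarith
  positivity

theorem continuous_binomialBelow (B k : ℕ) : Continuous (binomialBelow B k) := by
  unfold binomialBelow
  exact continuous_finsetSum _ fun i _ => (bernsteinPolynomial ℝ B i).continuous

theorem binomialBelow_one {B k : ℕ} (hk : k ≤ B) : binomialBelow B k 1 = 0 := by
  refine Finset.sum_eq_zero fun i hi => ?_
  rw [bernsteinPolynomial.eval_at_1, if_neg]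
  have := Finset.mem_range.1 hi
  omega

/-- A binomial tail is the probability that the `k`-th order statistic of `B` uniform variables
exceeds `q`. -/
theorem binomialBelow_eq_integral {B k : ℕ} (hk1 : 1 ≤ k) (hk : k ≤ B) (q : ℝ) :
    binomialBelow B k q = ∫ a in q..1, betaDensity B k a := by
  obtain ⟨k, rfl⟩ := Nat.exists_eq_add_of_le' hk1
  have := intervalIntegral.integral_eq_sub_of_hasDerivAt (a := q) (b := 1)
    (fun a _ => hasDerivAt_binomialBelow B k a)
    ((continuous_betaDensity B (k + 1)).neg.intervalIntegrable _ _)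
  rw [intervalIntegral.integral_neg, binomialBelow_one hk] at this
  linarith

theorem integral_bernstein {B i : ℕ} (hi : i ≤ B) :
    ∫ q in (0 : ℝ)..1, (bernsteinPolynomial ℝ B i).eval q = 1 / ((B : ℝ) + 1) := by
  have h := binomialBelow_eq_integral (B := B + 1) (k := i + 1) (by omega) (by omega) 0
  have h0 : binomialBelow (B + 1) (i + 1) 0 = 1 := by
    simp [binomialBelow, bernsteinPolynomial.eval_at_0]
  rw [h0] at h
  simp only [betaDensity, Nat.add_sub_cancel, intervalIntegral.integral_const_mul] at h
  push_cast at h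
  field_simp
  linarith

/-- The mean of the `k`-th of `B` uniform order statistics. -/
theorem integral_id_mul_betaDensity {B k : ℕ} (hk1 : 1 ≤ k) (hk : k ≤ B) :
    ∫ a in (0 : ℝ)..1, a * betaDensity B k a = (k : ℝ) / ((B : ℝ) + 1) := by
  have hφ : ∫ q in (0 : ℝ)..1, binomialBelow B k q = (k : ℝ) / ((B : ℝ) + 1) := by
    unfold binomialBelow
    rw [intervalIntegral.integral_finsetSum fun i _ =>
        (bernsteinPolynomial ℝ B i).continuous.intervalIntegrable _ _]
    rw [Finset.sum_congr rfl fun i hi => integral_bernstein (B := B) (i := i) (by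
      have := Finset.mem_range.1 hi; omega)]
    simp; ring
  obtain ⟨k, rfl⟩ := Nat.exists_eq_add_of_le' hk1
  have := intervalIntegral.integral_eq_sub_of_hasDerivAt (a := 0) (b := 1)
    (fun a _ => (hasDerivAt_id a).mul (hasDerivAt_binomialBelow B k a))
    (Continuous.intervalIntegrable (by
      have := continuous_betaDensity B (k + 1); have := continuous_binomialBelow B (k + 1)
      simp only [id]; fun_prop) _ _)
  simp only [id, Pi.mul_apply, binomialBelow_one hk, mul_zero, zero_mul, sub_self, one_mul,
      mul_neg] at this
  rw [intervalIntegral.integral_add ((continuous_binomialBelow B (k + 1)).intervalIntegrable _ _)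
    (Continuous.intervalIntegrable (by
      have := continuous_betaDensity B (k + 1); fun_prop) _ _), hφ,
    intervalIntegral.integral_neg] at this
  linarith

/-- Chebyshev's inequality for the binomial distribution. -/
theorem binomialBelow_le {B k : ℕ} (hB : 0 < B) (hk : k ≤ B + 1) {q ε : ℝ} (h0 : 0 ≤ q) (h1 : q ≤
    1) (hε : 0 < ε)
    (hkq : (k : ℝ) - 1 + B * ε ≤ B * q) : binomialBelow B k q ≤ 1 / (4 * B * ε ^ 2) := by
  have hvar := congrArg (Polynomial.eval q) (bernsteinPolynomial.variance ℝ B)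
  simp only [Polynomial.eval_finsetSum, Polynomial.eval_mul, Polynomial.eval_pow,
      Polynomial.eval_sub,
    Polynomial.eval_X, Polynomial.eval_natCast, Polynomial.eval_one, nsmul_eq_mul] at hvar
  have hnn : ∀ i, 0 ≤ (bernsteinPolynomial ℝ B i).eval q := fun i => by
    rw [bernstein_eval]
    have : 0 ≤ 1 - q := by linarith
    positivity
  have hB' : (0 : ℝ) < B := by exact_mod_cast hB
  have h2 : (B * ε) ^ 2 * binomialBelow B k q ≤ B * q * (1 - q) := by
    rw [← hvar, binomialBelow, Finset.mul_sum]
    refine (Finset.sum_le_sum fun i hi => ?_).trans (Finset.sum_le_sum_of_subset_of_nonneg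
      (Finset.range_mono hk) fun i _ _ => mul_nonneg (sq_nonneg _) (hnn i))
    refine mul_le_mul_of_nonneg_right (pow_le_pow_left₀ (by positivity) ?_ 2) (hnn i)
    have : (i : ℝ) + 1 ≤ k := by exact_mod_cast Finset.mem_range.1 hi
    linarith
  have h3 : q * (1 - q) ≤ 1 / 4 := by nlinarith [sq_nonneg (q - 1 / 2)]
  rw [le_div_iff₀ (by positivity)]
  have h4 : B * ((B * ε ^ 2) * binomialBelow B k q) ≤ B * (q * (1 - q)) := by
    calc _ = (B * ε) ^ 2 * binomialBelow B k q := by ring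
      _ ≤ B * q * (1 - q) := h2
      _ = _ := by ring
  have h5 := le_of_mul_le_mul_left h4 hB'
  linarith

theorem binomialBelow_le_one {B k : ℕ} (hk : k ≤ B + 1) {q : ℝ} (h0 : 0 ≤ q) (h1 : q ≤ 1) :
    binomialBelow B k q ≤ 1 := by
  have hs := congrArg (Polynomial.eval q) (bernsteinPolynomial.sum ℝ B)
  simp only [Polynomial.eval_finsetSum, Polynomial.eval_one] at hs
  rw [← hs, binomialBelow]
  refine Finset.sum_le_sum_of_subset_of_nonneg (Finset.range_mono hk) fun i _ _ => ?_
  rw [bernstein_eval]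
  have : 0 ≤ 1 - q := by linarith
  positivity

end Binomial

/-! ### Distribution of the Monte Carlo `p`-value -/

section PValues

variable {J : ℕ}

theorem exactPValue_mem {κ : Type*} (p : Fin J → unitInterval)
    (stat : (Fin J → Bool) → (Fin J → κ → ℝ) → ℝ) (z : Fin J → Bool) (y : Fin J → κ → ℝ) :
    0 ≤ exactPValue p stat z y ∧ exactPValue p stat z y ≤ 1 :=
  ⟨measureReal_nonneg, measureReal_le_one⟩

/-- Conditionally on the data, the number of redraws that reach the observed statistic is binomial
with the exact `p`-value as success probability. -/
theorem mcLaw_real_eq {κ : Type*} (p : Fin J → unitInterval) (B : ℕ)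
    (stat : (Fin J → Bool) → (Fin J → κ → ℝ) → ℝ) (y : (Fin J → Bool) → Fin J → κ → ℝ) {α : ℝ}
    (hα0 : 0 ≤ α) (hα : α < 1) :
    (mcLaw p B).real {ω | mcPValue stat ω.1 ω.2 (y ω.1) ≤ α} =
      ∫ z, binomialBelow B ⌊α * ((B : ℝ) + 1)⌋₊ (exactPValue p stat z (y z)) ∂(design p) := by
  have hB : (0 : ℝ) < (B : ℝ) + 1 := by positivity
  have hk : ⌊α * ((B : ℝ) + 1)⌋₊ ≤ B + 1 := by
    refine Nat.floor_le_of_le ?_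
    push_cast
    nlinarith
  rw [measureReal_def, mcLaw, Measure.prod_apply (MeasurableSet.of_discrete), ← integral_toReal
    (Measurable.of_discrete).aemeasurable (Eventually.of_forall fun z => measure_lt_top _ _)]
  refine integral_congr_ae (Eventually.of_forall fun z => ?_)
  simp only [exactPValue]
  rw [← measureReal_count_lt (design p) (A :=
      {z' | stat z' (y z) ≥ stat z (y z)}) MeasurableSet.of_discrete hk,
    measureReal_def]
  congr 2
  ext zs
  simp only [Set.mem_preimage, Set.mem_ofPred_eq, mcPValue]
  rw [div_le_iff₀ hB, ← Nat.cast_succ, ← Nat.succ_le_iff, ← Nat.le_floor_iff (by positivity)]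

/-- The rejection probability of a Monte Carlo test is the average of the distribution function of
the exact `p`-value against a beta density. -/
theorem integral_binomialBelow_eq {Ω : Type*} [Fintype Ω] [MeasurableSpace Ω]
    [DiscreteMeasurableSpace Ω] (P : Measure Ω) [IsProbabilityMeasure P] {q : Ω → ℝ}
    (hq : ∀ z, 0 ≤ q z ∧ q z ≤ 1) {B k : ℕ} (hk1 : 1 ≤ k) (hk : k ≤ B) :
    ∫ z, binomialBelow B k (q z) ∂P = ∫ a in (0 : ℝ)..1, P.real {z | q z ≤
        a} * betaDensity B k a := by
  have hw := continuous_betaDensity B k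
  have h1 : ∀ z, binomialBelow B k (q z) =
      ∫ a in (0 : ℝ)..1, (if q z ≤ a then 1 else 0) * betaDensity B k a := by
    intro z
    rw [binomialBelow_eq_integral hk1 hk, intervalIntegral.integral_of_le (hq z).2,
      intervalIntegral.integral_of_le zero_le_one, ← integral_Icc_eq_integral_Ioc,
      ← integral_Icc_eq_integral_Ioc]
    have e : ∀ a, (if q z ≤ a then 1 else 0) * betaDensity B k a =
        (Set.Ici (q z)).indicator (betaDensity B k) a := fun a => by
      by_cases h : q z ≤ a <;> simp [Set.indicator, h]
    simp only [e]
    rw [setIntegral_indicator measurableSet_Ici]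
    congr 2
    ext a
    have := (hq z).1
    simp only [Set.mem_Icc, Set.mem_inter_iff, Set.mem_Ici]
    constructor
    · rintro ⟨h1, h2⟩; exact ⟨⟨this.trans h1, h2⟩, h1⟩
    · rintro ⟨⟨_, h2⟩, h1⟩; exact ⟨h1, h2⟩
  have h2 : ∀ a, P.real {z | q z ≤ a} = ∑ z, P.real {z} * (if q z ≤ a then 1 else 0) := by
    intro a
    rw [← integral_indicator_one (MeasurableSet.of_discrete), integral_fintype Integrable.of_finite]
    refine Finset.sum_congr rfl fun z _ => ?_
    simp [Set.indicator]
  rw [integral_fintype Integrable.of_finite]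
  simp only [h1, h2, Finset.sum_mul, smul_eq_mul, ← intervalIntegral.integral_const_mul]
  rw [intervalIntegral.integral_finsetSum]
  · simp only [mul_assoc]
  · intro z _
    have e : ∀ a, P.real {z} * (if q z ≤ a then 1 else 0) * betaDensity B k a =
        (Set.Ici (q z)).indicator (fun a => P.real {z} * betaDensity B k a) a := fun a => by
      by_cases h : q z ≤ a <;> simp [Set.indicator, h]
    simp only [e]
    rw [intervalIntegrable_iff]
    exact ((hw.const_mul _).intervalIntegrable 0 1).def'.indicator measurableSet_Ici

end PValues

/-! ### A criterion for asymptotic validity -/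

section Criterion

theorem limsup_le_ofReal {Ω : ℕ → Type*} [∀ J, MeasurableSpace (Ω J)] (P : ∀ J, Measure (Ω J))
    [∀ J, IsProbabilityMeasure (P J)] (s : ∀ J, Set (Ω J)) {α : ℝ} (hα : 0 ≤ α)
    (h : ∀ ε > 0, ∀ᶠ J in atTop, (P J).real (s J) ≤ α + ε) :
    limsup (fun J => P J (s J)) atTop ≤ ENNReal.ofReal α := by
  refine ENNReal.le_of_forall_pos_le_add fun ε hε _ => ?_
  refine limsup_le_of_le (by isBoundedDefault) ?_
  filter_upwards [h ε (by exact_mod_cast hε)] with J hJ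
  rw [← ENNReal.ofReal_toReal (measure_ne_top (P J) (s J)), ← ENNReal.ofReal_coe_nnreal,
    ← ENNReal.ofReal_add hα (NNReal.coe_nonneg _)]
  exact ENNReal.ofReal_le_ofReal hJ

theorem intervalIntegrable_mul_betaDensity {H : ℝ → ℝ} (hH : Measurable H) {M : ℝ}
    (hM : ∀ a, |H a| ≤ M) (B k : ℕ) (a b : ℝ) :
    IntervalIntegrable (fun a => H a * betaDensity B k a) volume a b :=
  intervalIntegrable_iff.2 <|
    ((continuous_betaDensity B k).intervalIntegrable a b).def'.bdd_mul hH.aestronglyMeasurable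
      (Eventually.of_forall hM)

/-- For a fixed number of redraws, an asymptotic upper bound `H` on the distribution function of the
exact `p`-value passes to the rejection probability of the Monte Carlo test. -/
theorem eventually_integral_binomialBelow_le {Ω : ℕ → Type*} [∀ J, Fintype (Ω J)]
    [∀ J, MeasurableSpace (Ω J)] [∀ J, DiscreteMeasurableSpace (Ω J)] (P : ∀ J, Measure (Ω J))
    [∀ J, IsProbabilityMeasure (P J)] {q : ∀ J, Ω J → ℝ} (hq : ∀ J z, 0 ≤ q J z ∧ q J z ≤ 1)
    {H : ℝ → ℝ} (hH : Measurable H) (hH0 : ∀ a, 0 ≤ H a) (hH1 : ∀ a, H a ≤ 1)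
    (hF : ∀ a, 0 < a → a < 1 → ∀ b, H a < b → ∀ᶠ J in atTop, (P J).real {z | q J z ≤ a} < b)
    {B k : ℕ} (hk1 : 1 ≤ k) (hk : k ≤ B) {ε : ℝ} (hε : 0 < ε) :
    ∀ᶠ J in atTop, ∫ z, binomialBelow B k (q J z) ∂(P J) ≤
      (∫ a in (0 : ℝ)..1, H a * betaDensity B k a) + ε := by
  let F : ℕ → ℝ → ℝ := fun J a => (P J).real {z | q J z ≤ a}
  have hFm : ∀ J, Measurable (F J) := fun J => Monotone.measurable fun a b hab =>
    measureReal_mono (fun z hz => le_trans hz hab) (measure_ne_top _ _)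
  have hF0 : ∀ J a, 0 ≤ F J a := fun J a => measureReal_nonneg
  have hF1 : ∀ J a, F J a ≤ 1 := fun J a => measureReal_le_one
  have hw := continuous_betaDensity B k
  let G : ℕ → ℝ → ℝ := fun J a => max (F J a - H a) 0
  have hGm : ∀ J, Measurable (G J) := fun J => ((hFm J).sub hH).max measurable_const
  have hGb : ∀ J a, |G J a| ≤ 1 := fun J a => by
    rw [abs_of_nonneg (le_max_right _ _)]
    exact max_le (by linarith [hF1 J a, hH0 a]) zero_le_one
  have hlim : Tendsto (fun J => ∫ a in (0 : ℝ)..1, G J a * betaDensity B k a) atTop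
      (𝓝 (∫ a in (0 : ℝ)..1, (0 : ℝ))) := by
    refine intervalIntegral.tendsto_integral_filter_of_dominated_convergence
      (fun a => |betaDensity B k a|)
      (Eventually.of_forall fun J => ((hGm J).mul hw.measurable).aestronglyMeasurable)
      (Eventually.of_forall fun J => Eventually.of_forall fun a _ => ?_)
      (hw.abs.intervalIntegrable _ _) ?_
    · rw [norm_mul]
      exact mul_le_of_le_one_left (abs_nonneg _) (hGb J a)
    · have hne : ∀ᵐ a : ℝ, a ≠ 1 := by simp [ae_iff]
      filter_upwards [hne] with a ha1 ha
      rw [Set.uIoc_of_le zero_le_one] at ha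
      have hGz : Tendsto (fun J => G J a) atTop (𝓝 0) := by
        rw [tendsto_order]
        refine ⟨fun b hb => Eventually.of_forall fun J => hb.trans_le (le_max_right _ _),
            fun b hb => ?_⟩
        filter_upwards [hF a ha.1 (lt_of_le_of_ne ha.2 ha1) (H a + b) (by linarith)] with J hJ
        exact max_lt (by simp only [F]; linarith) hb
      simpa using hGz.mul_const (betaDensity B k a)
  rw [intervalIntegral.integral_zero] at hlim
  filter_upwards [hlim.eventually_lt_const hε] with J hJ
  rw [integral_binomialBelow_eq (P J) (hq J) hk1 hk]
  have hHi := intervalIntegrable_mul_betaDensity hH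
    (fun a => (abs_of_nonneg (hH0 a)).trans_le (hH1 a)) B k 0 1
  have hGi := intervalIntegrable_mul_betaDensity (hGm J) (hGb J) B k 0 1
  have hFi := intervalIntegrable_mul_betaDensity (hFm J)
    (fun a => (abs_of_nonneg (hF0 J a)).trans_le (hF1 J a)) B k 0 1
  have : ∫ a in (0 : ℝ)..1, F J a * betaDensity B k a ≤
      ∫ a in (0 : ℝ)..1, (H a * betaDensity B k a + G J a * betaDensity B k a) := by
    refine intervalIntegral.integral_mono_on zero_le_one hFi (hHi.add hGi) fun a ha => ?_
    rw [← add_mul]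
    refine mul_le_mul_of_nonneg_right ?_ (betaDensity_nonneg ha.1 ha.2)
    have := le_max_left (F J a - H a) 0
    simp only [G]
    linarith
  rw [intervalIntegral.integral_add hHi hGi] at this
  linarith

variable {L m : ℕ} {Y : (J : ℕ) → Outcomes (J * L)} {p : (J : ℕ) → Fin J → unitInterval}
  {stat : (J : ℕ) → (Fin J → Bool) → (Fin J → Fin (L - m) → ℝ) → ℝ} {α : ℝ}

/-- A criterion for asymptotic validity in terms of an asymptotic upper bound `H` on the
distribution function of the exact `p`-value. For many redraws the Monte Carlo `p`-value is close to
the exact one; for each of the finitely many remaining numbers of redraws, the rejection probability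
is an average of the distribution function against a beta density. -/
theorem asymptoticallyValid_of_bound (hα0 : 0 < α) (hα1 : α < 1)
    {H : ℝ → ℝ} (hH : Measurable H) (hH0 : ∀ a, 0 ≤ H a) (hH1 : ∀ a, H a ≤ 1)
    (hF : ∀ a, 0 < a → a < 1 → ∀ b, H a < b → ∀ᶠ J in atTop, (design (p J)).real
      {z | exactPValue (p J) (stat J) z (observed m (Y J) z) ≤ a} < b)
    {η : ℝ} (hη : 0 < η) (hHα : ∀ a, α < a → a < α + η → H a ≤ a)
    (hB : ∀ B k : ℕ, 1 ≤ k → k ≤ B → (k : ℝ) ≤ α * ((B : ℝ) + 1) →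
      ∫ a in (0 : ℝ)..1, H a * betaDensity B k a ≤ (k : ℝ) / ((B : ℝ) + 1)) :
    AsymptoticallyValid m Y p stat α := by
  have hnear : ∀ ε > 0, ∃ a, α < a ∧ a < 1 ∧ a ≤ α + ε ∧ ∀ᶠ J in atTop, (design (p J)).real
      {z | exactPValue (p J) (stat J) z (observed m (Y J) z) ≤ a} ≤ α + ε := by
    intro ε hε
    obtain ⟨a, ha1, ha2⟩ := exists_between (lt_min (lt_min (by linarith : α < α + η) hα1)
      (by linarith : α < α + ε))
    have h1 := lt_min_iff.1 (lt_min_iff.1 ha2).1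
    have h2 := (lt_min_iff.1 ha2).2
    refine ⟨a, ha1, h1.2, h2.le, ?_⟩
    filter_upwards [hF a (hα0.trans ha1) h1.2 (α + ε)
        ((hHα a ha1 h1.1).trans_lt h2)] with J hJ using hJ.le
  constructor
  · intro B
    have hprob : ∀ J, IsProbabilityMeasure (mcLaw (p J) (B J)) := fun J => by
      unfold mcLaw; infer_instance
    refine limsup_le_ofReal (fun J => mcLaw (p J) (B J)) _ hα0.le fun ε hε => ?_
    simp only [mcLaw_real_eq (p _) (B _) (stat _) (observed m (Y _)) hα0.le hα1]
    set q : ∀ J, (Fin J → Bool) → ℝ := fun J z => exactPValue (p J)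
        (stat J) z (observed m (Y J) z) with hqdef
    have hq : ∀ J z, 0 ≤ q J z ∧ q J z ≤ 1 := fun J z => exactPValue_mem _ _ _ _
    have hkB : ∀ B : ℕ, ⌊α * ((B : ℝ) + 1)⌋₊ ≤ B := fun B => by
      have : ⌊α * ((B : ℝ) + 1)⌋₊ < B + 1 := by
        rw [Nat.floor_lt (by positivity)]
        push_cast
        have : (0 : ℝ) < (B : ℝ) + 1 := by positivity
        nlinarith
      omega
    -- For `B ≥ B₀` the Monte Carlo `p`-value is at most `α` with probability at most `ε / 2` unless
    -- the exact one is at most `a`, a level slightly above `α`.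
    obtain ⟨a, ha0, ha1, -, hae⟩ := hnear (ε / 2) (by positivity)
    obtain ⟨B₀, hB₀⟩ : ∃ B₀ : ℕ, 1 / (4 * (a - α) ^ 2 * (ε / 2)) < B₀ := exists_nat_gt _
    have hlarge : ∀ᶠ J in atTop, ∀ B : ℕ, B₀ ≤ B →
        ∫ z, binomialBelow B ⌊α * ((B : ℝ) + 1)⌋₊ (q J z) ∂(design (p J)) ≤ α + ε := by
      filter_upwards [hae] with J hJ B hB
      have hδ : 0 < a - α := sub_pos.2 ha0
      have hBpos : (0 : ℝ) < B := lt_of_lt_of_le (lt_trans (by positivity) hB₀)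
          (by exact_mod_cast hB)
      have hpt : ∀ z, binomialBelow B ⌊α * ((B : ℝ) + 1)⌋₊ (q J z) ≤
          Set.indicator {z | q J z ≤ a} 1 z + ε / 2 := by
        intro z
        by_cases hz : q J z ≤ a
        · simp only [Set.indicator, Set.mem_ofPred_eq, hz, if_true, Pi.one_apply]
          have := binomialBelow_le_one (B := B) (k := ⌊α * ((B : ℝ) + 1)⌋₊) ((hkB B).trans
              (Nat.le_succ B))
            (hq J z).1 (hq J z).2
          linarith
        · simp only [Set.indicator, Set.mem_ofPred_eq, hz, if_false, zero_add]
          refine (binomialBelow_le (by exact_mod_cast hBpos) (by have := hkB B; omega)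
              (hq J z).1 (hq J z).2 hδ ?_).trans ?_
          · have hfl := Nat.floor_le (by positivity : 0 ≤ α * ((B : ℝ) + 1))
            have hz' := mul_le_mul_of_nonneg_left (not_le.1 hz).le hBpos.le
            nlinarith
          · rw [div_le_iff₀ (by positivity)]
            have h1 : 1 / (4 * (a - α) ^ 2 * (ε / 2)) < B :=
                lt_of_lt_of_le hB₀ (by exact_mod_cast hB)
            rw [div_lt_iff₀ (by positivity)] at h1
            linarith
      refine (integral_mono Integrable.of_finite Integrable.of_finite hpt).trans ?_
      rw [integral_add Integrable.of_finite Integrable.of_finite,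
        integral_indicator_one MeasurableSet.of_discrete]
      simp only [integral_const, probReal_univ, smul_eq_mul, one_mul]
      linarith
    -- Each `B < B₀` is fixed and handled by the criterion with `k = ⌊α (B + 1)⌋`; for `k = 0` the
    -- Monte Carlo `p`-value exceeds `α` always.
    have hsmall : ∀ B : ℕ, ∀ᶠ J in atTop,
        ∫ z, binomialBelow B ⌊α * ((B : ℝ) + 1)⌋₊ (q J z) ∂(design (p J)) ≤ α + ε := by
      intro B
      rcases Nat.eq_zero_or_pos ⌊α * ((B : ℝ) + 1)⌋₊ with hk0 | hk1
      · rw [hk0]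
        refine Eventually.of_forall fun J => ?_
        simp only [binomialBelow, Finset.range_zero, Finset.sum_empty, integral_zero]
        linarith
      · have hfl := Nat.floor_le (by positivity : 0 ≤ α * ((B : ℝ) + 1))
        filter_upwards [eventually_integral_binomialBelow_le (fun J =>
            design (p J)) hq hH hH0 hH1 hF
          hk1 (hkB B) hε] with J hJ
        refine hJ.trans (add_le_add_left ((hB B _ hk1 (hkB B) hfl).trans ?_) _)
        rw [div_le_iff₀ (by positivity)]
        exact hfl
    have hall : ∀ᶠ J in atTop, ∀ B < B₀,
        ∫ z, binomialBelow B ⌊α * ((B : ℝ) + 1)⌋₊ (q J z) ∂(design (p J)) ≤ α + ε := by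
      have := (Finset.range B₀).eventually_all.2 fun B _ => hsmall B
      filter_upwards [this] with J hJ B hB using hJ B (Finset.mem_range.2 hB)
    filter_upwards [hlarge, hall] with J h1 h2
    rcases lt_or_ge (B J) B₀ with h | h
    · exact h2 _ h
    · exact h1 _ h
  · refine limsup_le_ofReal (fun J => design (p J)) _ hα0.le fun ε hε => ?_
    obtain ⟨a, ha0, -, -, hae⟩ := hnear ε hε
    filter_upwards [hae] with J hJ
    exact (measureReal_mono (fun z hz => le_trans hz ha0.le) (measure_ne_top _ _)).trans hJ

end Criterion

/-! ### Bounds on exact `p`-values from limit laws -/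

section TailBound

/-- The smallest asymptotic bound on the probability of an exact `p`-value at most `a`, when the
redrawn statistic has limit law `γ` and the observed statistic has limit law `ρ`. -/
noncomputable def pValueBound (γ ρ : Measure ℝ) (a : ℝ) : ℝ :=
  sInf (insert 1 {r | ∃ c, a < γ.real (Set.Ioi c) ∧ r = ρ.real (Set.Ici c)})

variable (γ ρ : Measure ℝ)

theorem pValueBound_bddBelow (a : ℝ) :
    BddBelow (insert 1 {r | ∃ c, a < γ.real (Set.Ioi c) ∧ r = ρ.real (Set.Ici c)}) := by
  refine ⟨0, ?_⟩
  rintro r (rfl | ⟨c, -, rfl⟩)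
  exacts [zero_le_one, measureReal_nonneg]

theorem pValueBound_nonneg (a : ℝ) : 0 ≤ pValueBound γ ρ a := by
  refine le_csInf (Set.insert_nonempty _ _) ?_
  rintro r (rfl | ⟨c, -, rfl⟩)
  exacts [zero_le_one, measureReal_nonneg]

theorem pValueBound_le_one (a : ℝ) : pValueBound γ ρ a ≤ 1 :=
  csInf_le (pValueBound_bddBelow γ ρ a) (Set.mem_insert _ _)

variable {γ ρ}

theorem pValueBound_le {a c : ℝ} (h : a < γ.real (Set.Ioi c)) : pValueBound γ ρ a ≤
    ρ.real (Set.Ici c) :=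
  csInf_le (pValueBound_bddBelow γ ρ a) (Set.mem_insert_of_mem _ ⟨c, h, rfl⟩)

theorem pValueBound_mono : Monotone (pValueBound γ ρ) := by
  intro a b hab
  refine csInf_le_csInf (pValueBound_bddBelow γ ρ a) (Set.insert_nonempty _ _)
    (Set.insert_subset_insert ?_)
  rintro r ⟨c, hc, rfl⟩
  exact ⟨c, hab.trans_lt hc, rfl⟩

variable [IsProbabilityMeasure γ]

theorem measureReal_Ioi_eq_one_sub_cdf (c : ℝ) :
    γ.real (Set.Ioi c) = 1 - ProbabilityTheory.cdf γ c := by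
  rw [ProbabilityTheory.cdf_eq_real, ← Set.compl_Iic, probReal_compl_eq_one_sub measurableSet_Iic]

theorem continuous_cdf [NullSingletonClass γ] : Continuous (ProbabilityTheory.cdf γ) := by
  rw [continuous_iff_continuousAt]
  intro c
  have h := StieltjesFunction.measure_singleton (ProbabilityTheory.cdf γ) c
  rw [ProbabilityTheory.measure_cdf, measure_singleton, eq_comm, ENNReal.ofReal_eq_zero] at h
  rw [(ProbabilityTheory.monotone_cdf γ).continuousAt_iff_leftLim_eq_rightLim,
    StieltjesFunction.rightLim_eq]
  exact le_antisymm ((ProbabilityTheory.monotone_cdf γ).leftLim_le le_rfl) (by linarith)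

/-- Without atoms every tail probability is attained. -/
theorem exists_measureReal_Ioi_eq [NullSingletonClass γ] {v : ℝ} (h0 : 0 < v) (h1 : v < 1) :
    ∃ c, γ.real (Set.Ioi c) = v := by
  have hb := ((ProbabilityTheory.tendsto_cdf_atBot γ).eventually_lt_const (sub_pos.2 h1)).exists
  have ht := ((ProbabilityTheory.tendsto_cdf_atTop γ).eventually_const_lt
      (by linarith : 1 - v < 1)).exists
  obtain ⟨c, hc⟩ := mem_range_of_exists_le_of_exists_ge (continuous_cdf (γ := γ))
    ⟨hb.choose, hb.choose_spec.le⟩ ⟨ht.choose, ht.choose_spec.le⟩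
  exact ⟨c, by rw [measureReal_Ioi_eq_one_sub_cdf, hc]; ring⟩

/-- If the upper tails of `ρ` beyond `c₀` are dominated by those of `γ`, then the exact `p`-value is
asymptotically superuniform at the levels that correspond to thresholds beyond `c₀`. -/
theorem pValueBound_le_self [NullSingletonClass γ] {c₀ a : ℝ}
    (hdom : ∀ c, c₀ < c → ρ.real (Set.Ici c) ≤ γ.real (Set.Ici c)) (ha0 : 0 < a)
    (ha : a < γ.real (Set.Ioi c₀)) : pValueBound γ ρ a ≤ a := by
  refine le_of_forall_pos_le_add fun ε hε => ?_
  obtain ⟨v, hv1, hv2⟩ := exists_between (lt_min ha (by linarith : a < a + ε))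
  have hv3 := lt_min_iff.1 hv2
  obtain ⟨c, hc⟩ := exists_measureReal_Ioi_eq (γ := γ) (ha0.trans hv1)
    (hv3.1.trans_le measureReal_le_one)
  have hcc : c₀ < c := by
    by_contra hle
    have := measureReal_mono (μ := γ) (Set.Ioi_subset_Ioi (not_lt.1 hle))
    linarith [hv3.1]
  calc pValueBound γ ρ a ≤ ρ.real (Set.Ici c) := pValueBound_le (by rw [hc]; exact hv1)
    _ ≤ γ.real (Set.Ici c) := hdom c hcc
    _ = γ.real (Set.Ioi c) := measureReal_congr Ioi_ae_eq_Ici.symm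
    _ ≤ a + ε := by rw [hc]; exact hv3.2.le

end TailBound

/-! ### Quadratic forms in Gaussian vectors -/

section Quadratic

open scoped MatrixOrder

variable {κ : Type*} [Fintype κ]

/-- Spheres are null sets of the standard Gaussian measure in positive dimension. -/
theorem stdGaussian_norm_sq_eq [Nonempty κ] (c : ℝ) :
    ProbabilityTheory.stdGaussian (EuclideanSpace ℝ κ) {x | ‖x‖ ^ 2 = c} = 0 := by
  classical
  -- Given the other coordinates, the coordinate `k` can take at most two values on the sphere.
  obtain ⟨k⟩ := ‹Nonempty κ›
  have hm : MeasurableSet {x : EuclideanSpace ℝ κ | ‖x‖ ^ 2 = c} :=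
    (isClosed_eq (by fun_prop) continuous_const).measurableSet
  have := ProbabilityTheory.nullSingletonClass_gaussianReal (μ := 0) (v := 1) one_ne_zero
  rw [← ProbabilityTheory.map_pi_eq_stdGaussian, Measure.map_apply (by fun_prop) hm]
  have hpre : WithLp.toLp 2 ⁻¹' {x : EuclideanSpace ℝ κ | ‖x‖ ^ 2 = c} = {x : κ → ℝ | ∑ i,
      x i ^ 2 = c} := by
    ext x
    simp [EuclideanSpace.real_norm_sq_eq]
  rw [hpre]
  have hm' : MeasurableSet {x : κ → ℝ | ∑ i, x i ^ 2 = c} :=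
    (isClosed_eq (by fun_prop) continuous_const).measurableSet
  have hmp := measurePreserving_piEquivPiSubtypeProd
    (fun _ : κ => ProbabilityTheory.gaussianReal 0 1) (fun i => i ≠ k)
  have hs := (hmp.symm).measure_preimage hm'.nullMeasurableSet
  rw [← hs]
  refine (Measure.measure_prod_null ((hmp.symm).measurable hm')).2 (Eventually.of_forall fun y =>
      ?_)
  let r := √(c - ∑ i : {i // i ≠ k}, y i ^ 2)
  have hsub : Prod.mk y ⁻¹' ((MeasurableEquiv.piEquivPiSubtypeProd (fun _ : κ => ℝ) fun i =>
      i ≠ k).symm ⁻¹'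
      {x : κ → ℝ | ∑ i, x i ^ 2 = c}) ⊆
      {x | x ⟨k, by simp⟩ = r} ∪ {x | x ⟨k, by simp⟩ = -r} := by
    intro x hx
    simp only [Set.mem_preimage, Set.mem_ofPred_eq] at hx
    rw [← Fintype.sum_subtype_add_sum_subtype (fun i => i ≠ k)] at hx
    have huniq : (Finset.univ : Finset {i // ¬ i ≠ k}) = {⟨k, by simp⟩} := by
      ext i
      simpa [Subtype.ext_iff] using i.2
    have hne : ∀ i : {i // i ≠ k}, (MeasurableEquiv.piEquivPiSubtypeProd (fun _ : κ => ℝ)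
        fun i => i ≠ k).symm (y, x) i = y i := fun i => by
      simp [MeasurableEquiv.piEquivPiSubtypeProd, Equiv.piEquivPiSubtypeProd, i.2]
    have heq : (MeasurableEquiv.piEquivPiSubtypeProd (fun _ : κ => ℝ)
        fun i => i ≠ k).symm (y, x) k = x ⟨k, by simp⟩ := by
      simp [MeasurableEquiv.piEquivPiSubtypeProd, Equiv.piEquivPiSubtypeProd]
    rw [huniq, Finset.sum_singleton, heq] at hx
    simp only [hne] at hx
    have hr : r = |x ⟨k, by simp⟩| := by
      rw [← Real.sqrt_sq_eq_abs]
      simp only [r, ← hx, add_sub_cancel_left]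
    rcases abs_cases (x ⟨k, by simp⟩) with h | h
    · exact Or.inl (by rw [Set.mem_ofPred_eq, hr, h.1])
    · exact Or.inr (by rw [Set.mem_ofPred_eq, hr, h.1, neg_neg])
  refine measure_mono_null hsub (measure_union_null ?_ ?_)
  · exact Measure.pi_hyperplane (μ := fun _ : {i // ¬ i ≠ k} =>
        ProbabilityTheory.gaussianReal 0 1) _ _
  · exact Measure.pi_hyperplane (μ := fun _ : {i // ¬ i ≠ k} =>
        ProbabilityTheory.gaussianReal 0 1) _ _

theorem dotProduct_self_eq_norm_sq (ξ : EuclideanSpace ℝ κ) : ξ ⬝ᵥ ξ = ‖ξ‖ ^ 2 := by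
  rw [EuclideanSpace.real_norm_sq_eq]
  simp [dotProduct, sq]

variable [DecidableEq κ]

/-- A Gaussian vector with covariance `S` is `√S` times a standard one. -/
theorem multivariateGaussian_apply {S : Matrix κ κ ℝ} {A : Set (EuclideanSpace ℝ κ)}
    (hA : MeasurableSet A) :
    (ProbabilityTheory.multivariateGaussian 0 S).real A =
      (ProbabilityTheory.stdGaussian (EuclideanSpace ℝ κ)).real
        {ξ | WithLp.toLp 2 (CFC.sqrt S *ᵥ ξ) ∈ A} := by
  rw [ProbabilityTheory.multivariateGaussian, map_measureReal_apply (by fun_prop) hA]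
  congr 1
  ext ξ
  simp only [Set.mem_preimage, Set.mem_ofPred_eq, zero_add]
  rfl

theorem sqrt_transpose {S : Matrix κ κ ℝ} : (CFC.sqrt S)ᵀ = CFC.sqrt S := by
  have h : IsSelfAdjoint (CFC.sqrt S) := (CFC.sqrt_nonneg S).isSelfAdjoint
  have h2 : (CFC.sqrt S)ᴴ = CFC.sqrt S := h
  rwa [Matrix.conjTranspose_eq_transpose_of_trivial] at h2

theorem dotProduct_sqrt_mulVec {S : Matrix κ κ ℝ} (x y : κ → ℝ) :
    (CFC.sqrt S *ᵥ x) ⬝ᵥ y = x ⬝ᵥ (CFC.sqrt S *ᵥ y) := by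
  rw [dotProduct_comm, Matrix.dotProduct_mulVec, ← Matrix.mulVec_transpose, sqrt_transpose,
      dotProduct_comm]

/-- A quadratic form that inverts an upper bound `U` of the covariance matrix `S` is bounded by
the squared norm of the standard Gaussian vector that generates the Gaussian vector with
covariance `S`. -/
theorem quadratic_sqrt_le {S U : Matrix κ κ ℝ} (hS : S.PosSemidef) (hU : U.PosDef)
    (hSU : ∀ t, t ⬝ᵥ (S *ᵥ t) ≤ t ⬝ᵥ (U *ᵥ t)) (ξ : κ → ℝ) :
    (CFC.sqrt S *ᵥ ξ) ⬝ᵥ (U⁻¹ *ᵥ (CFC.sqrt S *ᵥ ξ)) ≤ ξ ⬝ᵥ ξ := by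
  set x := CFC.sqrt S *ᵥ ξ with hx
  set y := U⁻¹ *ᵥ x with hy
  have hUy : U *ᵥ y = x := by
    rw [hy, Matrix.mulVec_mulVec, Matrix.mul_nonsing_inv _ (isUnit_iff_ne_zero.2 hU.det_pos.ne'),
        Matrix.one_mulVec]
  have h1 : x ⬝ᵥ y = ξ ⬝ᵥ (CFC.sqrt S *ᵥ y) := dotProduct_sqrt_mulVec ξ y
  have h2 : (CFC.sqrt S *ᵥ y) ⬝ᵥ (CFC.sqrt S *ᵥ y) = y ⬝ᵥ (S *ᵥ y) := by
    rw [dotProduct_sqrt_mulVec, Matrix.mulVec_mulVec, CFC.sqrt_mul_sqrt_self _ hS.nonneg]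
  have h3 : y ⬝ᵥ (U *ᵥ y) = x ⬝ᵥ y := by rw [hUy, dotProduct_comm]
  have hcs : (ξ ⬝ᵥ (CFC.sqrt S *ᵥ y)) ^ 2 ≤
      (ξ ⬝ᵥ ξ) * ((CFC.sqrt S *ᵥ y) ⬝ᵥ (CFC.sqrt S *ᵥ y)) := by
    have := Finset.sum_mul_sq_le_sq_mul_sq Finset.univ ξ (CFC.sqrt S *ᵥ y)
    simpa only [dotProduct, sq] using this
  have hξ : 0 ≤ ξ ⬝ᵥ ξ := Finset.sum_nonneg fun i _ => mul_self_nonneg _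
  have hq : (x ⬝ᵥ y) ^ 2 ≤ (ξ ⬝ᵥ ξ) * (x ⬝ᵥ y) := by
    rw [← h1, h2] at hcs
    exact hcs.trans (mul_le_mul_of_nonneg_left ((hSU y).trans_eq h3) hξ)
  by_contra hlt
  push Not at hlt
  nlinarith

theorem quadratic_sqrt_eq {Q : Matrix κ κ ℝ} (hQ : Q.PosDef) (ξ : κ → ℝ) :
    (CFC.sqrt Q *ᵥ ξ) ⬝ᵥ (Q⁻¹ *ᵥ (CFC.sqrt Q *ᵥ ξ)) = ξ ⬝ᵥ ξ := by
  have hQQ : CFC.sqrt Q * CFC.sqrt Q = Q := CFC.sqrt_mul_sqrt_self _ hQ.posSemidef.nonneg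
  have hdet : IsUnit (CFC.sqrt Q).det := by
    refine isUnit_iff_ne_zero.2 fun h => hQ.det_pos.ne' ?_
    rw [← hQQ, Matrix.det_mul, h, zero_mul]
  have e : CFC.sqrt Q * (Q⁻¹ * CFC.sqrt Q) = 1 := by
    have : Q⁻¹ = (CFC.sqrt Q)⁻¹ * (CFC.sqrt Q)⁻¹ := by rw [← Matrix.mul_inv_rev, hQQ]
    rw [this, mul_assoc, Matrix.nonsing_inv_mul _ hdet, mul_one, Matrix.mul_nonsing_inv _ hdet]
  rw [dotProduct_sqrt_mulVec, Matrix.mulVec_mulVec, Matrix.mulVec_mulVec, mul_assoc, e,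
      Matrix.one_mulVec]

theorem measurable_quadratic (U : Matrix κ κ ℝ) :
    Measurable fun x : EuclideanSpace ℝ κ => x ⬝ᵥ (U⁻¹ *ᵥ x) := by
  have hx : Continuous (fun x : EuclideanSpace ℝ κ => (x : κ → ℝ)) := by fun_prop
  exact (hx.dotProduct (Continuous.matrix_mulVec continuous_const hx)).measurable

/-- The squared Mahalanobis norm of a Gaussian vector has the chi-squared law,
    represented here as the
law of the squared norm of a standard Gaussian vector. -/
theorem map_quadratic_eq {Q : Matrix κ κ ℝ} (hQ : Q.PosDef) :
    (ProbabilityTheory.multivariateGaussian 0 Q).map (fun x : EuclideanSpace ℝ κ =>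
        x ⬝ᵥ (Q⁻¹ *ᵥ x)) =
      (ProbabilityTheory.stdGaussian (EuclideanSpace ℝ κ)).map (fun ξ => ‖ξ‖ ^ 2) := by
  have h1 : IsProbabilityMeasure ((ProbabilityTheory.multivariateGaussian 0 Q).map
      (fun x : EuclideanSpace ℝ κ => x ⬝ᵥ (Q⁻¹ *ᵥ x))) :=
    Measure.isProbabilityMeasure_map (measurable_quadratic Q).aemeasurable
  have h2 : IsProbabilityMeasure
      ((ProbabilityTheory.stdGaussian (EuclideanSpace ℝ κ)).map (fun ξ => ‖ξ‖ ^ 2)) :=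
    Measure.isProbabilityMeasure_map (by fun_prop)
  refine Measure.ext fun A hA => ?_
  rw [← measureReal_eq_measureReal_iff, map_measureReal_apply (measurable_quadratic Q) hA,
    map_measureReal_apply (by fun_prop) hA, multivariateGaussian_apply (measurable_quadratic Q hA)]
  congr 1
  ext ξ
  simp only [Set.mem_preimage, Set.mem_ofPred_eq, quadratic_sqrt_eq hQ, dotProduct_self_eq_norm_sq]

/-- With a covariance matrix above the true one, the squared Mahalanobis norm is stochastically
dominated by the chi-squared law. -/
theorem map_quadratic_tail_le {S U : Matrix κ κ ℝ} (hS : S.PosSemidef) (hU : U.PosDef)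
    (hSU : ∀ t, t ⬝ᵥ (S *ᵥ t) ≤ t ⬝ᵥ (U *ᵥ t)) (c : ℝ) :
    ((ProbabilityTheory.multivariateGaussian 0 S).map (fun x : EuclideanSpace ℝ κ =>
        x ⬝ᵥ (U⁻¹ *ᵥ x))).real (Set.Ici c) ≤
      ((ProbabilityTheory.stdGaussian (EuclideanSpace ℝ κ)).map (fun ξ =>
          ‖ξ‖ ^ 2)).real (Set.Ici c) := by
  rw [map_measureReal_apply (measurable_quadratic U) measurableSet_Ici,
    map_measureReal_apply (by fun_prop) measurableSet_Ici,
    multivariateGaussian_apply (measurable_quadratic U measurableSet_Ici)]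
  refine measureReal_mono (fun ξ hξ => ?_) (measure_ne_top _ _)
  simp only [Set.mem_preimage, Set.mem_Ici, Set.mem_ofPred_eq] at hξ ⊢
  rw [← dotProduct_self_eq_norm_sq]
  exact hξ.trans (quadratic_sqrt_le hS hU hSU ξ)

/-- For the quadratic-form statistic the exact `p`-value is asymptotically superuniform. -/
theorem pValueBound_quadratic_le [Nonempty κ] {S U Q : Matrix κ κ ℝ} (hS : S.PosSemidef)
    (hU : U.PosDef) (hQ : Q.PosDef) (hSU : ∀ t, t ⬝ᵥ (S *ᵥ t) ≤ t ⬝ᵥ (U *ᵥ t)) {a : ℝ}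
    (ha0 : 0 < a) (ha1 : a < 1) :
    pValueBound ((ProbabilityTheory.multivariateGaussian 0 Q).map (fun x : EuclideanSpace ℝ κ =>
        x ⬝ᵥ (Q⁻¹ *ᵥ x)))
      ((ProbabilityTheory.multivariateGaussian 0 S).map (fun x : EuclideanSpace ℝ κ =>
          x ⬝ᵥ (U⁻¹ *ᵥ x))) a ≤ a := by
  rw [map_quadratic_eq hQ]
  have h2 : IsProbabilityMeasure
      ((ProbabilityTheory.stdGaussian (EuclideanSpace ℝ κ)).map (fun ξ => ‖ξ‖ ^ 2)) :=
    Measure.isProbabilityMeasure_map (by fun_prop)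
  have h3 : NullSingletonClass ((ProbabilityTheory.stdGaussian (EuclideanSpace ℝ κ)).map (fun ξ =>
      ‖ξ‖ ^ 2)) :=
    ⟨fun c => by
      rw [Measure.map_apply (by fun_prop) (measurableSet_singleton c)]
      exact stdGaussian_norm_sq_eq c⟩
  refine pValueBound_le_self (c₀ := -1) (fun c _ => map_quadratic_tail_le hS hU hSU c) ha0 ?_
  rw [map_measureReal_apply (by fun_prop) measurableSet_Ioi]
  have : (fun ξ : EuclideanSpace ℝ κ => ‖ξ‖ ^ 2) ⁻¹' Set.Ioi (-1) = Set.univ := by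
    ext ξ
    simp only [Set.mem_preimage, Set.mem_Ioi, Set.mem_univ, iff_true]
    have := sq_nonneg ‖ξ‖
    linarith
  rw [this, probReal_univ]
  exact ha1

end Quadratic

/-! ### One-sided tests -/

section OneSided

open ProbabilityTheory

theorem nullSingletonClass_stdNormal : NullSingletonClass (gaussianReal 0 1) :=
  nullSingletonClass_gaussianReal one_ne_zero

theorem continuous_stdNormal_Ioi : Continuous fun c => (gaussianReal 0 1).real (Set.Ioi c) := by
  have := nullSingletonClass_stdNormal
  simp only [measureReal_Ioi_eq_one_sub_cdf]
  exact continuous_const.sub continuous_cdf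

theorem stdNormal_Ioi_add_Ioi_neg (c : ℝ) :
    (gaussianReal 0 1).real (Set.Ioi c) + (gaussianReal 0 1).real (Set.Ioi (-c)) = 1 := by
  have := nullSingletonClass_stdNormal
  have h : (gaussianReal 0 1).real (Set.Ioi (-c)) = (gaussianReal 0 1).real (Set.Iio c) := by
    have hneg : (gaussianReal 0 1).map (fun x => -x) = gaussianReal 0 1 := by
      rw [gaussianReal_map_neg, neg_zero]
    conv_lhs => rw [← hneg]
    rw [map_measureReal_apply (by fun_prop) measurableSet_Ioi]
    congr 1
    ext x
    simp
  rw [h, measureReal_congr (Iio_ae_eq_Iic (μ := gaussianReal 0 1) (a := c)), ← Set.compl_Ioi,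
    probReal_compl_eq_one_sub measurableSet_Ioi]
  ring

theorem strictAnti_stdNormal_Ioi : StrictAnti fun c => (gaussianReal 0 1).real (Set.Ioi c) := by
  intro c d hcd
  have hpos : 0 < (gaussianReal 0 1).real (Set.Ioc c d) := by
    refine ENNReal.toReal_pos (fun h => ?_) (measure_ne_top _ _)
    have := gaussianReal_absolutelyContinuous' 0 one_ne_zero h
    rw [Real.volume_Ioc, ENNReal.ofReal_eq_zero] at this
    linarith
  have : (gaussianReal 0 1).real (Set.Ioi c) =
      (gaussianReal 0 1).real (Set.Ioc c d) + (gaussianReal 0 1).real (Set.Ioi d) := by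
    have hdisj : Disjoint (Set.Ioc c d) (Set.Ioi d) := Set.disjoint_left.2 fun x h h' =>
        not_lt.2 h.2 h'
    rw [← measureReal_union hdisj measurableSet_Ioi, Set.Ioc_union_Ioi_eq_Ioi hcd.le]
  simp only
  linarith

theorem stdNormal_Ioi_zero : (gaussianReal 0 1).real (Set.Ioi 0) = 1 / 2 := by
  have := stdNormal_Ioi_add_Ioi_neg 0
  rw [neg_zero] at this
  linarith

theorem map_mul_Ici (s c : ℝ) :
    ((gaussianReal 0 1).map (s * ·)).real (Set.Ici c) = (gaussianReal 0 1).real {x | c ≤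
        s * x} := by
  rw [map_measureReal_apply (by fun_prop) measurableSet_Ici]
  rfl

/-- Shrinking a standard normal variable towards zero makes its upper tails lighter, so that the
exact one-sided `p`-value is asymptotically superuniform at levels below one half. -/
theorem pValueBound_shrink_le {s a : ℝ} (hs0 : 0 ≤ s) (hs1 : s ≤ 1) (ha0 : 0 < a) (ha : a < 1 / 2) :
    pValueBound (gaussianReal 0 1) ((gaussianReal 0 1).map (s * ·)) a ≤ a := by
  have := nullSingletonClass_stdNormal
  refine pValueBound_le_self (c₀ := 0) (fun c hc => ?_) ha0 (by rwa [stdNormal_Ioi_zero])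
  rw [map_mul_Ici]
  refine measureReal_mono (fun x hx => ?_) (measure_ne_top _ _)
  simp only [Set.mem_ofPred_eq, Set.mem_Ici] at hx ⊢
  have hx0 : 0 < x := by
    by_contra h
    nlinarith [mul_nonneg hs0 (by linarith : 0 ≤ -x)]
  nlinarith

/-- At levels above one half the exact one-sided `p`-value may be anticonservative, but the excess
at level `1 - a` is compensated by the slack at level `a`. -/
theorem pValueBound_shrink_add_le {s a : ℝ} (hs0 : 0 ≤ s) (ha0 : 0 < a) (ha : a < 1 / 2) :
    pValueBound (gaussianReal 0 1) ((gaussianReal 0 1).map (s * ·)) a +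
      pValueBound (gaussianReal 0 1) ((gaussianReal 0 1).map (s * ·)) (1 - a) ≤ 1 := by
  have := nullSingletonClass_stdNormal
  -- The thresholds `c` and `-c` that belong to the levels `a` and `1 - a` are opposite, and so are
  -- the tails of the symmetric law beyond them; they are approached from below by `c - δ` and
  -- `-(c + δ)`.
  obtain ⟨c, hc⟩ := exists_measureReal_Ioi_eq (γ := gaussianReal 0 1) ha0 (by linarith : a < 1)
  have hc0 : 0 < c := by
    refine strictAnti_stdNormal_Ioi.lt_iff_gt.1 ?_
    simp only [hc, stdNormal_Ioi_zero]
    exact ha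
  rcases hs0.eq_or_lt with rfl | hs
  · have h1 : pValueBound (gaussianReal 0 1) ((gaussianReal 0 1).map ((0 : ℝ) * ·)) a ≤ 0 := by
      refine (pValueBound_le (c := c / 2) ?_).trans ?_
      · rw [← hc]
        exact strictAnti_stdNormal_Ioi (by linarith)
      · rw [map_mul_Ici]
        have : {x : ℝ | c / 2 ≤ 0 * x} = ∅ := by
          ext x
          simp only [zero_mul, Set.mem_ofPred_eq, Set.mem_empty_iff_false, iff_false, not_le]
          linarith
        rw [this, measureReal_empty]
    linarith [pValueBound_le_one (gaussianReal 0 1) ((gaussianReal 0 1).map ((0 : ℝ) * ·)) (1 - a)]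
  · have htail : ∀ d, ((gaussianReal 0 1).map (s * ·)).real (Set.Ici d) =
        (gaussianReal 0 1).real (Set.Ioi (d / s)) := by
      intro d
      rw [map_mul_Ici, measureReal_congr (Ioi_ae_eq_Ici (μ := gaussianReal 0 1) (a := d / s))]
      congr 1
      ext x
      simp only [Set.mem_ofPred_eq, Set.mem_Ici, div_le_iff₀ hs, mul_comm]
    have hcont : Continuous fun δ : ℝ => (gaussianReal 0 1).real (Set.Ioi ((c - δ) / s)) +
        (gaussianReal 0 1).real (Set.Ioi (-(c + δ) / s)) :=
      (continuous_stdNormal_Ioi.comp (by fun_prop : Continuous fun δ : ℝ => (c - δ) / s)).add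
        (continuous_stdNormal_Ioi.comp (by fun_prop : Continuous fun δ : ℝ => -(c + δ) / s))
    have hlim := (hcont.tendsto 0).mono_left (nhdsWithin_le_nhds (s := Set.Ioi 0))
    simp only [sub_zero, add_zero, neg_div, stdNormal_Ioi_add_Ioi_neg] at hlim
    refine ge_of_tendsto hlim ?_
    filter_upwards [self_mem_nhdsWithin] with δ hδ
    have hδ0 : 0 < δ := hδ
    refine add_le_add ?_ ?_
    · rw [← htail]
      refine pValueBound_le ?_
      rw [← hc]
      exact strictAnti_stdNormal_Ioi (by linarith)
    · rw [← neg_div, ← htail]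
      refine pValueBound_le ?_
      have h1 : (gaussianReal 0 1).real (Set.Ioi (-c)) = 1 - a := by
        linarith [stdNormal_Ioi_add_Ioi_neg c]
      rw [← h1]
      exact strictAnti_stdNormal_Ioi (by linarith)

/-- An order statistic of rank at most the median rank favours `a` over its reflection `1 - a`. -/
theorem betaDensity_reflect_le {B k : ℕ} (hkB : 2 * k ≤ B + 1) (hk : 1 ≤ k) {a : ℝ} (ha0 : 0 ≤ a)
    (ha : a ≤ 1 / 2) : betaDensity B k (1 - a) ≤ betaDensity B k a := by
  obtain ⟨d, hd⟩ : ∃ d, B - 1 - (k - 1) = (k - 1) + d := ⟨B - 1 - (k - 1) - (k - 1), by omega⟩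
  rw [betaDensity, betaDensity, bernstein_eval, bernstein_eval, hd, sub_sub_cancel, pow_add,
      pow_add,
    mul_assoc (Nat.choose _ _ : ℝ), mul_assoc (Nat.choose _ _ : ℝ)]
  have h1 : a ^ d ≤ (1 - a) ^ d := pow_le_pow_left₀ ha0 (by linarith) d
  have h2 : 0 ≤ 1 - a := by linarith
  have h3 : (1 - a) ^ (k - 1) * (a ^ (k - 1) * a ^ d) ≤
      a ^ (k - 1) * ((1 - a) ^ (k - 1) * (1 - a) ^ d) := by
    calc (1 - a) ^ (k - 1) * (a ^ (k - 1) * a ^ d) =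
        a ^ (k - 1) * (1 - a) ^ (k - 1) * a ^ d := by ring
      _ ≤ a ^ (k - 1) * (1 - a) ^ (k - 1) * (1 - a) ^ d :=
          mul_le_mul_of_nonneg_left h1 (by positivity)
      _ = _ := by ring
  gcongr

theorem integral_eq_integral_add_reflect {g : ℝ → ℝ}
    (hg : ∀ a b, IntervalIntegrable g volume a b) :
    ∫ a in (0 : ℝ)..1, g a = ∫ a in (0 : ℝ)..(1 / 2), (g a + g (1 - a)) := by
  have h := intervalIntegral.integral_comp_sub_left (a := 0) (b := 1 / 2) g 1
  have hr : IntervalIntegrable (fun a => g (1 - a)) volume 0 (1 / 2) := by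
    simpa using (hg 1 (1 - 1 / 2)).comp_sub_left 1
  rw [intervalIntegral.integral_add (hg _ _) hr, h,
      ← intervalIntegral.integral_add_adjacent_intervals (hg 0 (1 / 2)) (hg (1 / 2) 1)]
  norm_num

/-- An order statistic of rank below the median puts more weight on `a` than on `1 - a` for
`a < 1 / 2`, so slack at the small levels outweighs the excess at the large ones. -/
theorem integral_mul_betaDensity_le_of_reflect {H : ℝ → ℝ} (hH : Measurable H)
    (hM : ∀ a, |H a| ≤ 1) (h1 : ∀ a, 0 < a → a < 1 / 2 → H a ≤ a)
    (h2 : ∀ a, 0 < a → a < 1 / 2 → H a + H (1 - a) ≤ 1) {B k : ℕ} (hk : 1 ≤ k) (hkB : k ≤ B)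
    (hk2 : 2 * k ≤ B + 1) :
    ∫ a in (0 : ℝ)..1, H a * betaDensity B k a ≤ (k : ℝ) / ((B : ℝ) + 1) := by
  have hw := continuous_betaDensity B k
  have hi := fun a b => intervalIntegrable_mul_betaDensity hH hM B k a b
  have hi' : ∀ a b, IntervalIntegrable (fun x => x * betaDensity B k x) volume a b := fun a b =>
    (by fun_prop : Continuous fun x => x * betaDensity B k x).intervalIntegrable a b
  have hr : ∀ {g : ℝ → ℝ}, (∀ a b, IntervalIntegrable g volume a b) →
      IntervalIntegrable (fun a => g a + g (1 - a)) volume 0 (1 / 2) := fun hg => by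
    refine (hg _ _).add ?_
    simpa using (hg 1 (1 - 1 / 2)).comp_sub_left 1
  rw [← integral_id_mul_betaDensity hk hkB, integral_eq_integral_add_reflect hi,
    integral_eq_integral_add_reflect hi']
  refine intervalIntegral.integral_mono_on_of_le_Ioo (by norm_num) (hr hi) (hr hi') fun a ha => ?_
  have hw1 := betaDensity_reflect_le hk2 hk ha.1.le ha.2.le
  have hw0 : 0 ≤ betaDensity B k (1 - a) :=
    betaDensity_nonneg (by linarith [ha.2]) (by linarith [ha.1])
  nlinarith [mul_nonneg (sub_nonneg.2 (h1 a ha.1 ha.2)) (sub_nonneg.2 hw1),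
    mul_nonneg hw0 (sub_nonneg.2 (h2 a ha.1 ha.2))]

/-- A standardized coordinate of a centered Gaussian vector is a multiple of a standard normal
variable. -/
theorem map_coordinate_div {κ : Type*} [Fintype κ] [DecidableEq κ] {S : Matrix κ κ ℝ}
    (hS : S.PosSemidef) (ℓ : κ) (u : ℝ) :
    (multivariateGaussian 0 S).map (fun x : EuclideanSpace ℝ κ => x ℓ / √u) =
      (gaussianReal 0 1).map (√(S ℓ ℓ) / √u * ·) := by
  have h := (measurePreserving_eval_multivariateGaussian (μ := 0) hS (i := ℓ)).map_eq
  have e : (fun x : EuclideanSpace ℝ κ => x ℓ / √u) = (· / √u) ∘ (fun x : EuclideanSpace ℝ κ =>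
      x ℓ) := rfl
  have hsq : (gaussianReal 0 1).map (√(S ℓ ℓ) * ·) = gaussianReal 0 (S ℓ ℓ).toNNReal := by
    rw [gaussianReal_map_const_mul, mul_zero, mul_one]
    congr 1
    ext
    simp [Real.sq_sqrt hS.diag_nonneg, hS.diag_nonneg]
  have e2 : (√(S ℓ ℓ) / √u * · : ℝ → ℝ) = (· / √u) ∘ (√(S ℓ ℓ) * ·) := by
    ext x
    simp only [Function.comp]
    ring
  rw [e, ← Measure.map_map (by fun_prop) (by fun_prop), h, e2,
    ← Measure.map_map (by fun_prop) (by fun_prop), hsq]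
  rfl

end OneSided

/-! ### Asymptotic validity of the tests -/

section Validity

open ProbabilityTheory

variable {L m : ℕ} {Y : (J : ℕ) → Outcomes (J * L)} {p : (J : ℕ) → Fin J → unitInterval}
  {pmin C : ℝ} {ν : ProbabilityMeasure (SessionData (L - m))}

/-- Asymptotic validity of the test based on a statistic with a Gaussian limit, computed from the
positions `e`. It suffices that the tail bound formed from the two limit laws satisfies the
criterion for asymptotic validity, for all matrices `S ≤ U` and `Q` that may occur. -/
theorem asymptoticallyValid_of_gaussianLimit {κ : Type*} [Fintype κ] [DecidableEq κ]
    (hasym : VectorAsymptotics m Y p pmin C ν)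
    (hna : ∀ J, NonAnticipating (Y J)) (hco : ∀ J, Carryover m (Y J))
    {e : κ → Fin (L - m)} (he : Function.Injective e) (hτ : ∀ J k, tau m (Y J) (e k) = 0)
    {stat : ∀ {J : ℕ}, (Fin J → unitInterval) → (Fin J → Bool) → (Fin J → κ → ℝ) → ℝ}
    {lim : Matrix κ κ ℝ → EuclideanSpace ℝ κ → ℝ} (hs : HasGaussianLimit stat lim)
    (hlim : ∀ U, Measurable (lim U)) {α η : ℝ} (hα0 : 0 < α) (hα1 : α < 1) (hη : 0 < η)
    (hbound : ∀ S U Q : Matrix κ κ ℝ, S.PosSemidef → U.PosDef → Q.PosDef →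
      (∀ t, t ⬝ᵥ (S *ᵥ t) ≤ t ⬝ᵥ (U *ᵥ t)) →
      (∀ a, α < a → a < α + η → pValueBound ((multivariateGaussian 0 Q).map (lim Q))
        ((multivariateGaussian 0 S).map (lim U)) a ≤ a) ∧
      ∀ B k : ℕ, 1 ≤ k → k ≤ B → (k : ℝ) ≤ α * ((B : ℝ) + 1) →
        ∫ a in (0 : ℝ)..1, pValueBound ((multivariateGaussian 0 Q).map (lim Q))
          ((multivariateGaussian 0 S).map (lim U)) a * betaDensity B k a ≤ (k : ℝ) / ((B : ℝ) +
              1)) :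
    AsymptoticallyValid m Y p (fun J z y => stat (p J) z (fun j k => y j (e k))) α := by
  obtain ⟨S, U, h⟩ := hasym.exists_arrayLimit e hτ
  have hQ : ((sigmaR (ν : Measure (SessionData (L - m)))).submatrix e e).PosDef :=
    hasym.nondegenerate.submatrix he
  have hcross : ∀ k l, Tendsto (fun J => crossCov (p J)
      (fun j k => focalOutcome m (Y J) true j (e k)) (fun j k =>
          focalOutcome m (Y J) false j (e k)) k l)
      atTop (𝓝 ((sigmaR (ν : Measure (SessionData (L - m)))).submatrix e e k l)) := fun k l =>
    hasym.tendsto_crossCov (e k) (e l)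
  have hU := h.up_posDef hcross hQ
  obtain ⟨h1, h2⟩ := hbound S U _ h.posSemidef hU hQ h.cov_le_up
  refine asymptoticallyValid_of_bound hα0 hα1 pValueBound_mono.measurable
    (pValueBound_nonneg _ _) (pValueBound_le_one _ _) (fun a _ _ b hb => ?_) hη h1 h2
  have hobs : ∀ J z, (fun j k => observed m (Y J) z j (e k)) =
      pick (fun j k => focalOutcome m (Y J) true j (e k)) (fun j k =>
          focalOutcome m (Y J) false j (e k)) z := by
    intro J z
    rw [observed_eq_pick (hna J) (hco J)]
    rfl
  have hp : ∀ J z, exactPValue (p J) (fun z y => stat (p J) z (fun j k => y j (e k))) z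
      (observed m (Y J) z) = exactPValue (p J) (stat (p J)) z
        (pick (fun j k => focalOutcome m (Y J) true j (e k)) (fun j k =>
            focalOutcome m (Y J) false j (e k)) z) := by
    intro J z
    rw [← hobs]
    rfl
  simp only [hp]
  obtain ⟨r, hr, hrb⟩ := exists_lt_of_csInf_lt (Set.insert_nonempty _ _) hb
  rcases hr with rfl | ⟨c, hc, rfl⟩
  · exact Eventually.of_forall fun J => measureReal_le_one.trans_lt hrb
  · rw [map_measureReal_apply (hlim _) measurableSet_Ioi] at hc
    rw [map_measureReal_apply (hlim _) measurableSet_Ici] at hrb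
    exact hs.exactPValue_bound hlim h hU hQ hcross hc hrb

/-- If the statistic is identically zero, every `p`-value is one. -/
theorem asymptoticallyValid_zero {α : ℝ} (hα : α < 1) : AsymptoticallyValid m Y p (fun _ _ _ =>
    0) α := by
  refine ⟨fun B => ?_, ?_⟩
  · have : ∀ J, {ω : (Fin J → Bool) × (Fin (B J) → Fin J → Bool) |
        mcPValue (fun _ _ => (0 : ℝ)) ω.1 ω.2 (observed m (Y J) ω.1) ≤ α} = ∅ := fun J => by
      refine Set.eq_empty_of_forall_notMem fun ω hω => ?_
      have hB : (B J : ℝ) + 1 ≠ 0 := by positivity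
      simp [mcPValue, hB] at hω
      linarith
    simp [this]
  · have : ∀ J, {z : Fin J → Bool |
        exactPValue (p J) (fun _ _ => (0 : ℝ)) z (observed m (Y J) z) ≤ α} = ∅ := fun J => by
      refine Set.eq_empty_of_forall_notMem fun z hz => ?_
      simp [exactPValue] at hz
      linarith
    simp [this]

/-- Validity of the test based on the quadratic form in the estimates at the positions `e`. -/
theorem asymptoticallyValid_quadratic {κ : Type*} [Fintype κ] [DecidableEq κ]
    (hasym : VectorAsymptotics m Y p pmin C ν)
    (hna : ∀ J, NonAnticipating (Y J)) (hco : ∀ J, Carryover m (Y J))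
    {e : κ → Fin (L - m)} (he : Function.Injective e) (hτ : ∀ J k, tau m (Y J) (e k) = 0)
    {ginv : Matrix κ κ ℝ → Matrix κ κ ℝ} (hg : IsInversion ginv) {α : ℝ} (hα0 : 0 < α)
        (hα1 : α < 1) :
    AsymptoticallyValid m Y p (fun J z y => quadStat ginv (p J) z (fun j k => y j (e k))) α := by
  cases isEmpty_or_nonempty κ
  · have : ∀ J z (y : Fin J → Fin (L - m) → ℝ),
        quadStat ginv (p J) z (fun j k => y j (e k)) = 0 := fun J z y => by
      simp [quadStat, dotProduct]
    simp only [this]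
    exact asymptoticallyValid_zero hα1
  refine asymptoticallyValid_of_gaussianLimit hasym hna hco he hτ (hasGaussianLimit_quadStat hg)
    measurable_quadratic hα0 hα1 (sub_pos.2 hα1) fun S U Q hS hU hQ hSU => ?_
  have hle := fun a (h0 : 0 < a) (h1 : a < 1) => pValueBound_quadratic_le hS hU hQ hSU h0 h1
  refine ⟨fun a h1 h2 => hle a (hα0.trans h1) (by linarith), fun B k hk hkB _ => ?_⟩
  rw [← integral_id_mul_betaDensity hk hkB]
  have hw := continuous_betaDensity B k
  refine intervalIntegral.integral_mono_on_of_le_Ioo zero_le_one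
    (intervalIntegrable_mul_betaDensity pValueBound_mono.measurable (M := 1) (fun a => ?_) B k 0 1)
    ((by fun_prop : Continuous fun x => x * betaDensity B k x).intervalIntegrable 0 1) fun a ha =>
        ?_
  · rw [abs_of_nonneg (pValueBound_nonneg _ _ _)]
    exact pValueBound_le_one _ _ _
  · exact mul_le_mul_of_nonneg_right (hle a ha.1 ha.2) (betaDensity_nonneg ha.1.le ha.2.le)

/-- Validity of the one-sided test based on the studentized estimate at one position. -/
theorem asymptoticallyValid_studentized (hasym : VectorAsymptotics m Y p pmin C ν)
    (hna : ∀ J, NonAnticipating (Y J)) (hco : ∀ J, Carryover m (Y J)) {ℓ : Fin (L - m)}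
    (hτ : ∀ J, tau m (Y J) ℓ = 0) {α : ℝ} (hα0 : 0 < α) (hα1 : α < 1 / 2) :
    AsymptoticallyValid m Y p (fun J => studentized ℓ (p J)) α := by
  refine asymptoticallyValid_of_gaussianLimit (κ := Unit) (e := fun _ => ℓ) hasym hna hco
    (fun _ _ _ => rfl) (fun J _ => hτ J) (hasGaussianLimit_studentized ()) (fun U => by fun_prop)
    hα0 (by linarith) (sub_pos.2 hα1) fun S U Q hS hU hQ hSU => ?_
  have hQ1 : √(Q () ()) / √(Q () ()) = 1 := div_self (Real.sqrt_pos.2 hQ.diag_pos).ne'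
  have hSU1 : S () () ≤ U () () := by
    simpa [dotProduct, Matrix.mulVec] using hSU 1
  have hs1 : √(S () ()) / √(U () ()) ≤ 1 := div_le_one_of_le₀ (Real.sqrt_le_sqrt hSU1)
      (Real.sqrt_nonneg _)
  have hs0 : 0 ≤ √(S () ()) / √(U () ()) := by positivity
  have hid : (gaussianReal 0 1).map ((1 : ℝ) * ·) = gaussianReal 0 1 := by simp
  rw [map_coordinate_div hQ.posSemidef () (Q () ()), map_coordinate_div hS () (U () ()), hQ1, hid]
  refine ⟨fun a h1 h2 => pValueBound_shrink_le hs0 hs1 (hα0.trans h1) (by linarith),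
      fun B k hk hkB hkα => ?_⟩
  refine integral_mul_betaDensity_le_of_reflect pValueBound_mono.measurable (fun a => ?_)
    (fun a => pValueBound_shrink_le hs0 hs1) (fun a => pValueBound_shrink_add_le hs0) hk hkB ?_
  · rw [abs_of_nonneg (pValueBound_nonneg _ _ _)]
    exact pValueBound_le_one _ _ _
  · have : (2 * k : ℝ) ≤ (B : ℝ) + 1 := by nlinarith [Nat.cast_nonneg (α := ℝ) B]
    exact_mod_cast this

end Validity

end Switchback

open Switchback in
theorem theorem4 (L m : ℕ) (hmL : m < L)
    (Y : (J : ℕ) → Outcomes (J * L)) (p : (J : ℕ) → Fin J → unitInterval)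
    (hna : ∀ J, NonAnticipating (Y J)) (hco : ∀ J, Carryover m (Y J))
    (pmin C : ℝ) (ν : MeasureTheory.ProbabilityMeasure (SessionData (L - m)))
    (hasym : VectorAsymptotics m Y p pmin C ν) :
    (∀ ℓ : Fin (L - m), (∀ J, tau m (Y J) ℓ = 0) →
      ∀ α : ℝ, 0 < α → α < 1 / 2 →
        AsymptoticallyValid m Y p (fun J => studentized ℓ (p J)) α) ∧
    (∀ ginv : Matrix (Fin (L - m)) (Fin (L - m)) ℝ → Matrix (Fin (L - m)) (Fin (L - m)) ℝ,
      IsInversion ginv → (∀ J, ∀ ℓ : Fin (L - m), tau m (Y J) ℓ = 0) →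
      ∀ α : ℝ, 0 < α → α < 1 →
        AsymptoticallyValid m Y p (fun J => quadStat ginv (p J)) α) ∧
    (∀ (S : Finset (Fin (L - m))) (ginv : Matrix S S ℝ → Matrix S S ℝ),
      IsInversion ginv → (∀ J, ∀ ℓ ∈ S, tau m (Y J) ℓ = 0) →
      ∀ α : ℝ, 0 < α → α < 1 →
        AsymptoticallyValid m Y p (fun J => quadStatOn S ginv (p J)) α) := by
  refine ⟨fun ℓ hτ α h0 h1 => asymptoticallyValid_studentized hasym hna hco hτ h0 h1,
    fun ginv hg hτ α h0 h1 => ?_, fun S ginv hg hτ α h0 h1 => ?_⟩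
  · exact asymptoticallyValid_quadratic hasym hna hco (e := id) Function.injective_id hτ hg h0 h1
  · exact asymptoticallyValid_quadratic hasym hna hco (e := Subtype.val) Subtype.val_injective
      (fun J k => hτ J k k.2) hg h0 h1
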